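/- **Notation.** Let $\gamma_R$ be a simple, piecewise $C^1$ contour contained in $\{\Re\lambda>0\}$, oriented upwards, which outside a compact set consists of two half-lines in the directions $e^{\pm i\pi/3}$; let $\gamma_L:=-\gamma_R$ (with the orientation carried over by $\lambda\mapsto-\lambda$). For real $\tau,x$ put $$\mathrm{Ai}^{(\tau)}(x)=\int_{\gamma_R}\frac{d\lambda}{2\pi i}\,e^{\lambda^3/3+\tau\lambda^2-x\lambda}=e^{\tau x+\frac23\tau^3}\mathrm{Ai}(x+\tau^2),\qquad \mathrm{Ai}=\mathrm{Ai}^{(0)},$$ (independent of the choice of $\gamma_R$), $$K_{\mathrm{Ai}}(z,w)=\int_0^\infty \mathrm{Ai}(z+u)\mathrm{Ai}(w+u)\,du,\qquad F_2(s)=\det\big(\mathrm{Id}-K_{\mathrm{Ai}}|_{[s,\infty)}\big),$$ $$K^{(\tau,-\tau)}_{\mathrm{Ai}}(x,y)=\int_0^\infty \mathrm{Ai}^{(\tau)}(x+u)\mathrm{Ai}^{(-\tau)}(y+u)\,du,$$ $$\mathcal A^\tau_x(z)=\mathrm{Ai}^{(\tau)}(x+\sqrt[3]2\,z)-\int_0^\infty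 \mathrm{Ai}^{(\tau)}(-x+\sqrt[3]2\,w)\,\mathrm{Ai}(w+z)\,dw .$$ For $\sigma\in\mathbb R$ let $\tilde\sigma=2^{2/3}\sigma$. The single-time tacnode kernel is $$\mathbb K^{\rm tac}(x,y)=K^{(\tau,-\tau)}_{\mathrm{Ai}}(\sigma-x,\sigma-y)+\sqrt[3]2\int_{\tilde\sigma}^\infty \Big(\big(\mathrm{Id}-K_{\mathrm{Ai}}|_{[\tilde\sigma,\infty)}\big)^{-1}\mathcal A^\tau_{x-\sigma}\Big)(z)\,\mathcal A^{-\tau}_{y-\sigma}(z)\,dz ,$$ and its rescaled version is $\widetilde{\mathbb K}(x,y)=\sqrt[3]2\,\mathbb K^{\rm tac}(\sigma+\sqrt[3]2\,x,\sigma+\sqrt[3]2\,y)$. All determinants are Fredholm determinants, $\det(\mathrm{Id}-K)=\sum_{n\ge0}\frac{(-1)^n}{n!}\int\det[K(x_i,x_j)]_{i,j\le n}\,dx_1\cdots dx_n$. The gap probability of the tacnode process on a set $I$ is $\det(\mathrm{Id}-\mathbb K^{\rm tac}|_I)$. **Theorem.** Let $\tau,\sigma\in\mathbb R$, $a_1<a_2<\dots<a_{2K}$,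 $I=[a_1,a_2]\cup\dots\cup[a_{2K-1},a_{2K}]$, $\tilde a_j=2^{-1/3}(a_j-\sigma)$ and $\tilde I=[\tilde a_1,\tilde a_2]\cup\dots\cup[\tilde a_{2K-1},\tilde a_{2K}]$. Put $$h_j(\zeta)=2^{-1/3}e^{\zeta^3/12+2^{-2/3}\tau\zeta^2-(\tilde a_j+\tilde\sigma)\zeta},\qquad g_j(\zeta)=2^{-1/3}e^{-\zeta^3/12+2^{-2/3}\tau\zeta^2-\tilde a_j\zeta},$$ with $h_j^{-1}=1/h_j$, $g_j^{-1}=1/g_j$. On $L^2(\gamma_L)\oplus L^2(\gamma_R)\oplus L^2(\gamma_L)\oplus L^2(\gamma_R)$ (the four copies of the contours being called $L_1,R_1,L_2,R_2$) let $\mathbb M$ be the integral operator, $(\mathbb M\varphi)_i(\xi)=\sum_j\int\mathbb M_{ij}(\xi,\zeta)\varphi_j(\zeta)\,d\zeta$, with the block kernel $$\mathbb M=\begin{bmatrix}0&-\widetilde H H&-\widetilde HA&0\\-Q_RQ_L&0&-Q_RA&0\\0&0&0&-C\\-BQ_L&-BH&-BA&0\end{bmatrix},$$ where the symbols denote the kernels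 (with $\lambda,\lambda_1,\lambda_2\in\gamma_R$ and $\mu,\mu_1,\mu_2\in\gamma_L$) $$Q_RQ_L(\lambda,\mu)=\frac{e^{(\lambda^3-\mu^3)/12}}{2\pi i(\lambda-\mu)},\quad BQ_L(\lambda,\mu)=\frac{e^{\lambda^3/4-\lambda\tilde\sigma-\mu^3/12}}{2\pi i(\lambda-\mu)},\quad Q_RA(\lambda,\mu)=\frac{e^{\mu\tilde\sigma-\mu^3/4+\lambda^3/12}}{2\pi i(\lambda-\mu)},\quad C(\mu,\lambda)=\frac{e^{(\lambda^3-\mu^3)/12}}{2\pi i(\mu-\lambda)},$$ $$\widetilde HH(\mu,\lambda)=\frac{\sum_{j=1}^{2K}(-1)^{j+1}h_j^{-1}(\mu)h_j(\lambda)}{2\pi i(\mu-\lambda)},\qquad \widetilde HA(\mu_1,\mu_2)=\frac{\sum_{j=1}^{2K}(-1)^{j+1}h_j^{-1}(\mu_1)g_j(\mu_2)}{2\pi i(\mu_1-\mu_2)},$$ $$BH(\lambda_2,\lambda_1)=\frac{\sum_{j=1}^{2K}(-1)^{j}g_j^{-1}(\lambda_2)h_j(\lambda_1)}{2\pi i(\lambda_2-\lambda_1)},\qquad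 BA(\lambda,\mu)=\frac{e^{(\lambda^3-\mu^3)/4+(\mu-\lambda)\tilde\sigma}}{2\pi i(\lambda-\mu)}+\frac{\sum_{j=1}^{2K}(-1)^jg_j^{-1}(\lambda)g_j(\mu)}{2\pi i(\lambda-\mu)} .$$ Then $\mathrm{Id}-K_{\mathrm{Ai}}|_{[\tilde\sigma,\infty)}$ is boundedly invertible on $L^2([\tilde\sigma,\infty))$, $\mathcal A^{t}_x\in L^2([\tilde\sigma,\infty))$ for all real $t,x$, $\mathbb M$ is a bounded operator, the Fredholm series involved converge absolutely, $F_2(\tilde\sigma)\ne0$, and $$\det\big(\mathrm{Id}-\mathbb K^{\rm tac}|_I\big)=\det\big(\mathrm{Id}-\widetilde{\mathbb K}|_{\tilde I}\big)=F_2(\tilde\sigma)^{-1}\,\det(\mathrm{Id}-\mathbb M).$$ Moreover $\mathbb M$ is of Its–Izergin–Korepin–Slavnov integrable form, that is $$\mathbb M(\xi,\zeta)=\frac{\mathbf f(\xi)^T\mathbf g(\zeta)}{2\pi i(\xi-\zeta)},$$ where $\mathbf f,\mathbf g$ have the $2K+2$ components $$\mathbf f_1=-e^{-\xi^3/12}\chi_{L_2},\quad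 \mathbf f_2=-e^{\xi^3/4-\xi\tilde\sigma}\chi_{R_2}-e^{\xi^3/12}\chi_{R_1},\quad \mathbf f_{2+j}=-(-1)^jg_j^{-1}(\xi)\chi_{R_2}+(-1)^jh_j^{-1}(\xi)\chi_{L_1},$$ $$\mathbf g_1=e^{\zeta^3/12}\chi_{R_2},\quad \mathbf g_2=e^{-\zeta^3/12}\chi_{L_1}+e^{-\zeta^3/4+\zeta\tilde\sigma}\chi_{L_2},\quad \mathbf g_{2+j}=g_j(\zeta)\chi_{L_2}+h_j(\zeta)\chi_{R_1}\qquad(1\le j\le 2K),$$ and the numerator $\mathbf f(\xi)^T\mathbf g(\zeta)$ vanishes whenever $\xi=\zeta$ as points of $\gamma_L$ or of $\gamma_R$, on the same or on different copies. -/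

import Mathlib

open MeasureTheory Set

noncomputable section

/-! ### Fredholm determinants and integral operators -/

/-- The `n`-th term `(-1)^n / n! ∫ det [K(x_i, x_j)]_{i,j ≤ n} dμ(x_1) ⋯ dμ(x_n)` of the Fredholm
series of the integral operator with kernel `K` on `L²(X, μ)`. -/
def fredholmTerm {X : Type} [MeasurableSpace X] (μ : Measure X) (K : X → X → ℂ) (n : ℕ) : ℂ :=
  (-1) ^ n / (n.factorial : ℂ) *
    ∫ x : Fin n → X, Matrix.det (Matrix.of fun i j => K (x i) (x j)) ∂(Measure.pi fun _ => μ)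

/-- All integrals in the Fredholm series exist and the series converges absolutely. -/
def FredholmConverges {X : Type} [MeasurableSpace X] (μ : Measure X) (K : X → X → ℂ) : Prop :=
  (∀ n : ℕ, Integrable (fun x : Fin n → X => Matrix.det (Matrix.of fun i j => K (x i) (x j)))
    (Measure.pi fun _ => μ)) ∧
  Summable (fredholmTerm μ K)

/-- The Fredholm determinant `det (Id - K)` of the integral operator with kernel `K` on
`L²(X, μ)`. -/
def fredholmDet {X : Type} [MeasurableSpace X] (μ : Measure X) (K : X → X → ℂ) : ℂ :=
  ∑' n : ℕ, fredholmTerm μ K n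

/-- `T` is the bounded operator on `L²(X, μ)` with integral kernel `K`. -/
def IsIntegralOperator {X : Type} [MeasurableSpace X] (μ : Measure X) (K : X → X → ℂ)
    (T : Lp ℂ 2 μ →L[ℂ] Lp ℂ 2 μ) : Prop :=
  ∀ f : Lp ℂ 2 μ, ∀ᵐ x ∂μ, Integrable (fun y => K x y * f y) μ ∧ T f x = ∫ y, K x y * f y ∂μ

open Classical in
/-- The bounded operator on `L²(X, μ)` with integral kernel `K` (it is unique; the value is `0` if
there is none). -/
def integralOperator {X : Type} [MeasurableSpace X] (μ : Measure X) (K : X → X → ℂ) :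
    Lp ℂ 2 μ →L[ℂ] Lp ℂ 2 μ :=
  if h : ∃ T, IsIntegralOperator μ K T then h.choose else 0

open Classical in
/-- The class in `L²(X, μ)` of a square integrable function (`0` for other functions). -/
def toL2 {X : Type} [MeasurableSpace X] (μ : Measure X) (f : X → ℂ) : Lp ℂ 2 μ :=
  if h : MemLp f 2 μ then h.toLp f else 0

/-! ### Contours -/

/-- `γ` is the arc length parametrization of a contour `γ_R`: a simple, piecewise `C¹` curve in the
open right half plane which, outside a compact set, consists of two half-lines in the directions
`e^{iπ/3}` and `e^{-iπ/3}`, and which is oriented upwards. -/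
structure IsAiryContour (γ : ℝ → ℂ) : Prop where
  continuous : Continuous γ
  injective : Function.Injective γ
  re_pos : ∀ t, 0 < (γ t).re
  piecewise_C1 : ∃ S : Finset ℝ, ∀ t ∉ S, ContDiffAt ℝ 1 γ t ∧ ‖deriv γ t‖ = 1
  upper_ray : ∃ T : ℝ, ∀ t ≥ T,
    γ t = γ T + ((t - T : ℝ) : ℂ) * Complex.exp ((Real.pi / 3 : ℝ) * Complex.I)
  lower_ray : ∃ T : ℝ, ∀ t ≤ T,
    γ t = γ T + ((T - t : ℝ) : ℂ) * Complex.exp (-((Real.pi / 3 : ℝ) * Complex.I))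

/-- The contour made of the two half-lines from `1` in the directions `e^{± iπ/3}`. -/
def wedgeContour (t : ℝ) : ℂ :=
  if 0 ≤ t then 1 + (t : ℂ) * Complex.exp ((Real.pi / 3 : ℝ) * Complex.I)
  else 1 + ((-t : ℝ) : ℂ) * Complex.exp (-((Real.pi / 3 : ℝ) * Complex.I))

/-! ### The Airy functions and the Airy kernel -/

/-- `Ai^{(τ)}(x) = ∫_{γ_R} e^{λ³/3 + τ λ² - x λ} dλ / (2πi)`. -/
def airyTau (τ x : ℝ) : ℂ :=
  (2 * Real.pi * Complex.I)⁻¹ * ∫ t : ℝ,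
    Complex.exp (wedgeContour t ^ 3 / 3 + τ * wedgeContour t ^ 2 - x * wedgeContour t)
      * deriv wedgeContour t

/-- The Airy function `Ai(x) = ∫_{γ_R} e^{λ³/3 - x λ} dλ / (2πi)`. -/
def airyAi (x : ℝ) : ℂ := airyTau 0 x

/-- The Airy kernel `K_Ai(z, w) = ∫_0^∞ Ai(z + u) Ai(w + u) du`. -/
def airyKernel (z w : ℝ) : ℂ := ∫ u in Ioi (0 : ℝ), airyAi (z + u) * airyAi (w + u)

/-- The operator `K_Ai` restricted to `[s, ∞)`. -/
def airyOperator (s : ℝ) :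
    Lp ℂ 2 (volume.restrict (Ici s)) →L[ℂ] Lp ℂ 2 (volume.restrict (Ici s)) :=
  integralOperator (volume.restrict (Ici s)) airyKernel

/-- The Tracy--Widom distribution `F_2(s) = det (Id - K_Ai|_{[s, ∞)})`. -/
def tracyWidomF2 (s : ℝ) : ℂ := fredholmDet (volume.restrict (Ici s)) airyKernel

/-! ### The tacnode kernel -/

/-- `2^{1/3}`. -/
def cbrtTwo : ℝ := (2 : ℝ) ^ ((1 : ℝ) / 3)

/-- `σ̃ = 2^{2/3} σ`. -/
def sigmaTilde (σ : ℝ) : ℝ := (2 : ℝ) ^ ((2 : ℝ) / 3) * σ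

/-- `𝒜^τ_x(z) = Ai^{(τ)}(x + 2^{1/3} z) - ∫_0^∞ Ai^{(τ)}(-x + 2^{1/3} w) Ai(w + z) dw`. -/
def calA (τ x z : ℝ) : ℂ :=
  airyTau τ (x + cbrtTwo * z) -
    ∫ w in Ioi (0 : ℝ), airyTau τ (-x + cbrtTwo * w) * airyAi (w + z)

/-- `K_Ai^{(τ, -τ)}(x, y) = ∫_0^∞ Ai^{(τ)}(x + u) Ai^{(-τ)}(y + u) du`. -/
def airyKernelTau (τ x y : ℝ) : ℂ :=
  ∫ u in Ioi (0 : ℝ), airyTau τ (x + u) * airyTau (-τ) (y + u)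

/-- The single-time tacnode kernel
`K_Ai^{(τ,-τ)}(σ - x, σ - y)
  + 2^{1/3} ∫_{σ̃}^∞ ((Id - K_Ai|_{[σ̃, ∞)})^{-1} 𝒜^τ_{x-σ})(z) 𝒜^{-τ}_{y-σ}(z) dz`. -/
def tacnodeKernel (τ σ x y : ℝ) : ℂ :=
  airyKernelTau τ (σ - x) (σ - y) +
    (cbrtTwo : ℂ) * ∫ z in Ici (sigmaTilde σ),
      (Ring.inverse (1 - airyOperator (sigmaTilde σ))
        (toL2 (volume.restrict (Ici (sigmaTilde σ))) (calA τ (x - σ)))) z * calA (-τ) (y - σ) z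

/-- The tacnode kernel in the variables `u' = 2^{-1/3} (u - σ)`. -/
def tacnodeKernelRescaled (τ σ x y : ℝ) : ℂ :=
  (cbrtTwo : ℂ) * tacnodeKernel τ σ (σ + cbrtTwo * x) (σ + cbrtTwo * y)

/-- The union `[a_1, a_2] ∪ [a_3, a_4] ∪ ⋯ ∪ [a_{2K-1}, a_{2K}]`. -/
def intervalUnion (K : ℕ) (a : ℕ → ℝ) : Set ℝ :=
  ⋃ k ∈ Finset.Icc 1 K, Icc (a (2 * k - 1)) (a (2 * k))

/-- The rescaled endpoints `ã_j = 2^{-1/3} (a_j - σ)`. -/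
def rescaledEndpoint (σ : ℝ) (a : ℕ → ℝ) (j : ℕ) : ℝ := (a j - σ) / cbrtTwo

/-- The probability that the single-time tacnode process has no particles in `I`:
`det (Id - K^tac|_I)`. -/
def tacnodeGapProbability (τ σ : ℝ) (I : Set ℝ) : ℂ :=
  fredholmDet (volume.restrict I) (tacnodeKernel τ σ)

/-! ### The block operator `𝕄`

In this part `s` stands for `σ̃` and `b j` for the rescaled endpoint `ã_j`, `1 ≤ j ≤ 2K`. -/

/-- `h_j(ζ) = 2^{-1/3} e^{ζ³/12 + 2^{-2/3} τ ζ² - (ã_j + σ̃) ζ}`. -/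
def hFun (τ s : ℝ) (b : ℕ → ℝ) (j : ℕ) (ζ : ℂ) : ℂ :=
  Complex.exp (ζ ^ 3 / 12 + (τ / (2 : ℝ) ^ ((2 : ℝ) / 3) : ℝ) * ζ ^ 2 - ((b j + s : ℝ) : ℂ) * ζ)
    / (cbrtTwo : ℂ)

/-- `g_j(ζ) = 2^{-1/3} e^{-ζ³/12 + 2^{-2/3} τ ζ² - ã_j ζ}`. -/
def gFun (τ : ℝ) (b : ℕ → ℝ) (j : ℕ) (ζ : ℂ) : ℂ :=
  Complex.exp (-ζ ^ 3 / 12 + (τ / (2 : ℝ) ^ ((2 : ℝ) / 3) : ℝ) * ζ ^ 2 - (b j : ℂ) * ζ)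
    / (cbrtTwo : ℂ)

def kernelQRQL (l m : ℂ) : ℂ :=
  Complex.exp ((l ^ 3 - m ^ 3) / 12) / (2 * Real.pi * Complex.I * (l - m))

def kernelBQL (s : ℝ) (l m : ℂ) : ℂ :=
  Complex.exp (l ^ 3 / 4 - l * s - m ^ 3 / 12) / (2 * Real.pi * Complex.I * (l - m))

def kernelQRA (s : ℝ) (l m : ℂ) : ℂ :=
  Complex.exp (m * s - m ^ 3 / 4 + l ^ 3 / 12) / (2 * Real.pi * Complex.I * (l - m))

def kernelC (m l : ℂ) : ℂ :=
  Complex.exp ((l ^ 3 - m ^ 3) / 12) / (2 * Real.pi * Complex.I * (m - l))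

def kernelHH (τ s : ℝ) (K : ℕ) (b : ℕ → ℝ) (m l : ℂ) : ℂ :=
  (∑ j ∈ Finset.Icc 1 (2 * K), (-1) ^ (j + 1) * (hFun τ s b j m)⁻¹ * hFun τ s b j l)
    / (2 * Real.pi * Complex.I * (m - l))

def kernelHA (τ s : ℝ) (K : ℕ) (b : ℕ → ℝ) (m₁ m₂ : ℂ) : ℂ :=
  (∑ j ∈ Finset.Icc 1 (2 * K), (-1) ^ (j + 1) * (hFun τ s b j m₁)⁻¹ * gFun τ b j m₂)
    / (2 * Real.pi * Complex.I * (m₁ - m₂))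

def kernelBH (τ s : ℝ) (K : ℕ) (b : ℕ → ℝ) (l₂ l₁ : ℂ) : ℂ :=
  (∑ j ∈ Finset.Icc 1 (2 * K), (-1) ^ j * (gFun τ b j l₂)⁻¹ * hFun τ s b j l₁)
    / (2 * Real.pi * Complex.I * (l₂ - l₁))

def kernelBABA (τ s : ℝ) (K : ℕ) (b : ℕ → ℝ) (l m : ℂ) : ℂ :=
  Complex.exp ((l ^ 3 - m ^ 3) / 4 + (m - l) * s) / (2 * Real.pi * Complex.I * (l - m)) +
    (∑ j ∈ Finset.Icc 1 (2 * K), (-1) ^ j * (gFun τ b j l)⁻¹ * gFun τ b j m)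
      / (2 * Real.pi * Complex.I * (l - m))

/-- The `4 × 4` matrix of kernels of `𝕄`; rows and columns are ordered `L₁, R₁, L₂, R₂`. -/
def blockM (τ s : ℝ) (K : ℕ) (b : ℕ → ℝ) : Matrix (Fin 4) (Fin 4) (ℂ → ℂ → ℂ) :=
  !![0, -kernelHH τ s K b, -kernelHA τ s K b, 0;
     -kernelQRQL, 0, -kernelQRA s, 0;
     0, 0, 0, -kernelC;
     -kernelBQL s, -kernelBH τ s K b, -kernelBABA τ s K b, 0]

/-- The parametrizations of the contours `L₁, R₁, L₂, R₂`, where `γ_R` is parametrized by `γ` and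
`γ_L = -γ_R` by `-γ`. -/
def leg (γ : ℝ → ℂ) : Fin 4 → ℝ → ℂ := ![-γ, γ, -γ, γ]

/-- The measure on the disjoint union of four copies of the parameter line. For an arc length
parametrization of `γ_R`, its `L²` space is `L²(γ_L) ⊕ L²(γ_R) ⊕ L²(γ_L) ⊕ L²(γ_R)`. -/
def legMeasure : Measure (Fin 4 × ℝ) := (Measure.count : Measure (Fin 4)).prod volume

/-- The kernel of `𝕄` with respect to `legMeasure`; the last factor is `dζ / dt`, so that
`(𝕄 φ)_i(ξ) = ∑_j ∫ 𝕄_{ij}(ξ, ζ) φ_j(ζ) dζ`. -/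
def kernelM (τ s : ℝ) (K : ℕ) (b : ℕ → ℝ) (γ : ℝ → ℂ) (p q : Fin 4 × ℝ) : ℂ :=
  blockM τ s K b p.1 q.1 (leg γ p.1 p.2) (leg γ q.1 q.2) * deriv (leg γ q.1) q.2

/-- The indicator `χ_{l}` of the contour with label `l`, evaluated on the contour `i`. -/
def chi (l i : Fin 4) : ℂ := if i = l then 1 else 0

/-- The vector `f(ξ) ∈ ℂ^{2K+2}` for `ξ` on the contour with label `i`. -/
def iiksF (τ s : ℝ) (K : ℕ) (b : ℕ → ℝ) (i : Fin 4) (ξ : ℂ) : Fin (2 * K + 2) → ℂ :=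
  Matrix.vecCons (-Complex.exp (-ξ ^ 3 / 12) * chi 2 i)
    (Matrix.vecCons
      (-Complex.exp (ξ ^ 3 / 4 - ξ * s) * chi 3 i - Complex.exp (ξ ^ 3 / 12) * chi 1 i)
      (fun j : Fin (2 * K) =>
        -(-1) ^ (j.val + 1) * (gFun τ b (j.val + 1) ξ)⁻¹ * chi 3 i
          + (-1) ^ (j.val + 1) * (hFun τ s b (j.val + 1) ξ)⁻¹ * chi 0 i))

/-- The vector `g(ζ) ∈ ℂ^{2K+2}` for `ζ` on the contour with label `i`. -/
def iiksG (τ s : ℝ) (K : ℕ) (b : ℕ → ℝ) (i : Fin 4) (ζ : ℂ) : Fin (2 * K + 2) → ℂ :=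
  Matrix.vecCons (Complex.exp (ζ ^ 3 / 12) * chi 3 i)
    (Matrix.vecCons
      (Complex.exp (-ζ ^ 3 / 12) * chi 0 i + Complex.exp (-ζ ^ 3 / 4 + ζ * s) * chi 2 i)
      (fun j : Fin (2 * K) =>
        gFun τ b (j.val + 1) ζ * chi 2 i + hFun τ s b (j.val + 1) ζ * chi 1 i))

end

/-!
The kernel of `𝕄` is a sum of compositions through three auxiliary spaces. Since
`1 / (ξ - ζ) = ∫_0^∞ e^{-u (ξ - ζ)} du` for `Re (ξ - ζ) > 0`, and since the alternating sums over the
endpoints are boundary terms of an integral of exponentials over `Ĩ`, one has, off a null set,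
`𝕄 = A₀ B₀ + A₂ B₂ + A₁ B₁` with factors through `L²(Ĩ)`, `L²([σ̃, ∞))` and `L²(0, ∞)` whose kernels
are exponentials of cubic polynomials (`kernelM_eq`). The identity `det (1 - A B) = det (1 - B A)`
(`fredholmDet_comp_comm`, `fredholmDet_tsum`) replaces `𝕄` by the operator `(B_i A_j)` on
`L²(Ĩ) ⊕ L²(0, ∞) ⊕ L²([σ̃, ∞))`. Its entries are contour integrals of exponentials of cubics, that
is, Airy functions, and its diagonal blocks vanish because the factors involved live on different
contours: the operator is `-[[0, a₁, a₂], [b₁, 0, Bt], [b₂, Bo, 0]]`, where `Bo` and `Bt` have the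
kernel `Ai(z + u)`, so that `Bo Bt = K_Ai` (`blockFactorization_factors`). Eliminating the first block
and factoring the remaining determinant (`BlockFactorization.fredholmDet_eq`) gives
`det (1 - 𝕄) = det (1 - Bt Bo) det (1 - a₁ c₁ - a₂ c₂)`, where `c₁ + Bt c₂ = b₁` and
`c₂ + Bo c₁ = b₂`. The first factor is `F₂(σ̃)` (`tracyWidomF2_eq`). In the second one
`c₂ = (1 - K_Ai)⁻¹ (b₂ - Bo b₁)`, and `b₂ - Bo b₁`, `a₂ - a₁ Bt` are the functions `𝒜^{∓τ}` up to
a constant, so that its kernel is the rescaled tacnode kernel (`tacnodeKernelRescaled_eq`).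

The determinants are Fredholm series of kernels and not of trace class operators. All kernels are
dominated by products `φ(x) ψ(y)` of square integrable functions, so Hadamard's inequality yields
absolute convergence (`IsDominatedBy.fredholmConverges`). The determinant of `B A` is taken as that of
an infinite matrix in Hilbert bases, for which multiplicativity and the Schur complement formula
follow from finite matrices by truncation (`fredholmDet_mul`, `fredholmDet_schur`).

Invertibility of `1 - K_Ai` on `[s, ∞)` rests on the Airy transform `f ↦ ∫ Ai(z + u) f(z) dz`, which
is a contraction of `L²` by Plancherel's theorem (`integral_airyTransform_sq_le`). An eigenfunction
`f` of `K_Ai` with eigenvalue `1` would have a transform whose norm on `(0, ∞)` is already `‖f‖`;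
hence the transform vanishes on `(-1, 0)`, and being the restriction of an entire function
(`exists_entire_airyTransform`) it vanishes identically, so `f = K_Ai f = 0`
(`eq_zero_of_airyKernel_fixed`). As `K_Ai` is compact, `1 - K_Ai` is invertible
(`airyOperator_spec`); multiplicativity of the determinant then gives `F₂ ≠ 0`.

The equality of the determinants on `I` and `Ĩ` is a change of variables (`fredholmTerm_comp`), and
the integrable form of `𝕄` is a finite computation (`blockM_eq_iiks`, `iiks_dotProduct_self`).
-/

noncomputable section

open scoped InnerProductSpace

/-! ### Hadamard's inequality and convergence of Fredholm series -/

section Hadamard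

open scoped ComplexOrder

/-- Hadamard's inequality for a matrix with entries in the unit disc. -/
theorem norm_det_le_of_norm_entry_le_one {n : ℕ} (M : Matrix (Fin n) (Fin n) ℂ)
    (h : ∀ i j, ‖M i j‖ ≤ 1) : ‖M.det‖ ≤ √n ^ n := by
  rcases Nat.eq_zero_or_pos n with rfl | hn
  · simp
  have hP := Matrix.posSemidef_self_mul_conjTranspose M
  have hdet : ((‖M.det‖ ^ 2 : ℝ) : ℂ) = ((∏ i, hP.isHermitian.eigenvalues i : ℝ) : ℂ) := by
    have h1 := hP.isHermitian.det_eq_prod_eigenvalues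
    rw [Matrix.det_mul, Matrix.det_conjTranspose, Complex.star_def, Complex.mul_conj,
      Complex.normSq_eq_norm_sq] at h1
    rw [h1]; push_cast; rfl
  have htr : ∑ i, hP.isHermitian.eigenvalues i ≤ n * n := by
    have h1 := hP.isHermitian.trace_eq_sum_eigenvalues
    have h2 : (M * M.conjTranspose).trace = ((∑ i, ∑ j, ‖M i j‖ ^ 2 : ℝ) : ℂ) := by
      simp [Matrix.trace, Matrix.mul_apply, Complex.mul_conj, Complex.normSq_eq_norm_sq]
    rw [h2] at h1
    have h3 : (∑ i, ∑ j, ‖M i j‖ ^ 2 : ℝ) = ∑ i, hP.isHermitian.eigenvalues i := by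
      have h4 : ((∑ i, ∑ j, ‖M i j‖ ^ 2 : ℝ) : ℂ) =
          ((∑ i, hP.isHermitian.eigenvalues i : ℝ) : ℂ) := by
        rw [h1]; push_cast; rfl
      exact Complex.ofReal_inj.mp h4
    rw [← h3]
    calc (∑ i, ∑ j, ‖M i j‖ ^ 2 : ℝ) ≤ ∑ _i : Fin n, ∑ _j : Fin n, (1 : ℝ) := by
          gcongr with i _ j _
          exact pow_le_one₀ (norm_nonneg _) (h i j)
      _ = n * n := by simp
  have hprod : ∏ i, hP.isHermitian.eigenvalues i ≤ (n : ℝ) ^ n := by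
    have h0 : ∀ i, 0 ≤ hP.isHermitian.eigenvalues i := hP.eigenvalues_nonneg
    have hn' : (0 : ℝ) < n := by exact_mod_cast hn
    have h1 := Real.geom_mean_le_arith_mean_weighted Finset.univ (fun _ : Fin n => (n : ℝ)⁻¹)
      hP.isHermitian.eigenvalues (fun _ _ => by positivity)
      (by simp [hn'.ne']) (fun i _ => h0 i)
    have h2 : ∑ i : Fin n, (n : ℝ)⁻¹ * hP.isHermitian.eigenvalues i ≤ n := by
      rw [← Finset.mul_sum]
      calc (n : ℝ)⁻¹ * ∑ i, hP.isHermitian.eigenvalues i ≤ (n : ℝ)⁻¹ * (n * n) := by gcongr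
        _ = n := by field_simp
    rw [Real.finsetProd_rpow _ _ (fun i _ => h0 i)] at h1
    have h3 := h1.trans h2
    have h4 : 0 ≤ ∏ i, hP.isHermitian.eigenvalues i := Finset.prod_nonneg fun i _ => h0 i
    calc ∏ i, hP.isHermitian.eigenvalues i
        = ((∏ i, hP.isHermitian.eigenvalues i) ^ (n : ℝ)⁻¹) ^ n := by
          rw [Real.rpow_inv_natCast_pow h4 hn.ne']
      _ ≤ (n : ℝ) ^ n := by gcongr
  have h5 : ‖M.det‖ ^ 2 ≤ (√n ^ n) ^ 2 := by
    rw [Complex.ofReal_inj.mp hdet, ← pow_mul, mul_comm n 2, pow_mul,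
      Real.sq_sqrt (Nat.cast_nonneg n)]
    exact hprod
  exact le_of_sq_le_sq h5 (by positivity)

/-- The weights `n^{n/2} / n!` of the Hadamard bound beat every geometric growth. -/
theorem summable_hadamard (C : ℝ) (hC : 0 ≤ C) :
    Summable fun n : ℕ => √n ^ n / n.factorial * C ^ n := by
  have h1 : Summable fun n : ℕ =>
      (1 / 2 : ℝ) * ((4 * C ^ 2 * Real.exp 1) ^ n / n.factorial + (1 / 4) ^ n) :=
    ((Real.summable_pow_div_factorial _).add
      (summable_geometric_of_lt_one (by norm_num) (by norm_num))).mul_left _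
  refine Summable.of_nonneg_of_le (fun n => by positivity) (fun n => ?_) h1
  set a : ℝ := √n ^ n / n.factorial * C ^ n with ha
  have hf : (0 : ℝ) < n.factorial := by exact_mod_cast n.factorial_pos
  have ha2 : a ^ 2 ≤ (C ^ 2 * Real.exp 1) ^ n / n.factorial := by
    have h2 : (n : ℝ) ^ n / n.factorial ≤ Real.exp 1 ^ n := by
      have := Real.pow_div_factorial_le_exp n (Nat.cast_nonneg n) n
      rwa [← Real.exp_one_rpow, Real.rpow_natCast] at this
    have h3 : a ^ 2 = (n : ℝ) ^ n / n.factorial * ((C ^ 2) ^ n / n.factorial) := by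
      rw [ha, mul_pow, div_pow, ← pow_mul, mul_comm n 2, pow_mul (√(n:ℝ)),
        Real.sq_sqrt (Nat.cast_nonneg n)]
      field_simp
      ring
    rw [h3, mul_pow]
    calc _ ≤ Real.exp 1 ^ n * ((C ^ 2) ^ n / n.factorial) := by gcongr
      _ = _ := by ring
  -- `a = (2^n a) 2^{-n}` is at most half the sum of the squares
  have h4 : a ≤ 1 / 2 * (4 ^ n * a ^ 2 + (1 / 4) ^ n) := by
    have h5 : (2 ^ n : ℝ) * (1 / 2) ^ n = 1 := by rw [← mul_pow]; norm_num
    have h6 := two_mul_le_add_sq (2 ^ n * a) ((1 / 2 : ℝ) ^ n)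
    have h7 : (2 ^ n * a) ^ 2 = 4 ^ n * a ^ 2 := by
      rw [mul_pow, ← pow_mul, mul_comm n 2, pow_mul]; norm_num
    have h8 : ((1 / 2 : ℝ) ^ n) ^ 2 = (1 / 4) ^ n := by
      rw [← pow_mul, mul_comm n 2, pow_mul]; norm_num
    have h9 : 2 * (2 ^ n * a) * (1 / 2 : ℝ) ^ n = 2 * a := by
      calc _ = 2 * a * ((2 ^ n : ℝ) * (1 / 2) ^ n) := by ring
        _ = _ := by rw [h5, mul_one]
    rw [h7, h8, h9] at h6
    linarith
  refine h4.trans ?_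
  have : 4 ^ n * a ^ 2 ≤ (4 * C ^ 2 * Real.exp 1) ^ n / n.factorial := by
    calc 4 ^ n * a ^ 2 ≤ 4 ^ n * ((C ^ 2 * Real.exp 1) ^ n / n.factorial) := by gcongr
      _ = _ := by rw [mul_assoc 4, mul_pow 4]; ring
  gcongr

/-- Hadamard's inequality for a kernel dominated by a product. -/
theorem norm_det_kernel_le {X : Type} {n : ℕ} (K : X → X → ℂ) (φ ψ : X → ℝ) (x : Fin n → X)
    (hφ : ∀ x, 0 ≤ φ x) (hψ : ∀ x, 0 ≤ ψ x)
    (h : ∀ i j, ‖K (x i) (x j)‖ ≤ φ (x i) * ψ (x j)) :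
    ‖Matrix.det (Matrix.of fun i j => K (x i) (x j))‖ ≤ √n ^ n * ∏ i, φ (x i) * ψ (x i) := by
  -- where a weight vanishes so does the entry, so that division by zero does no harm
  set N : Matrix (Fin n) (Fin n) ℂ :=
    Matrix.of fun i j => K (x i) (x j) / (φ (x i) * ψ (x j) : ℝ) with hN
  have hfac : (Matrix.of fun i j => K (x i) (x j)) =
      Matrix.of fun i j => (φ (x i) : ℂ) *
        (Matrix.of fun i j => (ψ (x j) : ℂ) * N i j) i j := by
    ext i j
    simp only [hN, Matrix.of_apply]
    by_cases h0 : φ (x i) * ψ (x j) = 0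
    · have : K (x i) (x j) = 0 := by
        have := h i j
        rw [h0] at this
        exact norm_le_zero_iff.mp this
      simp [this]
    · have h1 : (φ (x i) : ℂ) ≠ 0 := by
        exact_mod_cast left_ne_zero_of_mul h0
      have h2 : (ψ (x j) : ℂ) ≠ 0 := by
        exact_mod_cast right_ne_zero_of_mul h0
      push_cast
      field_simp
  rw [hfac, Matrix.det_mul_column (fun i => (φ (x i) : ℂ)), Matrix.det_mul_row, norm_mul, norm_mul,
    norm_prod, norm_prod, Finset.prod_mul_distrib]
  have hle : ‖N.det‖ ≤ √n ^ n := by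
    apply norm_det_le_of_norm_entry_le_one
    intro i j
    simp only [hN, Matrix.of_apply, norm_div, Complex.norm_real, Real.norm_eq_abs]
    rw [abs_of_nonneg (mul_nonneg (hφ _) (hψ _))]
    exact div_le_one_of_le₀ (h i j) (mul_nonneg (hφ _) (hψ _))
  simp only [Complex.norm_real, Real.norm_eq_abs, abs_of_nonneg (hφ _), abs_of_nonneg (hψ _)]
  have h1 : 0 ≤ ∏ i, φ (x i) := Finset.prod_nonneg fun i _ => hφ _
  have h2 : 0 ≤ ∏ i, ψ (x i) := Finset.prod_nonneg fun i _ => hψ _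
  calc _ ≤ (∏ i, φ (x i)) * ((∏ i, ψ (x i)) * √n ^ n) := by gcongr
    _ = _ := by ring

end Hadamard

section Fredholm

variable {X Y : Type} [MeasurableSpace X] [MeasurableSpace Y]

/-- The kernel `K` is dominated on a conull set by `φ ⊗ ψ` with `φ ψ` integrable. By Hadamard's
inequality this is enough for the convergence of the Fredholm series. -/
structure IsDominatedBy (μ : Measure X) (K : X → X → ℂ) (S : Set X) (φ ψ : X → ℝ) : Prop where
  conull : ∀ᵐ x ∂μ, x ∈ S
  nonneg_left : ∀ x, 0 ≤ φ x
  nonneg_right : ∀ x, 0 ≤ ψ x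
  integrable : Integrable (fun x => φ x * ψ x) μ
  bound : ∀ x ∈ S, ∀ y ∈ S, ‖K x y‖ ≤ φ x * ψ y

theorem ae_pi_forall {μ : Measure X} [SigmaFinite μ] {S : Set X} (hS : ∀ᵐ x ∂μ, x ∈ S) (n : ℕ) :
    ∀ᵐ x ∂(Measure.pi fun _ : Fin n => μ), ∀ i, x i ∈ S := by
  rw [ae_all_iff]
  exact fun i => Measure.tendsto_eval_ae_ae.eventually hS

theorem measurable_det_kernel {K : X → X → ℂ} (hK : Measurable (Function.uncurry K)) (n : ℕ) :
    Measurable fun x : Fin n → X => Matrix.det (Matrix.of fun i j => K (x i) (x j)) := by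
  simp only [Matrix.det_apply, Matrix.of_apply]
  refine Finset.measurable_sum _ fun σ _ => ?_
  refine Measurable.const_smul (Finset.measurable_prod _ fun i _ => ?_) _
  exact hK.comp (f := fun x : Fin n → X => (x (σ i), x i))
    ((measurable_pi_apply _).prodMk (measurable_pi_apply _))

variable {μ : Measure X} [SigmaFinite μ] {ν : Measure Y} [SigmaFinite ν]

theorem IsDominatedBy.norm_det_le {K : X → X → ℂ} {S : Set X} {φ ψ : X → ℝ}
    (hd : IsDominatedBy μ K S φ ψ) (n : ℕ) :
    ∀ᵐ x ∂(Measure.pi fun _ : Fin n => μ),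
      ‖Matrix.det (Matrix.of fun i j => K (x i) (x j))‖ ≤ √n ^ n * ∏ i, φ (x i) * ψ (x i) := by
  filter_upwards [ae_pi_forall hd.conull n] with x hx
  exact norm_det_kernel_le K φ ψ x hd.nonneg_left hd.nonneg_right
    fun i j => hd.bound _ (hx i) _ (hx j)

theorem IsDominatedBy.integrable_bound {K : X → X → ℂ} {S : Set X} {φ ψ : X → ℝ}
    (hd : IsDominatedBy μ K S φ ψ) (n : ℕ) :
    Integrable (fun x : Fin n → X => √n ^ n * ∏ i, φ (x i) * ψ (x i))
      (Measure.pi fun _ : Fin n => μ) :=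
  (Integrable.fintype_prod (f := fun _ : Fin n => fun x => φ x * ψ x)
    (μ := fun _ => μ) fun _ => hd.integrable).const_mul _

theorem IsDominatedBy.integrable_det {K : X → X → ℂ} {S : Set X} {φ ψ : X → ℝ}
    (hd : IsDominatedBy μ K S φ ψ) (hK : Measurable (Function.uncurry K)) (n : ℕ) :
    Integrable (fun x : Fin n → X => Matrix.det (Matrix.of fun i j => K (x i) (x j)))
      (Measure.pi fun _ => μ) :=
  (hd.integrable_bound n).mono' (measurable_det_kernel hK n).aestronglyMeasurable
    (hd.norm_det_le n)

theorem IsDominatedBy.norm_fredholmTerm_le {K : X → X → ℂ} {S : Set X} {φ ψ : X → ℝ}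
    (hd : IsDominatedBy μ K S φ ψ) (n : ℕ) :
    ‖fredholmTerm μ K n‖ ≤ √n ^ n / n.factorial * (∫ x, φ x * ψ x ∂μ) ^ n := by
  have h1 : ‖∫ x : Fin n → X, Matrix.det (Matrix.of fun i j => K (x i) (x j))
      ∂(Measure.pi fun _ => μ)‖ ≤ √n ^ n * (∫ x, φ x * ψ x ∂μ) ^ n := by
    refine (norm_integral_le_of_norm_le (hd.integrable_bound n) (hd.norm_det_le n)).trans ?_
    rw [integral_const_mul, integral_fintype_prod_eq_pow (𝕜 := ℝ) (fun x => φ x * ψ x)]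
    simp
  rw [fredholmTerm, norm_mul, norm_div, norm_pow, norm_neg, norm_one, one_pow,
    Complex.norm_natCast]
  calc _ ≤ 1 / (n.factorial : ℝ) * (√n ^ n * (∫ x, φ x * ψ x ∂μ) ^ n) := by gcongr
    _ = _ := by ring

omit [SigmaFinite μ] in
theorem IsDominatedBy.integral_nonneg {K : X → X → ℂ} {S : Set X} {φ ψ : X → ℝ}
    (hd : IsDominatedBy μ K S φ ψ) : 0 ≤ ∫ x, φ x * ψ x ∂μ :=
  MeasureTheory.integral_nonneg fun x => mul_nonneg (hd.nonneg_left x) (hd.nonneg_right x)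

theorem IsDominatedBy.fredholmConverges {K : X → X → ℂ} {S : Set X} {φ ψ : X → ℝ}
    (hd : IsDominatedBy μ K S φ ψ) (hK : Measurable (Function.uncurry K)) :
    FredholmConverges μ K :=
  ⟨hd.integrable_det hK, .of_norm_bounded (summable_hadamard _ hd.integral_nonneg)
    hd.norm_fredholmTerm_le⟩

/-- Fredholm determinants are continuous under dominated pointwise convergence of the kernels. -/
theorem tendsto_fredholmDet {ι : Type} {l : Filter ι} [l.IsCountablyGenerated]
    {F : ι → X → X → ℂ} {K : X → X → ℂ} {S : Set X} {φ ψ : X → ℝ}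
    (hF : ∀ j, Measurable (Function.uncurry (F j)))
    (hd : ∀ j, IsDominatedBy μ (F j) S φ ψ)
    (hlim : ∀ x ∈ S, ∀ y ∈ S, Filter.Tendsto (fun j => F j x y) l (nhds (K x y))) :
    Filter.Tendsto (fun j => fredholmDet μ (F j)) l (nhds (fredholmDet μ K)) := by
  rcases isEmpty_or_nonempty ι with hι | ⟨⟨j₀⟩⟩
  · rw [Filter.filter_eq_bot_of_isEmpty l]; exact Filter.tendsto_bot
  refine tendsto_tsum_of_dominated_convergence
    (summable_hadamard _ (hd j₀).integral_nonneg) (fun n => ?_)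
    (Filter.Eventually.of_forall fun j n => (hd j).norm_fredholmTerm_le n)
  refine Filter.Tendsto.const_mul _ ?_
  refine tendsto_integral_filter_of_dominated_convergence _
    (Filter.Eventually.of_forall fun j => (measurable_det_kernel (hF j) n).aestronglyMeasurable)
    (Filter.Eventually.of_forall fun j => (hd j).norm_det_le n) ((hd j₀).integrable_bound n) ?_
  filter_upwards [ae_pi_forall (hd j₀).conull n] with x hx
  simp only [Matrix.det_apply, Matrix.of_apply]
  exact tendsto_finsetSum _ fun σ _ =>
    (tendsto_finsetProd _ fun i _ => hlim _ (hx _) _ (hx _)).const_smul _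

/-! ### Dependence on null sets -/

theorem ae_pi_pair {P : X × X → Prop} (h : ∀ᵐ p ∂μ.prod μ, P p) {n : ℕ} {i j : Fin n}
    (hij : i ≠ j) : ∀ᵐ x ∂(Measure.pi fun _ : Fin n => μ), P (x i, x j) := by
  obtain ⟨m, rfl⟩ : ∃ m, n = m + 1 := ⟨n - 1, by have := i.2; omega⟩
  obtain ⟨k, rfl⟩ := Fin.exists_succAbove_eq hij.symm
  have hmp := measurePreserving_piFinSuccAbove (fun _ : Fin (m + 1) => μ) i
  have h2 : Measure.QuasiMeasurePreserving
      (fun p : X × (Fin m → X) => (p.1, p.2 k)) (μ.prod (Measure.pi fun _ => μ)) (μ.prod μ) :=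
    MeasureTheory.QuasiMeasurePreserving.prodMap (f := fun x : X => x)
      (g := fun y : Fin m → X => y k)
      (Measure.QuasiMeasurePreserving.id μ)
      (Measure.quasiMeasurePreserving_eval _ k)
  have h3 := hmp.quasiMeasurePreserving.tendsto_ae.eventually (h2.tendsto_ae.eventually h)
  filter_upwards [h3] with x hx
  exact hx

/-- The Fredholm series sees a kernel only up to null sets of `X × X` and of the diagonal. -/
theorem ae_det_congr {K K' : X → X → ℂ} (hdiag : ∀ᵐ x ∂μ, K x x = K' x x)
    (hoff : ∀ᵐ p ∂μ.prod μ, K p.1 p.2 = K' p.1 p.2) (n : ℕ) :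
    ∀ᵐ x ∂(Measure.pi fun _ : Fin n => μ),
      Matrix.det (Matrix.of fun i j => K (x i) (x j)) =
        Matrix.det (Matrix.of fun i j => K' (x i) (x j)) := by
  have : ∀ᵐ x ∂(Measure.pi fun _ : Fin n => μ), ∀ i j, K (x i) (x j) = K' (x i) (x j) := by
    simp only [ae_all_iff]
    intro i j
    by_cases hij : i = j
    · subst hij
      exact (Measure.tendsto_eval_ae_ae (μ := fun _ : Fin n => μ) (i := i)).eventually hdiag
    · exact ae_pi_pair hoff hij
  filter_upwards [this] with x hx
  simp only [hx]

theorem fredholmTerm_congr {K K' : X → X → ℂ} (hdiag : ∀ᵐ x ∂μ, K x x = K' x x)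
    (hoff : ∀ᵐ p ∂μ.prod μ, K p.1 p.2 = K' p.1 p.2) (n : ℕ) :
    fredholmTerm μ K n = fredholmTerm μ K' n := by
  rw [fredholmTerm, integral_congr_ae (ae_det_congr hdiag hoff n), ← fredholmTerm]

theorem fredholmDet_congr {K K' : X → X → ℂ} (hdiag : ∀ᵐ x ∂μ, K x x = K' x x)
    (hoff : ∀ᵐ p ∂μ.prod μ, K p.1 p.2 = K' p.1 p.2) :
    fredholmDet μ K = fredholmDet μ K' :=
  tsum_congr (fredholmTerm_congr hdiag hoff)

theorem FredholmConverges.congr {K K' : X → X → ℂ} (h : FredholmConverges μ K')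
    (hdiag : ∀ᵐ x ∂μ, K x x = K' x x) (hoff : ∀ᵐ p ∂μ.prod μ, K p.1 p.2 = K' p.1 p.2) :
    FredholmConverges μ K :=
  ⟨fun n => (h.1 n).congr ((ae_det_congr hdiag hoff n).mono fun _ h => h.symm), by
    rw [show fredholmTerm μ K = fredholmTerm μ K' from
      funext (fredholmTerm_congr hdiag hoff)]
    exact h.2⟩

end Fredholm

/-! ### The identity `det (1 - A B) = det (1 - B A)` -/

section Swap

variable {X Y : Type} [MeasurableSpace X] [MeasurableSpace Y]
variable {μ : Measure X} [SigmaFinite μ] {ν : Measure Y} [SigmaFinite ν]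

theorem measurePreserving_pi_comp_perm (n : ℕ) (σ : Equiv.Perm (Fin n)) :
    MeasurePreserving (fun (x : Fin n → X) i => x (σ i))
      (Measure.pi fun _ => μ) (Measure.pi fun _ => μ) := by
  have h := measurePreserving_piCongrLeft (α := fun _ : Fin n => X) (fun _ => μ) σ.symm
  convert h using 1
  funext x i
  have := Equiv.piCongrLeft_apply_apply (P := fun _ : Fin n => X) σ.symm x (σ i)
  rw [MeasurableEquiv.coe_piCongrLeft]
  simpa using this.symm

theorem integrable_prod_pair_perm {f : X × Y → ℝ} (hf : Integrable f (μ.prod ν)) (n : ℕ)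
    (σ : Equiv.Perm (Fin n)) :
    Integrable (fun p : (Fin n → X) × (Fin n → Y) => ∏ i, f (p.1 (σ i), p.2 i))
      ((Measure.pi fun _ => μ).prod (Measure.pi fun _ => ν)) := by
  have h1 : Integrable (fun p : (Fin n → X) × (Fin n → Y) => ∏ i, f (p.1 i, p.2 i))
      ((Measure.pi fun _ => μ).prod (Measure.pi fun _ => ν)) := by
    have hmp := measurePreserving_arrowProdEquivProdArrow X Y (Fin n) (fun _ => μ) (fun _ => ν)
    rw [← hmp.integrable_comp_emb (MeasurableEquiv.measurableEmbedding _)]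
    exact Integrable.fintype_prod (f := fun _ : Fin n => f) (μ := fun _ => μ.prod ν) fun _ => hf
  have h2 : MeasurePreserving
      (Prod.map (fun (x : Fin n → X) i => x (σ i)) (id : (Fin n → Y) → (Fin n → Y)))
      ((Measure.pi fun _ => μ).prod (Measure.pi fun _ => ν))
      ((Measure.pi fun _ => μ).prod (Measure.pi fun _ => ν)) :=
    (measurePreserving_pi_comp_perm n σ).prod (MeasurePreserving.id _)
  exact h2.integrable_comp_of_integrable h1

/-- The summands of the expanded determinants are integrable as soon as both kernels are square
integrable. -/
theorem integrable_perm_summand {A : X → Y → ℂ} {B : Y → X → ℂ}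
    (hA : Measurable (Function.uncurry A)) (hB : Measurable (Function.uncurry B))
    (hA2 : Integrable (fun p : X × Y => ‖A p.1 p.2‖ ^ 2) (μ.prod ν))
    (hB2 : Integrable (fun p : X × Y => ‖B p.2 p.1‖ ^ 2) (μ.prod ν)) (n : ℕ)
    (σ τ : Equiv.Perm (Fin n)) :
    Integrable (fun p : (Fin n → X) × (Fin n → Y) =>
      ∏ i, A (p.1 (σ i)) (p.2 i) * B (p.2 i) (p.1 (τ i)))
      ((Measure.pi fun _ => μ).prod (Measure.pi fun _ => ν)) := by
  have h1 := integrable_prod_pair_perm hA2 n σ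
  have h2 := integrable_prod_pair_perm hB2 n τ
  refine ((h1.add h2).const_mul (1 / 2)).mono' ?_ (Filter.Eventually.of_forall fun p => ?_)
  · refine (Finset.measurable_prod _ fun i _ => Measurable.mul ?_ ?_).aestronglyMeasurable
    · exact hA.comp (f := fun p : (Fin n → X) × (Fin n → Y) => (p.1 (σ i), p.2 i))
        (((measurable_pi_apply _).comp measurable_fst).prodMk
          ((measurable_pi_apply _).comp measurable_snd))
    · exact hB.comp (f := fun p : (Fin n → X) × (Fin n → Y) => (p.2 i, p.1 (τ i)))
        (((measurable_pi_apply _).comp measurable_snd).prodMk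
          ((measurable_pi_apply _).comp measurable_fst))
  · simp only [norm_prod, norm_mul, Finset.prod_mul_distrib, Pi.add_apply, Finset.prod_pow]
    have := two_mul_le_add_sq (∏ i, ‖A (p.1 (σ i)) (p.2 i)‖) (∏ i, ‖B (p.2 i) (p.1 (τ i))‖)
    linarith

theorem integral_det_comp {A : X → Y → ℂ} {B : Y → X → ℂ}
    (hA : Measurable (Function.uncurry A)) (hB : Measurable (Function.uncurry B))
    (hA2 : Integrable (fun p : X × Y => ‖A p.1 p.2‖ ^ 2) (μ.prod ν))
    (hB2 : Integrable (fun p : X × Y => ‖B p.2 p.1‖ ^ 2) (μ.prod ν)) (n : ℕ) :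
    ∫ x : Fin n → X, Matrix.det (Matrix.of fun i j => ∫ y, A (x i) y * B y (x j) ∂ν)
        ∂(Measure.pi fun _ => μ) =
      ∑ σ : Equiv.Perm (Fin n), (Equiv.Perm.sign σ : ℤ) •
        ∫ x : Fin n → X, ∫ y : Fin n → Y, ∏ i, A (x (σ i)) (y i) * B (y i) (x i)
          ∂(Measure.pi fun _ => ν) ∂(Measure.pi fun _ => μ) := by
  simp only [Matrix.det_apply, Matrix.of_apply]
  have h0 : ∀ (x : Fin n → X) (σ : Equiv.Perm (Fin n)),
      ∏ i, ∫ y, A (x (σ i)) y * B y (x i) ∂ν =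
        ∫ y : Fin n → Y, ∏ i, A (x (σ i)) (y i) * B (y i) (x i) ∂(Measure.pi fun _ => ν) :=
    fun x σ => (integral_fintype_prod_eq_prod (𝕜 := ℂ)
      (fun i y => A (x (σ i)) y * B y (x i))).symm
  simp only [h0]
  rw [integral_finsetSum]
  · refine Finset.sum_congr rfl fun σ _ => ?_
    simp only [Units.smul_def, zsmul_eq_mul]
    rw [integral_const_mul]
  · intro σ _
    simp only [Units.smul_def, zsmul_eq_mul]
    have := (integrable_perm_summand hA hB hA2 hB2 n σ 1).integral_prod_left
    exact this.const_mul _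

/-- Andréief's identity in the form `det (1 - A B) = det (1 - B A)`, term by term. -/
theorem fredholmTerm_comp_comm {A : X → Y → ℂ} {B : Y → X → ℂ}
    (hA : Measurable (Function.uncurry A)) (hB : Measurable (Function.uncurry B))
    (hA2 : Integrable (fun p : X × Y => ‖A p.1 p.2‖ ^ 2) (μ.prod ν))
    (hB2 : Integrable (fun p : X × Y => ‖B p.2 p.1‖ ^ 2) (μ.prod ν)) (n : ℕ) :
    fredholmTerm μ (fun x x' => ∫ y, A x y * B y x' ∂ν) n =
      fredholmTerm ν (fun y y' => ∫ x, B y x * A x y' ∂μ) n := by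
  unfold fredholmTerm
  congr 1
  rw [integral_det_comp hA hB hA2 hB2, integral_det_comp hB hA hB2.swap hA2.swap]
  refine Finset.sum_congr rfl fun σ _ => ?_
  congr 1
  have h1 : ∀ x : Fin n → X, ∫ y : Fin n → Y, ∏ i, A (x (σ i)) (y i) * B (y i) (x i)
        ∂(Measure.pi fun _ => ν) =
      ∫ y : Fin n → Y, ∏ i, A (x i) (y i) * B (y (σ i)) (x i) ∂(Measure.pi fun _ => ν) := by
    intro x
    rw [← (measurePreserving_piCongrLeft (α := fun _ : Fin n => Y) (fun _ => ν) σ).integral_comp'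
      (fun y => ∏ i, A (x i) (y i) * B (y (σ i)) (x i))]
    refine integral_congr_ae (Filter.Eventually.of_forall fun y => ?_)
    have h2 : ∀ i, MeasurableEquiv.piCongrLeft (fun _ : Fin n => Y) σ y (σ i) = y i := fun i => by
      rw [MeasurableEquiv.coe_piCongrLeft, Equiv.piCongrLeft_apply_apply]
    simp only [Finset.prod_mul_distrib, h2]
    congr 1
    rw [← Equiv.prod_comp σ fun i =>
      A (x i) (MeasurableEquiv.piCongrLeft (fun _ : Fin n => Y) σ y i)]
    simp only [h2]
  simp only [h1]
  rw [integral_integral_swap]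
  · simp only [mul_comm]
  · have h3 := (integrable_perm_summand hB hA hB2.swap hA2.swap n σ 1).swap
    refine h3.congr (Filter.Eventually.of_forall fun p => ?_)
    simp [Function.uncurry, mul_comm]

theorem fredholmDet_comp_comm {A : X → Y → ℂ} {B : Y → X → ℂ}
    (hA : Measurable (Function.uncurry A)) (hB : Measurable (Function.uncurry B))
    (hA2 : Integrable (fun p : X × Y => ‖A p.1 p.2‖ ^ 2) (μ.prod ν))
    (hB2 : Integrable (fun p : X × Y => ‖B p.2 p.1‖ ^ 2) (μ.prod ν)) :
    fredholmDet μ (fun x x' => ∫ y, A x y * B y x' ∂ν) =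
      fredholmDet ν (fun y y' => ∫ x, B y x * A x y' ∂μ) :=
  tsum_congr (fredholmTerm_comp_comm hA hB hA2 hB2)

end Swap

/-! ### Infinite matrices and their determinants -/

instance Sum.instDiscreteMeasurableSpace {α β : Type} [MeasurableSpace α] [MeasurableSpace β]
    [DiscreteMeasurableSpace α] [DiscreteMeasurableSpace β] : DiscreteMeasurableSpace (α ⊕ β) :=
  ⟨fun _ => measurableSet_sum_iff.mpr ⟨.of_discrete, .of_discrete⟩⟩

section Finite

variable {F : Type} [Fintype F] [DecidableEq F]

theorem sum_det_submatrix_eq_factorial_mul (G : Matrix F F ℂ) (n : ℕ) :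
    ∑ f : Fin n → F, (G.submatrix f f).det =
      n.factorial * ∑ s ∈ (Finset.univ : Finset F).powersetCard n,
        (G.submatrix (Subtype.val : s → F) (Subtype.val : s → F)).det := by
  classical
  have h1 : ∑ f : Fin n → F, (G.submatrix f f).det =
      ∑ f ∈ Finset.univ.filter (fun f : Fin n → F => Function.Injective f),
        (G.submatrix f f).det := by
    symm
    refine Finset.sum_subset (Finset.subset_univ _) fun f _ hf => ?_
    have hf : ¬ Function.Injective f := fun h => hf (by simpa using h)
    simp only [Function.Injective, not_forall] at hf
    obtain ⟨i, j, hij, hne⟩ := hf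
    exact Matrix.det_zero_of_row_eq hne (by ext k; simp [hij])
  rw [h1, ← Finset.sum_fiberwise_of_maps_to (s := Finset.univ.filter _)
    (t := (Finset.univ : Finset F).powersetCard n) (g := fun f : Fin n → F => Finset.univ.image f),
    Finset.mul_sum]
  · refine Finset.sum_congr rfl fun s hs => ?_
    have hcard : s.card = n := (Finset.mem_powersetCard.mp hs).2
    have hE : (Fintype.card (Fin n ≃ s)) = n.factorial := by
      rw [Fintype.card_equiv (Fintype.equivOfCardEq (by simp [hcard])), Fintype.card_fin]
    rw [← hE, ← Finset.card_univ, ← nsmul_eq_mul, ← Finset.sum_const]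
    symm
    refine Finset.sum_bij (fun (e : Fin n ≃ s) _ => fun i => (e i : F)) ?_ ?_ ?_ ?_
    · intro e _
      simp only [Finset.mem_filter, Finset.mem_univ, true_and]
      refine ⟨Subtype.val_injective.comp e.injective, ?_⟩
      ext x
      simp only [Finset.mem_image, Finset.mem_univ, true_and]
      exact ⟨fun ⟨i, hi⟩ => hi ▸ (e i).2, fun hx => ⟨e.symm ⟨x, hx⟩, by simp⟩⟩
    · intro e _ e' _ h
      ext i
      exact congrFun h i
    · intro f hf
      simp only [Finset.mem_filter, Finset.mem_univ, true_and] at hf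
      obtain ⟨hinj, him⟩ := hf
      refine ⟨Equiv.ofBijective (fun i => (⟨f i, him ▸ Finset.mem_image_of_mem f
        (Finset.mem_univ i)⟩ : s)) ⟨fun i j h => hinj (congrArg Subtype.val h), ?_⟩,
        Finset.mem_univ _, rfl⟩
      rintro ⟨x, hx⟩
      rw [← him] at hx
      obtain ⟨i, _, rfl⟩ := Finset.mem_image.mp hx
      exact ⟨i, rfl⟩
    · intro e _
      rw [← Matrix.det_submatrix_equiv_self e]
      rfl
  · intro f hf
    simp only [Finset.mem_filter, Finset.mem_univ, true_and] at hf
    rw [Finset.mem_powersetCard]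
    exact ⟨Finset.subset_univ _, by rw [Finset.card_image_of_injective _ hf]; simp⟩

variable [MeasurableSpace F] [DiscreteMeasurableSpace F]

/-- On a finite set the Fredholm determinant is the determinant of a matrix. -/
theorem fredholmDet_count_fintype (G : F → F → ℂ) :
    fredholmDet (Measure.count : Measure F) G = (1 - Matrix.of G).det := by
  open Polynomial in
  set P : ℂ[X] := (1 + (X : ℂ[X]) • (Matrix.of G).map C).det with hP
  have hterm : ∀ n, fredholmTerm (Measure.count : Measure F) G n = P.coeff n * (-1) ^ n := by
    intro n
    have hsum : ∫ x : Fin n → F, Matrix.det (Matrix.of fun i j => G (x i) (x j))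
        ∂(Measure.pi fun _ => Measure.count) =
        ∑ f : Fin n → F, ((Matrix.of G).submatrix f f).det := by
      rw [integral_fintype]
      · refine Finset.sum_congr rfl fun f _ => ?_
        have : (Measure.pi fun _ : Fin n => (Measure.count : Measure F)).real {f} = 1 := by
          rw [measureReal_def, Measure.pi_singleton]
          simp
        rw [this, one_smul]
        rfl
      · exact Integrable.of_finite
    rw [fredholmTerm, hsum, sum_det_submatrix_eq_factorial_mul, hP,
      Matrix.coeff_det_one_add_X_smul_eq_sum_minors]
    have : (n.factorial : ℂ) ≠ 0 := by exact_mod_cast n.factorial_ne_zero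
    field_simp
  have heval : (1 - Matrix.of G).det = P.eval (-1) := by
    rw [hP, ← Polynomial.coe_evalRingHom, RingHom.map_det]
    congr 1
    ext i j
    simp [Matrix.one_apply, sub_eq_add_neg]
    split_ifs <;> simp
  rw [heval, Polynomial.eval_eq_sum_range, fredholmDet]
  rw [tsum_eq_sum (s := Finset.range (P.natDegree + 1))]
  · exact Finset.sum_congr rfl fun n _ => hterm n
  · intro n hn
    rw [hterm, Polynomial.coeff_eq_zero_of_natDegree_lt (by simpa using hn), zero_mul]

end Finite

section Discrete

variable {X κ : Type} [MeasurableSpace X] [MeasurableSpace κ] [DiscreteMeasurableSpace κ]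
  [Countable κ] {μ : Measure X} [SigmaFinite μ]

theorem measurable_uncurry_of_countable_right {A : X → κ → ℂ}
    (hA : ∀ k, Measurable fun x => A x k) :
    Measurable (Function.uncurry A) :=
  measurable_from_prod_countable_left fun k => hA k

theorem integral_count_eq_tsum {f : κ → ℂ} (hf : Summable fun k => ‖f k‖) :
    ∫ k, f k ∂(Measure.count : Measure κ) = ∑' k, f k := by
  rw [integral_countable (integrable_count_iff.mpr hf)]
  simp

omit [SigmaFinite μ] in
/-- A kernel on `X × κ` whose rows have square integrable `ℓ²` norms is square integrable. -/
theorem integrable_sq_prod_count {A : X → κ → ℂ} (hA : ∀ k, Measurable fun x => A x k)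
    {φ : X → ℝ} (hφ : Integrable (fun x => φ x ^ 2) μ)
    (h : ∀ᵐ x ∂μ, (Summable fun k => ‖A x k‖ ^ 2) ∧ ∑' k, ‖A x k‖ ^ 2 ≤ φ x ^ 2) :
    Integrable (fun p : X × κ => ‖A p.1 p.2‖ ^ 2) (μ.prod Measure.count) := by
  have hm : AEStronglyMeasurable (fun p : X × κ => ‖A p.1 p.2‖ ^ 2) (μ.prod Measure.count) :=
    ((measurable_uncurry_of_countable_right hA).norm.pow_const 2).aestronglyMeasurable
  rw [integrable_prod_iff hm]
  have hs : ∀ᵐ x ∂μ, Integrable (fun k => ‖A x k‖ ^ 2) (Measure.count : Measure κ) := by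
    filter_upwards [h] with x hx
    exact integrable_count_iff.mpr hx.1.norm
  refine ⟨hs, hφ.mono' hm.norm.integral_prod_right' ?_⟩
  filter_upwards [h, hs] with x hx hxs
  rw [Real.norm_of_nonneg (integral_nonneg fun _ => norm_nonneg _)]
  simp only [norm_pow, norm_norm]
  rw [integral_countable hxs]
  simpa using hx.2

/-- A matrix (possibly rectangular) with entries dominated by `φ_k ψ_l`, where `φ, ψ ∈ ℓ²`. Such
matrices are of trace class, and they are closed under sums and products. -/
def IsEllTwoDominated {κ κ' : Type} (G : κ → κ' → ℂ) : Prop :=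
  ∃ (φ : κ → ℝ) (ψ : κ' → ℝ), (∀ k, 0 ≤ φ k) ∧ (∀ l, 0 ≤ ψ l) ∧
    (Summable fun k => φ k ^ 2) ∧ (Summable fun l => ψ l ^ 2) ∧ ∀ k l, ‖G k l‖ ≤ φ k * ψ l

theorem summable_mul_of_sq {κ : Type} {φ ψ : κ → ℝ} (hφ : Summable fun k => φ k ^ 2)
    (hψ : Summable fun k => ψ k ^ 2) : Summable fun k => φ k * ψ k := by
  refine Summable.of_norm_bounded ((hφ.add hψ).mul_left (1 / 2)) fun k => ?_
  rw [Real.norm_eq_abs, abs_le]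
  constructor <;> nlinarith [sq_nonneg (φ k + ψ k), sq_nonneg (φ k - ψ k)]

theorem summable_add_sq {κ : Type} {φ ψ : κ → ℝ} (hφ : Summable fun k => φ k ^ 2)
    (hψ : Summable fun k => ψ k ^ 2) : Summable fun k => (φ k + ψ k) ^ 2 := by
  have := (hφ.add hψ).add ((summable_mul_of_sq hφ hψ).mul_left 2)
  exact this.congr fun k => by ring

theorem isDominatedBy_count {G : κ → κ → ℂ} {φ ψ : κ → ℝ} (hφ0 : ∀ k, 0 ≤ φ k)
    (hψ0 : ∀ k, 0 ≤ ψ k) (hφ : Summable fun k => φ k ^ 2) (hψ : Summable fun k => ψ k ^ 2)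
    (h : ∀ k l, ‖G k l‖ ≤ φ k * ψ l) : IsDominatedBy Measure.count G univ φ ψ :=
  ⟨by simp, hφ0, hψ0, integrable_count_iff.mpr (summable_mul_of_sq hφ hψ).norm,
    fun k _ l _ => h k l⟩

open Classical in
/-- Truncating the rows of an infinite matrix to a finite set leaves a finite determinant. -/
theorem fredholmDet_truncate {F : Type} [Fintype F] [DecidableEq F] {e : F → κ}
    (he : Function.Injective e) {G : κ → κ → ℂ} (hG : ∀ k, Summable fun l => ‖G k l‖ ^ 2) :
    fredholmDet Measure.count (fun k l => if k ∈ range e then G k l else 0) =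
      (1 - Matrix.of fun i j => G (e i) (e j)).det := by
  let _ : MeasurableSpace F := ⊤
  set A : κ → F → ℂ := fun k j => if k = e j then 1 else 0 with hA
  set B : F → κ → ℂ := fun j l => G (e j) l with hB
  have hAm : Measurable (Function.uncurry A) := Measurable.of_discrete
  have hBm : Measurable (Function.uncurry B) := Measurable.of_discrete
  have hB2 : Integrable (fun p : F × κ => ‖B p.1 p.2‖ ^ 2) (Measure.count.prod Measure.count) :=
    integrable_sq_prod_count (fun k => Measurable.of_discrete)
      (φ := fun j => √(∑' l, ‖B j l‖ ^ 2)) Integrable.of_finite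
      (Filter.Eventually.of_forall fun j => ⟨hG (e j), by
        rw [Real.sq_sqrt (tsum_nonneg fun l => by positivity)]⟩)
  have hAs : ∀ j, Summable fun k => ‖A k j‖ ^ 2 := fun j =>
    summable_of_hasFiniteSupport ((Set.finite_singleton (e j)).subset fun k hk => by
      by_contra hne
      simp only [mem_singleton_iff] at hne
      simp [hA, hne] at hk)
  have hA2 : Integrable (fun p : F × κ => ‖A p.2 p.1‖ ^ 2) (Measure.count.prod Measure.count) :=
    integrable_sq_prod_count (A := fun j k => A k j) (fun k => Measurable.of_discrete)
      (φ := fun j => √(∑' l, ‖A l j‖ ^ 2)) Integrable.of_finite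
      (Filter.Eventually.of_forall fun j => ⟨hAs j, by
        rw [Real.sq_sqrt (tsum_nonneg fun l => by positivity)]⟩)
  have hswap := fredholmDet_comp_comm hAm hBm hA2.swap hB2.swap
  have hAB : (fun k l => ∫ j, A k j * B j l ∂(Measure.count : Measure F)) =
      fun k l => if k ∈ range e then G k l else 0 := by
    funext k l
    rw [integral_count_eq_tsum (.of_finite), tsum_fintype]
    split_ifs with hk
    · obtain ⟨j, rfl⟩ := hk
      rw [Finset.sum_eq_single j]
      · simp [hA, hB]
      · intro i _ hij
        simp [hA, he.eq_iff, hij.symm]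
      · simp
    · refine Finset.sum_eq_zero fun j _ => ?_
      have : k ≠ e j := fun h => hk ⟨j, h.symm⟩
      simp [hA, this]
  have hBA : (fun i j => ∫ l, B i l * A l j ∂(Measure.count : Measure κ)) =
      fun i j => G (e i) (e j) := by
    funext i j
    have h0 : ∀ l, l ≠ e j → B i l * A l j = 0 := fun l hl => by simp [hA, hl]
    rw [integral_count_eq_tsum, tsum_eq_single (e j) h0]
    · simp [hA, hB]
    · exact summable_of_hasFiniteSupport ((Set.finite_singleton (e j)).subset fun k hk => by
        by_contra hne
        simp only [mem_singleton_iff] at hne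
        exact hk (by simp [h0 k hne]))
  rw [hAB, hBA] at hswap
  rw [hswap, fredholmDet_count_fintype]

theorem summable_sq_row {κ κ' : Type} {G : κ → κ' → ℂ} {φ : κ → ℝ} {ψ : κ' → ℝ}
    (hψ : Summable fun k => ψ k ^ 2)
    (h : ∀ k l, ‖G k l‖ ≤ φ k * ψ l) (k : κ) : Summable fun l => ‖G k l‖ ^ 2 := by
  refine Summable.of_nonneg_of_le (fun _ => by positivity) (fun l => ?_) (hψ.mul_left (φ k ^ 2))
  calc ‖G k l‖ ^ 2 ≤ (φ k * ψ l) ^ 2 := by gcongr; exact h k l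
    _ = _ := by ring

open Classical in
/-- The determinants of truncations, possibly of approximate matrices `G j`, converge to the
determinant of the infinite matrix. -/
theorem tendsto_det_truncate {J : Type} {l : Filter J} [l.IsCountablyGenerated]
    {F : J → Type} [∀ j, Fintype (F j)] [∀ j, DecidableEq (F j)] {e : ∀ j, F j → κ}
    (he : ∀ j, Function.Injective (e j))
    (hex : ∀ k, ∀ᶠ j in l, k ∈ range (e j))
    {G : J → κ → κ → ℂ} {G' : κ → κ → ℂ} {φ ψ : κ → ℝ} (hφ0 : ∀ k, 0 ≤ φ k)
    (hψ0 : ∀ k, 0 ≤ ψ k) (hφ : Summable fun k => φ k ^ 2) (hψ : Summable fun k => ψ k ^ 2)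
    (h : ∀ j k l, ‖G j k l‖ ≤ φ k * ψ l)
    (hlim : ∀ k m, Filter.Tendsto (fun j => G j k m) l (nhds (G' k m))) :
    Filter.Tendsto (fun j => (1 - Matrix.of fun i i' => G j (e j i) (e j i')).det) l
      (nhds (fredholmDet Measure.count G')) := by
  have h1 : ∀ j, (1 - Matrix.of fun i i' => G j (e j i) (e j i')).det =
      fredholmDet Measure.count (fun k l => if k ∈ range (e j) then G j k l else 0) := fun j =>
    (fredholmDet_truncate (he j) fun k => summable_sq_row hψ (h j) k).symm
  simp only [h1]
  refine tendsto_fredholmDet (S := univ) (φ := φ) (ψ := ψ) (fun j => Measurable.of_discrete)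
    (fun j => isDominatedBy_count hφ0 hψ0 hφ hψ fun k l => ?_) fun k _ m _ => ?_
  · split_ifs
    · exact h j k l
    · simpa using mul_nonneg (hφ0 k) (hψ0 l)
  · refine (hlim k m).congr' ?_
    filter_upwards [hex k] with j hj
    rw [if_pos hj]

theorem summable_entries_mul {κ₁ κ₂ κ₃ : Type} {G₁ : κ₁ → κ₂ → ℂ} {G₂ : κ₂ → κ₃ → ℂ}
    {φ₁ : κ₁ → ℝ} {ψ₁ φ₂ : κ₂ → ℝ} {ψ₂ : κ₃ → ℝ} (hφ0 : ∀ k, 0 ≤ φ₁ k) (hψ0 : ∀ k, 0 ≤ ψ₁ k)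
    (hψ : Summable fun k => ψ₁ k ^ 2) (hφ : Summable fun k => φ₂ k ^ 2)
    (h₁ : ∀ k l, ‖G₁ k l‖ ≤ φ₁ k * ψ₁ l) (h₂ : ∀ k l, ‖G₂ k l‖ ≤ φ₂ k * ψ₂ l) (k : κ₁) (l : κ₃) :
    Summable (fun m => G₁ k m * G₂ m l) := by
  refine Summable.of_norm_bounded
    ((summable_mul_of_sq hψ hφ).mul_left (φ₁ k * ψ₂ l)) fun m => ?_
  rw [norm_mul]
  calc ‖G₁ k m‖ * ‖G₂ m l‖ ≤ (φ₁ k * ψ₁ m) * (φ₂ m * ψ₂ l) :=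
        mul_le_mul (h₁ k m) (h₂ m l) (norm_nonneg _) (mul_nonneg (hφ0 _) (hψ0 _))
    _ = _ := by ring

theorem norm_sum_entries_mul_le {κ₁ κ₂ κ₃ : Type} {G₁ : κ₁ → κ₂ → ℂ} {G₂ : κ₂ → κ₃ → ℂ}
    {φ₁ : κ₁ → ℝ} {ψ₁ φ₂ : κ₂ → ℝ} {ψ₂ : κ₃ → ℝ} (hφ0 : ∀ k, 0 ≤ φ₁ k) (hψ0 : ∀ k, 0 ≤ ψ₁ k)
    (hφ0' : ∀ k, 0 ≤ φ₂ k) (hψ0' : ∀ k, 0 ≤ ψ₂ k)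
    (hψ : Summable fun k => ψ₁ k ^ 2) (hφ : Summable fun k => φ₂ k ^ 2)
    (h₁ : ∀ k l, ‖G₁ k l‖ ≤ φ₁ k * ψ₁ l) (h₂ : ∀ k l, ‖G₂ k l‖ ≤ φ₂ k * ψ₂ l) (s : Finset κ₂)
    (k : κ₁) (l : κ₃) :
    ‖∑ m ∈ s, G₁ k m * G₂ m l‖ ≤ φ₁ k * (∑' m, ψ₁ m * φ₂ m) * ψ₂ l := by
  calc ‖∑ m ∈ s, G₁ k m * G₂ m l‖ ≤ ∑ m ∈ s, (φ₁ k * ψ₂ l) * (ψ₁ m * φ₂ m) := by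
        refine norm_sum_le_of_le s fun m _ => ?_
        rw [norm_mul]
        calc ‖G₁ k m‖ * ‖G₂ m l‖ ≤ (φ₁ k * ψ₁ m) * (φ₂ m * ψ₂ l) :=
              mul_le_mul (h₁ k m) (h₂ m l) (norm_nonneg _) (mul_nonneg (hφ0 _) (hψ0 _))
          _ = _ := by ring
    _ = (φ₁ k * ψ₂ l) * ∑ m ∈ s, ψ₁ m * φ₂ m := by rw [Finset.mul_sum]
    _ ≤ (φ₁ k * ψ₂ l) * ∑' m, ψ₁ m * φ₂ m := by
        refine mul_le_mul_of_nonneg_left ?_ (mul_nonneg (hφ0 k) (hψ0' l))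
        exact (summable_mul_of_sq hψ hφ).sum_le_tsum s fun m _ => mul_nonneg (hψ0 m) (hφ0' m)
    _ = _ := by ring

theorem tendsto_sum_finset_snd {ι κ : Type} {f : ι → ℂ} (hf : Summable f) :
    Filter.Tendsto (fun s : Finset ι × Finset κ => ∑ m ∈ s.1, f m)
      (Filter.atTop ×ˢ Filter.atTop) (nhds (∑' m, f m)) :=
  hf.hasSum.comp Filter.tendsto_fst

/-- Multiplicativity: `det (1 - G₁) det (1 - G₂) = det ((1 - G₁) (1 - G₂))`. -/
theorem fredholmDet_mul {G₁ G₂ : κ → κ → ℂ} (h₁ : IsEllTwoDominated G₁)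
    (h₂ : IsEllTwoDominated G₂) :
    fredholmDet Measure.count G₁ * fredholmDet Measure.count G₂ =
      fredholmDet Measure.count (fun k l => G₁ k l + G₂ k l - ∑' m, G₁ k m * G₂ m l) := by
  classical
  obtain ⟨φ₁, ψ₁, hφ₁, hψ₁, sφ₁, sψ₁, b₁⟩ := h₁
  obtain ⟨φ₂, ψ₂, hφ₂, hψ₂, sφ₂, sψ₂, b₂⟩ := h₂
  set C : ℝ := ∑' m, ψ₁ m * φ₂ m with hC
  have hC0 : 0 ≤ C := tsum_nonneg fun m => mul_nonneg (hψ₁ m) (hφ₂ m)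
  have he : ∀ s : Finset κ, Function.Injective (Subtype.val : s → κ) :=
    fun s => Subtype.val_injective
  have hex : ∀ k : κ, ∀ᶠ s : Finset κ in Filter.atTop, k ∈ range (Subtype.val : s → κ) := by
    intro k
    filter_upwards [Filter.eventually_ge_atTop {k}] with s hs
    simpa using hs
  have t₁ := tendsto_det_truncate (l := Filter.atTop) he hex (G := fun _ => G₁) hφ₁ hψ₁ sφ₁ sψ₁
    (fun _ => b₁) (fun k m => tendsto_const_nhds)
  have t₂ := tendsto_det_truncate (l := Filter.atTop) he hex (G := fun _ => G₂) hφ₂ hψ₂ sφ₂ sψ₂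
    (fun _ => b₂) (fun k m => tendsto_const_nhds)
  have t₃ := tendsto_det_truncate (l := Filter.atTop) he hex
    (G := fun (s : Finset κ) k l => G₁ k l + G₂ k l - ∑ m ∈ s, G₁ k m * G₂ m l)
    (φ := fun k => (1 + C) * (φ₁ k + φ₂ k)) (ψ := fun l => ψ₁ l + ψ₂ l)
    (fun k => mul_nonneg (by positivity) (add_nonneg (hφ₁ k) (hφ₂ k)))
    (fun l => add_nonneg (hψ₁ l) (hψ₂ l))
    (((summable_add_sq sφ₁ sφ₂).mul_left ((1 + C) ^ 2)).congr fun k => by ring)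
    (summable_add_sq sψ₁ sψ₂)
    (fun s k l => by
      have e1 := b₁ k l
      have e2 := b₂ k l
      have e3 := norm_sum_entries_mul_le hφ₁ hψ₁ hφ₂ hψ₂ sψ₁ sφ₂ b₁ b₂ s k l
      have e4 : ‖G₁ k l + G₂ k l - ∑ m ∈ s, G₁ k m * G₂ m l‖ ≤
          φ₁ k * ψ₁ l + φ₂ k * ψ₂ l + φ₁ k * C * ψ₂ l :=
        (norm_sub_le _ _).trans (add_le_add ((norm_add_le _ _).trans (add_le_add e1 e2)) e3)
      refine e4.trans ?_
      have p1 := mul_nonneg (hφ₁ k) (hψ₁ l)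
      have p2 := mul_nonneg (hφ₂ k) (hψ₂ l)
      have p3 := mul_nonneg (hφ₁ k) (hψ₂ l)
      have p4 := mul_nonneg (hφ₂ k) (hψ₁ l)
      nlinarith [mul_nonneg hC0 p1, mul_nonneg hC0 p2, mul_nonneg hC0 p4])
    (fun k m => Filter.Tendsto.sub tendsto_const_nhds
      (summable_entries_mul hφ₁ hψ₁ sψ₁ sφ₂ b₁ b₂ k m).hasSum)
  -- for finite truncations this is the multiplicativity of the determinant of matrices
  refine tendsto_nhds_unique (t₁.mul t₂) (t₃.congr fun s => ?_)
  rw [← Matrix.det_mul]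
  congr 1
  have : (Matrix.of fun i i' : s => G₁ i i' + G₂ i i' - ∑ m ∈ s, G₁ i m * G₂ m i') =
      (Matrix.of fun i i' : s => G₁ i i') + (Matrix.of fun i i' : s => G₂ i i') -
        (Matrix.of fun i i' : s => G₁ i i') * (Matrix.of fun i i' : s => G₂ i i') := by
    ext i j
    simp only [Matrix.of_apply, Matrix.sub_apply, Matrix.add_apply, Matrix.mul_apply]
    rw [Finset.sum_coe_sort s (fun m => G₁ i m * G₂ m j)]
  rw [this, mul_sub, sub_mul, sub_mul, mul_one, one_mul, mul_one]
  abel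

/-- Eliminating a block of the form `1` on the diagonal:
`det [[1, -p], [-q, 1 - S]] = det (1 - S - q p)`. -/
theorem fredholmDet_schur {ι : Type} [MeasurableSpace ι] [DiscreteMeasurableSpace ι] [Countable ι]
    {G : ι ⊕ κ → ι ⊕ κ → ℂ} (hG : IsEllTwoDominated G)
    (h0 : ∀ i j, G (Sum.inl i) (Sum.inl j) = 0) :
    fredholmDet Measure.count G = fredholmDet Measure.count (fun k l =>
      G (Sum.inr k) (Sum.inr l) + ∑' m, G (Sum.inr k) (Sum.inl m) * G (Sum.inl m) (Sum.inr l)) := by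
  classical
  obtain ⟨φ, ψ, hφ, hψ, sφ, sψ, b⟩ := hG
  have t₁ := tendsto_det_truncate (l := Filter.atTop ×ˢ Filter.atTop)
    (F := fun s : Finset ι × Finset κ => s.1 ⊕ s.2)
    (e := fun s => Sum.map Subtype.val Subtype.val)
    (fun s => Sum.map_injective.mpr ⟨Subtype.val_injective, Subtype.val_injective⟩)
    (fun k => by
      rcases k with k | k
      · filter_upwards [Filter.tendsto_fst.eventually (Filter.eventually_ge_atTop {k})] with s hs
        exact ⟨Sum.inl ⟨k, by simpa using hs⟩, rfl⟩
      · filter_upwards [Filter.tendsto_snd.eventually (Filter.eventually_ge_atTop {k})] with s hs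
        exact ⟨Sum.inr ⟨k, by simpa using hs⟩, rfl⟩)
    (G := fun _ => G) hφ hψ sφ sψ (fun _ => b) (fun k m => tendsto_const_nhds)
  set C : ℝ := ∑' m : ι, ψ (Sum.inl m) * φ (Sum.inl m) with hC
  have hC0 : 0 ≤ C := tsum_nonneg fun m => mul_nonneg (hψ _) (hφ _)
  have sφl : Summable fun k => φ (Sum.inl k) ^ 2 := sφ.comp_injective Sum.inl_injective
  have sψl : Summable fun k => ψ (Sum.inl k) ^ 2 := sψ.comp_injective Sum.inl_injective
  have sφr : Summable fun k => φ (Sum.inr k) ^ 2 := sφ.comp_injective Sum.inr_injective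
  have sψr : Summable fun k => ψ (Sum.inr k) ^ 2 := sψ.comp_injective Sum.inr_injective
  have t₂ := tendsto_det_truncate (l := Filter.atTop ×ˢ Filter.atTop)
    (F := fun s : Finset ι × Finset κ => s.2) (e := fun s => Subtype.val)
    (fun s => Subtype.val_injective)
    (fun k => by
      filter_upwards [Filter.tendsto_snd.eventually (Filter.eventually_ge_atTop {k})] with s hs
      exact ⟨⟨k, by simpa using hs⟩, rfl⟩)
    (G := fun (s : Finset ι × Finset κ) k l => G (Sum.inr k) (Sum.inr l) +
      ∑ m ∈ s.1, G (Sum.inr k) (Sum.inl m) * G (Sum.inl m) (Sum.inr l))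
    (φ := fun k => (1 + C) * φ (Sum.inr k)) (ψ := fun l => ψ (Sum.inr l))
    (fun k => mul_nonneg (by positivity) (hφ _)) (fun l => hψ _)
    ((sφr.mul_left ((1 + C) ^ 2)).congr fun k => by ring) sψr
    (fun s k l => by
      have e1 := b (Sum.inr k) (Sum.inr l)
      have e2 := norm_sum_entries_mul_le (G₁ := fun k m => G (Sum.inr k) (Sum.inl m))
        (G₂ := fun m l => G (Sum.inl m) (Sum.inr l)) (fun k => hφ (Sum.inr k))
        (fun m => hψ (Sum.inl m)) (fun m => hφ (Sum.inl m)) (fun l => hψ (Sum.inr l)) sψl sφl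
        (fun k m => b _ _) (fun m l => b _ _) s.1 k l
      refine ((norm_add_le _ _).trans (add_le_add e1 e2)).trans (le_of_eq ?_)
      ring)
    (fun k m => Filter.Tendsto.add tendsto_const_nhds (tendsto_sum_finset_snd
      (summable_entries_mul (G₁ := fun k m => G (Sum.inr k) (Sum.inl m))
        (G₂ := fun m l => G (Sum.inl m) (Sum.inr l)) (fun k => hφ (Sum.inr k))
        (fun m => hψ (Sum.inl m)) sψl sφl (fun k m => b _ _) (fun m l => b _ _) k m)))
  -- for finite truncations this is the Schur complement formula for block matrices
  refine tendsto_nhds_unique t₁ (t₂.congr fun s => ?_)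
  symm
  have hblock : (1 - Matrix.of fun i i' : s.1 ⊕ s.2 =>
      G (Sum.map Subtype.val Subtype.val i) (Sum.map Subtype.val Subtype.val i')) =
      Matrix.fromBlocks 1 (-Matrix.of fun (i : s.1) (j : s.2) => G (Sum.inl i) (Sum.inr j))
        (-Matrix.of fun (i : s.2) (j : s.1) => G (Sum.inr i) (Sum.inl j))
        (1 - Matrix.of fun (i : s.2) (j : s.2) => G (Sum.inr i) (Sum.inr j)) := by
    ext i j
    rcases i with i | i <;> rcases j with j | j <;> simp [Matrix.one_apply, h0]
  rw [hblock, Matrix.det_fromBlocks_one₁₁]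
  congr 1
  have : (Matrix.of fun i i' : s.2 => G (Sum.inr i) (Sum.inr i') +
      ∑ m ∈ s.1, G (Sum.inr i) (Sum.inl m) * G (Sum.inl m) (Sum.inr i')) =
      (Matrix.of fun (i : s.2) (j : s.2) => G (Sum.inr i) (Sum.inr j)) +
      (Matrix.of fun (i : s.2) (j : s.1) => G (Sum.inr i) (Sum.inl j)) *
        (Matrix.of fun (i : s.1) (j : s.2) => G (Sum.inl i) (Sum.inr j)) := by
    ext i j
    simp only [Matrix.of_apply, Matrix.add_apply, Matrix.mul_apply]
    rw [Finset.sum_coe_sort s.1 (fun m => G (Sum.inr i) (Sum.inl m) * G (Sum.inl m) (Sum.inr j))]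
  rw [this, Matrix.neg_mul, Matrix.mul_neg, neg_neg]
  abel

end Discrete

/-! ### Kernels factored through `ℓ²` -/

theorem norm_integral_mul_le_sqrt {X : Type} [MeasurableSpace X] {μ : Measure X} {f g : X → ℂ}
    (hf : MemLp f 2 μ) (hg : MemLp g 2 μ) :
    ‖∫ x, f x * g x ∂μ‖ ≤ √(∫ x, ‖f x‖ ^ 2 ∂μ) * √(∫ x, ‖g x‖ ^ 2 ∂μ) := by
  refine (norm_integral_le_integral_norm _).trans ?_
  have h := integral_mul_le_Lp_mul_Lq_of_nonneg (μ := μ) (p := 2) (q := 2) (f := fun x => ‖f x‖)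
    (g := fun x => ‖g x‖) (by constructor <;> norm_num)
    (Filter.Eventually.of_forall fun _ => norm_nonneg _)
    (Filter.Eventually.of_forall fun _ => norm_nonneg _)
    (by simpa using hf.norm) (by simpa using hg.norm)
  simp only [norm_mul]
  refine h.trans (le_of_eq ?_)
  simp [Real.sqrt_eq_rpow]

section EllTwo

variable {X : Type} [MeasurableSpace X] {μ : Measure X}

/-- A measurable family of square summable sequences whose `ℓ²` norm is square integrable. -/
structure IsEllTwoField {κ : Type} (μ : Measure X) (A : X → κ → ℂ) : Prop where
  measurable : ∀ k, Measurable fun x => A x k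
  exists_bound : ∃ φ : X → ℝ, (∀ x, 0 ≤ φ x) ∧ MemLp φ 2 μ ∧
    ∀ᵐ x ∂μ, (Summable fun k => ‖A x k‖ ^ 2) ∧ ∑' k, ‖A x k‖ ^ 2 ≤ φ x ^ 2

theorem IsEllTwoField.sumElim {κ κ' : Type} {A : X → κ → ℂ} {A' : X → κ' → ℂ}
    (hA : IsEllTwoField μ A) (hA' : IsEllTwoField μ A') :
    IsEllTwoField μ fun x => Sum.elim (A x) (A' x) := by
  obtain ⟨φ, hφ0, hφ, h⟩ := hA.exists_bound
  obtain ⟨φ', hφ0', hφ', h'⟩ := hA'.exists_bound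
  refine ⟨?_, fun x => φ x + φ' x, fun x => add_nonneg (hφ0 x) (hφ0' x), hφ.add hφ', ?_⟩
  · rintro (k | k)
    · exact hA.measurable k
    · exact hA'.measurable k
  · filter_upwards [h, h'] with x hx hx'
    have hs := HasSum.sum (f := fun k => ‖Sum.elim (A x) (A' x) k‖ ^ 2) hx.1.hasSum hx'.1.hasSum
    refine ⟨hs.summable, ?_⟩
    rw [hs.tsum_eq]
    nlinarith [hx.2, hx'.2, mul_nonneg (hφ0 x) (hφ0' x)]

variable {κ : Type} [MeasurableSpace κ] [DiscreteMeasurableSpace κ] [Countable κ] [SigmaFinite μ]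

omit [SigmaFinite μ] in
theorem IsEllTwoField.integrable {A : X → κ → ℂ} (hA : IsEllTwoField μ A) :
    Integrable (fun p : X × κ => ‖A p.1 p.2‖ ^ 2) (μ.prod Measure.count) := by
  obtain ⟨φ, _, hφ, h⟩ := hA.exists_bound
  exact integrable_sq_prod_count hA.measurable hφ.integrable_sq h

omit [MeasurableSpace κ] [DiscreteMeasurableSpace κ] [Countable κ] [SigmaFinite μ] in
theorem IsEllTwoField.ae_memLp {A : X → κ → ℂ} (hA : IsEllTwoField μ A) (k : κ) :
    MemLp (fun x => A x k) 2 μ := by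
  obtain ⟨φ, hφ0, hφ, h⟩ := hA.exists_bound
  refine hφ.of_le (hA.measurable k).aestronglyMeasurable ?_
  filter_upwards [h] with x hx
  rw [Real.norm_of_nonneg (hφ0 x)]
  refine le_of_sq_le_sq ?_ (hφ0 x)
  exact (hx.1.le_tsum k fun _ _ => by positivity).trans hx.2

theorem IsEllTwoField.summable_integral {A : X → κ → ℂ} (hA : IsEllTwoField μ A) :
    Summable fun k => ∫ x, ‖A x k‖ ^ 2 ∂μ := by
  have h := hA.integrable.swap.integral_prod_left
  exact (integrable_count_iff.mp h).of_norm

/-- The matrix `∫ B_k(x) A_l(x) dμ(x)` is of trace class. -/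
theorem isEllTwoDominated_integral {κ' : Type} [MeasurableSpace κ'] [DiscreteMeasurableSpace κ']
    [Countable κ'] {A : X → κ' → ℂ} {B : X → κ → ℂ} (hA : IsEllTwoField μ A)
    (hB : IsEllTwoField μ B) :
    IsEllTwoDominated fun k l => ∫ x, B x k * A x l ∂μ := by
  refine ⟨fun k => √(∫ x, ‖B x k‖ ^ 2 ∂μ), fun l => √(∫ x, ‖A x l‖ ^ 2 ∂μ),
    fun _ => Real.sqrt_nonneg _, fun _ => Real.sqrt_nonneg _, ?_, ?_,
    fun k l => norm_integral_mul_le_sqrt (hB.ae_memLp k) (hA.ae_memLp l)⟩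
  · exact hB.summable_integral.congr fun k =>
      (Real.sq_sqrt (integral_nonneg fun _ => by positivity)).symm
  · exact hA.summable_integral.congr fun k =>
      (Real.sq_sqrt (integral_nonneg fun _ => by positivity)).symm

theorem summable_norm_mul_of_sq {κ : Type} {a b : κ → ℂ} (ha : Summable fun k => ‖a k‖ ^ 2)
    (hb : Summable fun k => ‖b k‖ ^ 2) : Summable fun k => ‖a k * b k‖ := by
  simpa using summable_mul_of_sq ha hb

theorem norm_tsum_mul_le_of_sq {κ : Type} {a b : κ → ℂ} {s t : ℝ} (hs : 0 ≤ s) (ht : 0 ≤ t)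
    (ha : Summable fun k => ‖a k‖ ^ 2)
    (hb : Summable fun k => ‖b k‖ ^ 2) (has : ∑' k, ‖a k‖ ^ 2 ≤ s ^ 2)
    (hbt : ∑' k, ‖b k‖ ^ 2 ≤ t ^ 2) : ‖∑' k, a k * b k‖ ≤ s * t := by
  have h1 : ∀ F : Finset κ, ∑ k ∈ F, ‖a k * b k‖ ≤ s * t := fun F => by
    simp only [norm_mul]
    refine le_of_sq_le_sq ?_ (mul_nonneg hs ht)
    calc (∑ k ∈ F, ‖a k‖ * ‖b k‖) ^ 2 ≤ (∑ k ∈ F, ‖a k‖ ^ 2) * ∑ k ∈ F, ‖b k‖ ^ 2 :=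
          Finset.sum_mul_sq_le_sq_mul_sq _ _ _
      _ ≤ s ^ 2 * t ^ 2 := by
          gcongr
          · exact (ha.sum_le_tsum F fun _ _ => by positivity).trans has
          · exact (hb.sum_le_tsum F fun _ _ => by positivity).trans hbt
      _ = _ := by ring
  exact (norm_tsum_le_tsum_norm (summable_norm_mul_of_sq ha hb)).trans
    (Real.tsum_le_of_sum_le (fun _ => norm_nonneg _) h1)

omit [SigmaFinite μ] in
theorem IsEllTwoField.integral_eq_tsum {A B : X → κ → ℂ} (hA : IsEllTwoField μ A)
    (hB : IsEllTwoField μ B) :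
    ∃ S : Set X, (∀ᵐ x ∂μ, x ∈ S) ∧ ∀ x ∈ S, ∀ y ∈ S,
      ∫ k, A x k * B y k ∂(Measure.count : Measure κ) = ∑' k, A x k * B y k := by
  obtain ⟨φ, hφ0, hφ, h⟩ := hA.exists_bound
  obtain ⟨ψ, hψ0, hψ, h'⟩ := hB.exists_bound
  exact ⟨_, h.and h', fun x hx y hy =>
    integral_count_eq_tsum (summable_norm_mul_of_sq hx.1.1 hy.2.1)⟩

omit [SigmaFinite μ] in
/-- Equality of kernels on the square of a conull set suffices for Fredholm series. -/
theorem ae_prod_of_conull {S : Set X} (hS : ∀ᵐ x ∂μ, x ∈ S) {P : X → X → Prop}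
    (h : ∀ x ∈ S, ∀ y ∈ S, P x y) : (∀ᵐ x ∂μ, P x x) ∧ ∀ᵐ p ∂μ.prod μ, P p.1 p.2 := by
  refine ⟨hS.mono fun x hx => h x hx x hx, ?_⟩
  filter_upwards [Measure.quasiMeasurePreserving_fst.tendsto_ae.eventually hS,
    Measure.quasiMeasurePreserving_snd.tendsto_ae.eventually hS] with p h1 h2
  exact h _ h1 _ h2

theorem measurable_integral_comp {A B : X → κ → ℂ} (hA : ∀ k, Measurable fun x => A x k)
    (hB : ∀ k, Measurable fun x => B x k) :
    Measurable (Function.uncurry fun x y => ∫ k, A x k * B y k ∂(Measure.count : Measure κ)) := by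
  have : Measurable fun p : (X × X) × κ => A p.1.1 p.2 * B p.1.2 p.2 :=
    measurable_from_prod_countable_left fun k =>
      ((hA k).comp measurable_fst).mul ((hB k).comp measurable_snd)
  exact (this.stronglyMeasurable.integral_prod_right' (ν := Measure.count)).measurable

/-- A kernel `∑ A_k(x) B_k(y)` has a convergent Fredholm series. -/
theorem fredholmConverges_tsum {A B : X → κ → ℂ} (hA : IsEllTwoField μ A)
    (hB : IsEllTwoField μ B) : FredholmConverges μ fun x y => ∑' k, A x k * B y k := by
  obtain ⟨S, hS, hSe⟩ := hA.integral_eq_tsum hB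
  obtain ⟨e1, e2⟩ := ae_prod_of_conull hS hSe
  refine FredholmConverges.congr (K' := fun x y => ∫ k, A x k * B y k ∂(Measure.count : Measure κ))
    ?_ (e1.mono fun _ h => h.symm) (e2.mono fun _ h => h.symm)
  obtain ⟨φ, hφ0, hφ, h⟩ := hA.exists_bound
  obtain ⟨ψ, hψ0, hψ, h'⟩ := hB.exists_bound
  refine IsDominatedBy.fredholmConverges (φ := φ) (ψ := ψ)
    ⟨(h.and h').and hS, hφ0, hψ0, hφ.integrable_mul hψ, fun x hx y hy => ?_⟩
    (measurable_integral_comp hA.measurable hB.measurable)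
  rw [hSe x hx.2 y hy.2]
  exact norm_tsum_mul_le_of_sq (hφ0 x) (hψ0 y) hx.1.1.1 hy.1.2.1 hx.1.1.2 hy.1.2.2

/-- The Fredholm determinant of `∑ A_k(x) B_k(y)` is the determinant of the infinite matrix
`∫ B_k A_l dμ`. -/
theorem fredholmDet_tsum {A B : X → κ → ℂ} (hA : IsEllTwoField μ A) (hB : IsEllTwoField μ B) :
    fredholmDet μ (fun x y => ∑' k, A x k * B y k) =
      fredholmDet Measure.count fun k l => ∫ x, B x k * A x l ∂μ := by
  obtain ⟨S, hS, hSe⟩ := hA.integral_eq_tsum hB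
  obtain ⟨e1, e2⟩ := ae_prod_of_conull hS hSe
  rw [← fredholmDet_congr (K := fun x y => ∫ k, A x k * B y k ∂(Measure.count : Measure κ)) e1 e2]
  exact fredholmDet_comp_comm (A := A) (B := fun k x => B x k)
    (measurable_uncurry_of_countable_right hA.measurable)
    (measurable_from_prod_countable_right hB.measurable) hA.integrable hB.integrable

end EllTwo

/-! ### Square integrable vector fields -/

section Field

variable {X : Type} [MeasurableSpace X] {μ : Measure X}
variable {H H' : Type} [NormedAddCommGroup H] [InnerProductSpace ℂ H] [CompleteSpace H]
  [NormedAddCommGroup H'] [InnerProductSpace ℂ H'] [CompleteSpace H']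

/-- A weakly measurable map to a Hilbert space with square integrable norm. -/
structure IsSquareIntegrableField (μ : Measure X) (W : X → H) : Prop where
  measurable : ∀ h : H, Measurable fun x => ⟪h, W x⟫_ℂ
  exists_bound : ∃ φ : X → ℝ, (∀ x, 0 ≤ φ x) ∧ MemLp φ 2 μ ∧ ∀ᵐ x ∂μ, ‖W x‖ ≤ φ x

theorem IsSquareIntegrableField.clm_apply {W : X → H} (hW : IsSquareIntegrableField μ W)
    (T : H →L[ℂ] H') : IsSquareIntegrableField μ fun x => T (W x) := by
  obtain ⟨φ, hφ0, hφ, h⟩ := hW.exists_bound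
  refine ⟨fun h => ?_, fun x => ‖T‖ * φ x, fun x => mul_nonneg (norm_nonneg _) (hφ0 x),
    hφ.const_mul _, ?_⟩
  · simp only [← ContinuousLinearMap.adjoint_inner_left]
    exact hW.measurable _
  · filter_upwards [h] with x hx
    exact (T.le_opNorm _).trans (by gcongr)

omit [CompleteSpace H] in
theorem IsSquareIntegrableField.sub {W W' : X → H} (hW : IsSquareIntegrableField μ W)
    (hW' : IsSquareIntegrableField μ W') : IsSquareIntegrableField μ fun x => W x - W' x := by
  obtain ⟨φ, hφ0, hφ, h⟩ := hW.exists_bound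
  obtain ⟨φ', hφ0', hφ', h'⟩ := hW'.exists_bound
  refine ⟨fun h => ?_, fun x => φ x + φ' x, fun x => add_nonneg (hφ0 x) (hφ0' x), hφ.add hφ', ?_⟩
  · simp only [inner_sub_right]
    exact (hW.measurable h).sub (hW'.measurable h)
  · filter_upwards [h, h'] with x hx hx'
    exact (norm_sub_le _ _).trans (add_le_add hx hx')

omit [CompleteSpace H] in
theorem hasSum_norm_inner_sq {κ : Type} (e : HilbertBasis κ ℂ H) (v : H) :
    HasSum (fun k => ‖⟪e k, v⟫_ℂ‖ ^ 2) (‖v‖ ^ 2) := by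
  have h := e.hasSum_inner_mul_inner v v
  rw [inner_self_eq_norm_sq_to_K] at h
  have h2 : (fun k => ⟪v, e k⟫_ℂ * ⟪e k, v⟫_ℂ) = fun k => ((‖⟪e k, v⟫_ℂ‖ ^ 2 : ℝ) : ℂ) := by
    funext k
    rw [← inner_conj_symm v (e k), mul_comm, Complex.mul_conj, Complex.normSq_eq_norm_sq]
  have h3 : ((‖v‖ : ℝ) : ℂ) ^ 2 = ((‖v‖ ^ 2 : ℝ) : ℂ) := by push_cast; rfl
  rw [h2] at h
  exact Complex.hasSum_ofReal.mp (h3 ▸ h)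

omit [CompleteSpace H] in
theorem IsSquareIntegrableField.ellTwo_right {κ : Type} (e : HilbertBasis κ ℂ H) {W : X → H}
    (hW : IsSquareIntegrableField μ W) : IsEllTwoField μ fun x k => ⟪e k, W x⟫_ℂ := by
  obtain ⟨φ, hφ0, hφ, h⟩ := hW.exists_bound
  refine ⟨fun k => hW.measurable _, φ, hφ0, hφ, ?_⟩
  filter_upwards [h] with x hx
  have h1 := hasSum_norm_inner_sq e (W x)
  refine ⟨h1.summable, ?_⟩
  rw [h1.tsum_eq]
  gcongr

omit [CompleteSpace H] in
theorem IsSquareIntegrableField.ellTwo_left {κ : Type} (e : HilbertBasis κ ℂ H) {V : X → H}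
    (hV : IsSquareIntegrableField μ V) : IsEllTwoField μ fun x k => ⟪V x, e k⟫_ℂ := by
  have h := hV.ellTwo_right e
  have h2 : ∀ x k, ⟪V x, e k⟫_ℂ = starRingEnd ℂ ⟪e k, V x⟫_ℂ := fun x k =>
    (inner_conj_symm _ _).symm
  refine ⟨fun k => ?_, ?_⟩
  · simp only [h2]
    exact Complex.continuous_conj.measurable.comp (h.measurable k)
  · simpa only [h2, RCLike.norm_conj] using h.exists_bound

end Field

/-! ### Operators given by a superposition of rank one operators -/

section Superposition

variable {P : Type} [MeasurableSpace P] {μ : Measure P}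
variable {H H' : Type} [NormedAddCommGroup H] [InnerProductSpace ℂ H] [CompleteSpace H]
  [NormedAddCommGroup H'] [InnerProductSpace ℂ H'] [CompleteSpace H']

omit [CompleteSpace H] in
theorem IsSquareIntegrableField.memLp_inner_right {W : P → H} (hW : IsSquareIntegrableField μ W)
    (h : H) : MemLp (fun p => ⟪h, W p⟫_ℂ) 2 μ := by
  obtain ⟨φ, _, hφ, hb⟩ := hW.exists_bound
  refine (hφ.const_mul ‖h‖).of_le (hW.measurable h).aestronglyMeasurable ?_
  filter_upwards [hb] with p hp
  refine (norm_inner_le_norm _ _).trans ?_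
  exact (mul_le_mul_of_nonneg_left hp (norm_nonneg _)).trans (le_abs_self _)

omit [CompleteSpace H] in
theorem IsSquareIntegrableField.memLp_inner_left {W : P → H} (hW : IsSquareIntegrableField μ W)
    (h : H) : MemLp (fun p => ⟪W p, h⟫_ℂ) 2 μ := by
  have h1 := (hW.memLp_inner_right h).star
  refine h1.ae_eq (Filter.Eventually.of_forall fun p => ?_)
  exact inner_conj_symm (𝕜 := ℂ) (W p) h

omit [CompleteSpace H] in
/-- The `L²` norm of `p ↦ ⟪W p, h⟫` is at most a constant times `‖h‖`. -/
theorem IsSquareIntegrableField.exists_sqrt_integral_le {W : P → H}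
    (hW : IsSquareIntegrableField μ W) :
    ∃ C, 0 ≤ C ∧ ∀ h : H, √(∫ p, ‖⟪h, W p⟫_ℂ‖ ^ 2 ∂μ) ≤ C * ‖h‖ ∧
      √(∫ p, ‖⟪W p, h⟫_ℂ‖ ^ 2 ∂μ) ≤ C * ‖h‖ := by
  obtain ⟨φ, hφ0, hφ, hb⟩ := hW.exists_bound
  refine ⟨√(∫ p, φ p ^ 2 ∂μ), Real.sqrt_nonneg _, fun h => ?_⟩
  have key : √(∫ p, ‖⟪h, W p⟫_ℂ‖ ^ 2 ∂μ) ≤ √(∫ p, φ p ^ 2 ∂μ) * ‖h‖ := by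
    have h2 : √(∫ p, φ p ^ 2 ∂μ) * ‖h‖ = √(∫ p, φ p ^ 2 * ‖h‖ ^ 2 ∂μ) := by
      rw [integral_mul_const, Real.sqrt_mul (integral_nonneg fun _ => by positivity),
        Real.sqrt_sq (norm_nonneg h)]
    rw [h2]
    refine Real.sqrt_le_sqrt (integral_mono_ae (hW.memLp_inner_right h).norm.integrable_sq
      (hφ.integrable_sq.mul_const _) ?_)
    filter_upwards [hb] with p hp
    rw [← mul_pow]
    refine pow_le_pow_left₀ (norm_nonneg _) ((norm_inner_le_norm _ _).trans ?_) 2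
    rw [mul_comm]
    gcongr
  refine ⟨key, ?_⟩
  simpa only [norm_inner_symm] using key

/-- `T = -∫ W_p ⟪V_p, ·⟫ dμ(p)` in the weak sense. -/
def IsNegSuperposition (μ : Measure P) (W : P → H') (V : P → H) (T : H →L[ℂ] H') : Prop :=
  ∀ (h : H') (h' : H), ∫ p, ⟪h, W p⟫_ℂ * ⟪V p, h'⟫_ℂ ∂μ = -⟪h, T h'⟫_ℂ

variable {W : P → H'} {V : P → H} {T : H →L[ℂ] H'}

omit [CompleteSpace H'] [CompleteSpace H] in
theorem IsNegSuperposition.exists_norm_inner_le (hT : IsNegSuperposition μ W V T)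
    (hW : IsSquareIntegrableField μ W) (hV : IsSquareIntegrableField μ V) :
    ∃ C, 0 ≤ C ∧ ∀ h h', ‖⟪h, T h'⟫_ℂ‖ ≤ √(∫ p, ‖⟪h, W p⟫_ℂ‖ ^ 2 ∂μ) * (C * ‖h'‖) := by
  obtain ⟨C, hC, hle⟩ := hV.exists_sqrt_integral_le
  refine ⟨C, hC, fun h h' => ?_⟩
  rw [← norm_neg, ← hT h h']
  exact (norm_integral_mul_le_sqrt (hW.memLp_inner_right h) (hV.memLp_inner_left h')).trans
    (mul_le_mul_of_nonneg_left (hle h').2 (Real.sqrt_nonneg _))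

omit [CompleteSpace H] [CompleteSpace H'] in
theorem IsNegSuperposition.exists_norm_apply_le (hT : IsNegSuperposition μ W V T)
    (hW : IsSquareIntegrableField μ W) (hV : IsSquareIntegrableField μ V) :
    ∃ C, 0 ≤ C ∧ ∀ h', ‖T h'‖ ≤ C * √(∫ p, ‖⟪V p, h'⟫_ℂ‖ ^ 2 ∂μ) := by
  obtain ⟨C, hC, hle⟩ := hW.exists_sqrt_integral_le
  refine ⟨C, hC, fun h' => ?_⟩
  by_cases h0 : T h' = 0
  · rw [h0, norm_zero]
    exact mul_nonneg hC (Real.sqrt_nonneg _)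
  have h1 : ‖T h'‖ * ‖T h'‖ ≤ ‖T h'‖ * (C * √(∫ p, ‖⟪V p, h'⟫_ℂ‖ ^ 2 ∂μ)) := by
    calc ‖T h'‖ * ‖T h'‖ = ‖⟪T h', T h'⟫_ℂ‖ := by
          rw [inner_self_eq_norm_sq_to_K, norm_pow]; simp [sq]
      _ ≤ √(∫ p, ‖⟪T h', W p⟫_ℂ‖ ^ 2 ∂μ) * √(∫ p, ‖⟪V p, h'⟫_ℂ‖ ^ 2 ∂μ) := by
          rw [← norm_neg, ← hT]
          exact norm_integral_mul_le_sqrt (hW.memLp_inner_right _) (hV.memLp_inner_left h')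
      _ ≤ (C * ‖T h'‖) * √(∫ p, ‖⟪V p, h'⟫_ℂ‖ ^ 2 ∂μ) := by gcongr; exact (hle _).1
      _ = _ := by ring
  exact le_of_mul_le_mul_left h1 (norm_pos_iff.mpr h0)

omit [CompleteSpace H] in
/-- An operator with `∑ ‖T e_k‖² < ∞` is compact. -/
theorem isCompactOperator_of_summable_sq {κ : Type} (e : HilbertBasis κ ℂ H) {T : H →L[ℂ] H'}
    (hs : Summable fun k => ‖T (e k)‖ ^ 2) : IsCompactOperator T := by
  let F : Finset κ → H →L[ℂ] H' := fun s => ∑ k ∈ s, (innerSL ℂ (e k)).smulRight (T (e k))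
  have hF : ∀ s, IsCompactOperator (F s) := fun s => by
    have : ∀ k, IsCompactOperator ((innerSL ℂ (e k)).smulRight (T (e k))) := fun k => by
      have h1 : IsCompactOperator (ContinuousLinearMap.toSpanSingleton ℂ (T (e k))) :=
        isCompactOperator_of_locallyCompactSpace_rng _
      exact h1.comp_clm (innerSL ℂ (e k))
    induction s using Finset.cons_induction with
    | empty => simpa [F] using isCompactOperator_zero
    | cons k s hk ih =>
      simp only [F, Finset.sum_cons]
      exact (this k).add ih
  refine isCompactOperator_of_tendsto (l := Filter.atTop) (F := F) ?_ (.of_forall hF)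
  rw [tendsto_iff_norm_sub_tendsto_zero]
  have htail : Filter.Tendsto (fun s : Finset κ => √(∑' k : {k // k ∉ s}, ‖T (e k)‖ ^ 2))
      Filter.atTop (nhds 0) := by
    have := (Real.continuous_sqrt.tendsto 0).comp
      (tendsto_tsum_compl_atTop_zero fun k => ‖T (e k)‖ ^ 2)
    simpa [Function.comp_def] using this
  refine squeeze_zero (fun _ => norm_nonneg _) (fun s => ?_) htail
  refine ContinuousLinearMap.opNorm_le_bound _ (Real.sqrt_nonneg _) fun v => ?_
  have h1 : HasSum (fun k => ⟪e k, v⟫_ℂ • T (e k)) (T v) := by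
    have := (e.hasSum_repr v).mapL T
    simpa [e.repr_apply_apply] using this
  have h2 : HasSum (fun k : {k // k ∉ s} => ⟪e k, v⟫_ℂ • T (e k)) (T v - F s v) := by
    have h3 : F s v = ∑ k ∈ s, ⟪e k, v⟫_ℂ • T (e k) := by
      simp [F]
    rw [h3]
    exact (Finset.hasSum_iff_compl s).mp h1
  have h4 := hs.subtype {k | k ∉ s}
  rw [sub_apply, norm_sub_rev]
  refine le_of_tendsto h2.norm (Filter.Eventually.of_forall fun t => ?_)
  rw [← Real.sqrt_sq (norm_nonneg v), ← Real.sqrt_mul (tsum_nonneg fun _ => by positivity)]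
  refine Real.le_sqrt_of_sq_le ?_
  calc ‖∑ k ∈ t, ⟪e k, v⟫_ℂ • T (e k)‖ ^ 2 ≤ (∑ k ∈ t, ‖⟪e k, v⟫_ℂ‖ * ‖T (e k)‖) ^ 2 := by
        gcongr
        exact norm_sum_le_of_le _ fun k _ => (norm_smul _ _).le
    _ ≤ (∑ k ∈ t, ‖⟪e k, v⟫_ℂ‖ ^ 2) * ∑ k ∈ t, ‖T (e k)‖ ^ 2 :=
        Finset.sum_mul_sq_le_sq_mul_sq _ _ _
    _ ≤ ‖v‖ ^ 2 * ∑' k : {k // k ∉ s}, ‖T (e k)‖ ^ 2 := by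
        gcongr
        · have h5 := hasSum_norm_inner_sq e v
          rw [← h5.tsum_eq]
          refine le_trans (le_of_eq (Finset.sum_map t (Function.Embedding.subtype fun k => k ∉ s)
            fun k => ‖⟪e k, v⟫_ℂ‖ ^ 2).symm) ?_
          exact h5.summable.sum_le_tsum _ fun _ _ => by positivity
        · exact h4.sum_le_tsum t fun _ _ => by positivity
    _ = _ := mul_comm _ _

omit [CompleteSpace H] [CompleteSpace H'] in
theorem IsNegSuperposition.summable_norm_sq {κ : Type} [Countable κ] [SigmaFinite μ]
    (hT : IsNegSuperposition μ W V T) (hW : IsSquareIntegrableField μ W)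
    (hV : IsSquareIntegrableField μ V) (e : HilbertBasis κ ℂ H) :
    Summable fun k => ‖T (e k)‖ ^ 2 := by
  let _ : MeasurableSpace κ := ⊤
  obtain ⟨C, hC, hle⟩ := hT.exists_norm_apply_le hW hV
  refine Summable.of_nonneg_of_le (fun _ => by positivity) (fun k => ?_)
    ((hV.ellTwo_left e).summable_integral.mul_left (C ^ 2))
  calc ‖T (e k)‖ ^ 2 ≤ (C * √(∫ p, ‖⟪V p, e k⟫_ℂ‖ ^ 2 ∂μ)) ^ 2 := by gcongr; exact hle _
    _ = _ := by rw [mul_pow, Real.sq_sqrt (integral_nonneg fun _ => by positivity)]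

omit [CompleteSpace H] [CompleteSpace H'] in
/-- A product `T S T'` with outer factors superpositions of rank one operators and `S` bounded has
a matrix of trace class. -/
theorem IsNegSuperposition.isEllTwoDominated_comp {κ : Type} [Countable κ] [SigmaFinite μ]
    {W' : P → H} {V' : P → H'} {T' : H' →L[ℂ] H}
    (hT : IsNegSuperposition μ W V T) (hW : IsSquareIntegrableField μ W)
    (hV : IsSquareIntegrableField μ V) (hT' : IsNegSuperposition μ W' V' T')
    (hW' : IsSquareIntegrableField μ W') (hV' : IsSquareIntegrableField μ V')
    (e : HilbertBasis κ ℂ H') (S : H →L[ℂ] H) :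
    IsEllTwoDominated fun k l => ⟪e k, T (S (T' (e l)))⟫_ℂ := by
  let _ : MeasurableSpace κ := ⊤
  obtain ⟨C, hC, hle⟩ := hT.exists_norm_inner_le hW hV
  refine ⟨fun k => √(∫ p, ‖⟪e k, W p⟫_ℂ‖ ^ 2 ∂μ), fun l => C * ‖S‖ * ‖T' (e l)‖,
    fun _ => Real.sqrt_nonneg _, fun _ => by positivity, ?_, ?_, fun k l => ?_⟩
  · exact (hW.ellTwo_right e).summable_integral.congr fun k =>
      (Real.sq_sqrt (integral_nonneg fun _ => by positivity)).symm
  · exact ((hT'.summable_norm_sq hW' hV' e).mul_left ((C * ‖S‖) ^ 2)).congr fun k => by ring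
  · refine (hle _ _).trans (mul_le_mul_of_nonneg_left ?_ (Real.sqrt_nonneg _))
    change C * ‖S (T' (e l))‖ ≤ C * ‖S‖ * ‖T' (e l)‖
    rw [mul_assoc]
    gcongr
    exact S.le_opNorm _

end Superposition

/-! ### Elimination of the blocks -/

section Elimination

variable {P X : Type} [MeasurableSpace P] {μ : Measure P} [SigmaFinite μ] [MeasurableSpace X]
  {ν : Measure X} [SigmaFinite ν]
variable {H₁ H₂ : Type} [NormedAddCommGroup H₁] [InnerProductSpace ℂ H₁] [CompleteSpace H₁]
  [NormedAddCommGroup H₂] [InnerProductSpace ℂ H₂] [CompleteSpace H₂]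

theorem tsum_mul_integral {κ : Type} [Countable κ] {c : κ → ℂ} (hc : Summable fun k => ‖c k‖ ^ 2)
    {B : X → κ → ℂ} (hB : IsEllTwoField ν B) {g : X → ℂ} (hg : MemLp g 2 ν) :
    ∑' m, c m * ∫ x, B x m * g x ∂ν = ∫ x, (∑' m, c m * B x m) * g x ∂ν := by
  let _ : MeasurableSpace κ := ⊤
  have hint : ∀ m, Integrable (fun x => c m * (B x m * g x)) ν := fun m =>
    ((hB.ae_memLp m).integrable_mul hg).const_mul _
  have hb : ∀ m, ∫ x, ‖c m * (B x m * g x)‖ ∂ν ≤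
      √(∫ x, ‖g x‖ ^ 2 ∂ν) * (‖c m‖ * √(∫ x, ‖B x m‖ ^ 2 ∂ν)) := fun m => by
    have h1 : ∀ x, ‖c m * (B x m * g x)‖ = ‖c m‖ * ‖B x m * g x‖ := fun x => norm_mul _ _
    simp only [h1]
    rw [integral_const_mul]
    have h := integral_mul_le_Lp_mul_Lq_of_nonneg (μ := ν) (p := 2) (q := 2)
      (f := fun x => ‖B x m‖) (g := fun x => ‖g x‖) (by constructor <;> norm_num)
      (Filter.Eventually.of_forall fun _ => norm_nonneg _)
      (Filter.Eventually.of_forall fun _ => norm_nonneg _)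
      (by simpa using (hB.ae_memLp m).norm) (by simpa using hg.norm)
    have h2 : ∫ x, ‖B x m * g x‖ ∂ν ≤ √(∫ x, ‖B x m‖ ^ 2 ∂ν) * √(∫ x, ‖g x‖ ^ 2 ∂ν) := by
      simp only [norm_mul]
      refine h.trans (le_of_eq ?_)
      simp [Real.sqrt_eq_rpow]
    calc _ ≤ ‖c m‖ * (√(∫ x, ‖B x m‖ ^ 2 ∂ν) * √(∫ x, ‖g x‖ ^ 2 ∂ν)) := by gcongr
      _ = _ := by ring
  have hs : Summable fun m => ∫ x, ‖c m * (B x m * g x)‖ ∂ν := by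
    refine Summable.of_nonneg_of_le (fun m => integral_nonneg fun _ => norm_nonneg _) hb ?_
    refine (summable_mul_of_sq hc ?_).mul_left _
    exact hB.summable_integral.congr fun k =>
      (Real.sq_sqrt (integral_nonneg fun _ => by positivity)).symm
  have h := integral_tsum_of_summable_integral_norm hint hs
  simp only [integral_const_mul] at h
  rw [h]
  refine integral_congr_ae (Filter.Eventually.of_forall fun x => ?_)
  simp only [← mul_assoc]
  exact tsum_mul_right

/-- The data of the elimination: operators `Bo : H₁ → H₂` and `Bt : H₂ → H₁`, and the operator on
`L²(ν) ⊕ H₁ ⊕ H₂` with block matrix `-[[0, a₁, a₂], [b₁, 0, Bt], [b₂, Bo, 0]]`, presented as the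
superposition `∫ W_p ⟪V_p, ·⟫ dμ(p)`. The rows `a` and columns `b` are given by vector fields on
the measure space `X` (for the rows, up to complex conjugation). -/
structure BlockFactorization (μ : Measure P) (ν : Measure X) (V₀ W₀ : P → Lp ℂ 2 ν)
    (V₁ W₁ : P → H₁) (V₂ W₂ : P → H₂) (Bo : H₁ →L[ℂ] H₂) (Bt : H₂ →L[ℂ] H₁)
    (a₁ b₁ : X → H₁) (a₂ b₂ : X → H₂) : Prop where
  field_V₀ : IsSquareIntegrableField μ V₀
  field_W₀ : IsSquareIntegrableField μ W₀
  field_V₁ : IsSquareIntegrableField μ V₁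
  field_W₁ : IsSquareIntegrableField μ W₁
  field_V₂ : IsSquareIntegrableField μ V₂
  field_W₂ : IsSquareIntegrableField μ W₂
  field_a₁ : IsSquareIntegrableField ν a₁
  field_b₁ : IsSquareIntegrableField ν b₁
  field_a₂ : IsSquareIntegrableField ν a₂
  field_b₂ : IsSquareIntegrableField ν b₂
  block₀₀ : ∀ h h', ∫ p, ⟪h, W₀ p⟫_ℂ * ⟪V₀ p, h'⟫_ℂ ∂μ = 0
  block₁₁ : ∀ h h', ∫ p, ⟪h, W₁ p⟫_ℂ * ⟪V₁ p, h'⟫_ℂ ∂μ = 0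
  block₂₂ : ∀ h h', ∫ p, ⟪h, W₂ p⟫_ℂ * ⟪V₂ p, h'⟫_ℂ ∂μ = 0
  block₁₂ : IsNegSuperposition μ W₁ V₂ Bt
  block₂₁ : IsNegSuperposition μ W₂ V₁ Bo
  block₀₁ : ∀ (h : Lp ℂ 2 ν) h', ∫ p, ⟪h, W₀ p⟫_ℂ * ⟪V₁ p, h'⟫_ℂ ∂μ =
    -∫ x, starRingEnd ℂ (h x) * ⟪a₁ x, h'⟫_ℂ ∂ν
  block₀₂ : ∀ (h : Lp ℂ 2 ν) h', ∫ p, ⟪h, W₀ p⟫_ℂ * ⟪V₂ p, h'⟫_ℂ ∂μ =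
    -∫ x, starRingEnd ℂ (h x) * ⟪a₂ x, h'⟫_ℂ ∂ν
  block₁₀ : ∀ h (h' : Lp ℂ 2 ν), ∫ p, ⟪h, W₁ p⟫_ℂ * ⟪V₀ p, h'⟫_ℂ ∂μ =
    -∫ x, ⟪h, b₁ x⟫_ℂ * h' x ∂ν
  block₂₀ : ∀ h (h' : Lp ℂ 2 ν), ∫ p, ⟪h, W₂ p⟫_ℂ * ⟪V₀ p, h'⟫_ℂ ∂μ =
    -∫ x, ⟪h, b₂ x⟫_ℂ * h' x ∂ν

omit [SigmaFinite ν] in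
/-- Parseval's identity in `L²(ν)`, without complex conjugation. -/
theorem tsum_integral_mul_integral {κ : Type} (e : HilbertBasis κ ℂ (Lp ℂ 2 ν)) {f g : X → ℂ}
    (hf : MemLp f 2 ν) (hg : MemLp g 2 ν) :
    ∑' k, (∫ x, f x * e k x ∂ν) * (∫ x, starRingEnd ℂ (e k x) * g x ∂ν) =
      ∫ x, f x * g x ∂ν := by
  have h := e.tsum_inner_mul_inner (hf.star.toLp _) (hg.toLp g)
  have hf' := hf.star.coeFn_toLp
  have hg' := hg.coeFn_toLp
  have e1 : ∀ u : Lp ℂ 2 ν, ⟪hf.star.toLp _, u⟫_ℂ = ∫ x, f x * u x ∂ν := fun u => by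
    rw [L2.inner_def]
    refine integral_congr_ae ?_
    filter_upwards [hf'] with x hx
    rw [hx, RCLike.inner_apply]
    simp [mul_comm]
  have e2 : ∀ u : Lp ℂ 2 ν, ⟪u, hg.toLp g⟫_ℂ = ∫ x, starRingEnd ℂ (u x) * g x ∂ν := fun u => by
    rw [L2.inner_def]
    refine integral_congr_ae ?_
    filter_upwards [hg'] with x hx
    rw [hx, RCLike.inner_apply, mul_comm]
  simp only [e1, e2] at h
  rw [h]
  refine integral_congr_ae ?_
  filter_upwards [hg'] with x hx
  rw [hx]

variable {V₀ W₀ : P → Lp ℂ 2 ν} {V₁ W₁ : P → H₁} {V₂ W₂ : P → H₂} {Bo : H₁ →L[ℂ] H₂}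
  {Bt : H₂ →L[ℂ] H₁} {a₁ b₁ : X → H₁} {a₂ b₂ : X → H₂}
variable {κ₀ κ₁ κ₂ : Type} [Countable κ₀] [Countable κ₁] [Countable κ₂]
  [MeasurableSpace κ₀] [DiscreteMeasurableSpace κ₀] [MeasurableSpace κ₁]
  [DiscreteMeasurableSpace κ₁] [MeasurableSpace κ₂] [DiscreteMeasurableSpace κ₂]

/-- `⟪e_k, T v⟫` expanded in a Hilbert basis. -/
theorem tsum_inner_clm {H H' : Type} [NormedAddCommGroup H] [InnerProductSpace ℂ H]
    [CompleteSpace H] [NormedAddCommGroup H'] [InnerProductSpace ℂ H'] [CompleteSpace H']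
    {κ : Type} (e : HilbertBasis κ ℂ H) (T : H →L[ℂ] H') (h : H') (v : H) :
    HasSum (fun m => ⟪h, T (e m)⟫_ℂ * ⟪e m, v⟫_ℂ) ⟪h, T v⟫_ℂ := by
  simp only [← ContinuousLinearMap.adjoint_inner_left]
  exact e.hasSum_inner_mul_inner _ _

/-- The determinant of the block operator is the product of the determinant of `1 - Bt Bo` and of
the determinant of the Schur complement, an operator on `L²(ν)`. -/
theorem BlockFactorization.fredholmDet_eq
    (D : BlockFactorization μ ν V₀ W₀ V₁ W₁ V₂ W₂ Bo Bt a₁ b₁ a₂ b₂)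
    (e₀ : HilbertBasis κ₀ ℂ (Lp ℂ 2 ν)) (e₁ : HilbertBasis κ₁ ℂ H₁) (e₂ : HilbertBasis κ₂ ℂ H₂)
    {c₁ : X → H₁} {c₂ : X → H₂} (hc₁ : IsSquareIntegrableField ν c₁)
    (hc₂ : IsSquareIntegrableField ν c₂) (h₁ : ∀ x, c₁ x + Bt (c₂ x) = b₁ x)
    (h₂ : ∀ x, c₂ x + Bo (c₁ x) = b₂ x) :
    fredholmDet μ (fun p q => ⟪V₀ p, W₀ q⟫_ℂ + (⟪V₂ p, W₂ q⟫_ℂ + ⟪V₁ p, W₁ q⟫_ℂ)) =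
      fredholmDet Measure.count (fun k l => ⟪e₁ k, Bt (Bo (e₁ l))⟫_ℂ) *
        fredholmDet ν (fun x y => ⟪a₂ x, c₂ y⟫_ℂ + ⟪a₁ x, c₁ y⟫_ℂ) := by
  set A : P → κ₀ ⊕ (κ₂ ⊕ κ₁) → ℂ := fun p => Sum.elim (fun k => ⟪V₀ p, e₀ k⟫_ℂ)
    (Sum.elim (fun k => ⟪V₂ p, e₂ k⟫_ℂ) (fun k => ⟪V₁ p, e₁ k⟫_ℂ)) with hA
  set B : P → κ₀ ⊕ (κ₂ ⊕ κ₁) → ℂ := fun p => Sum.elim (fun k => ⟪e₀ k, W₀ p⟫_ℂ)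
    (Sum.elim (fun k => ⟪e₂ k, W₂ p⟫_ℂ) (fun k => ⟪e₁ k, W₁ p⟫_ℂ)) with hB
  have fA : IsEllTwoField μ A := (D.field_V₀.ellTwo_left e₀).sumElim
    ((D.field_V₂.ellTwo_left e₂).sumElim (D.field_V₁.ellTwo_left e₁))
  have fB : IsEllTwoField μ B := (D.field_W₀.ellTwo_right e₀).sumElim
    ((D.field_W₂.ellTwo_right e₂).sumElim (D.field_W₁.ellTwo_right e₁))
  have hker : (fun p q => ⟪V₀ p, W₀ q⟫_ℂ + (⟪V₂ p, W₂ q⟫_ℂ + ⟪V₁ p, W₁ q⟫_ℂ)) =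
      fun p q => ∑' k, A p k * B q k := by
    funext p q
    have h₂₁ : HasSum (fun k => A p (Sum.inr k) * B q (Sum.inr k)) _ :=
      HasSum.sum (f := fun k => A p (Sum.inr k) * B q (Sum.inr k))
        (e₂.hasSum_inner_mul_inner (V₂ p) (W₂ q)) (e₁.hasSum_inner_mul_inner (V₁ p) (W₁ q))
    exact (HasSum.sum (f := fun k => A p k * B q k)
      (e₀.hasSum_inner_mul_inner (V₀ p) (W₀ q)) h₂₁).tsum_eq.symm
  -- `det (1 - A B) = det (1 - B A)`: from here on everything happens on matrices
  rw [hker, fredholmDet_tsum fA fB]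
  set G : κ₀ ⊕ (κ₂ ⊕ κ₁) → κ₀ ⊕ (κ₂ ⊕ κ₁) → ℂ := fun k l => ∫ p, B p k * A p l ∂μ with hG
  have dG : IsEllTwoDominated G := isEllTwoDominated_integral fA fB
  -- the rows and columns of the Schur complement
  set α : X → κ₂ ⊕ κ₁ → ℂ := fun x =>
    Sum.elim (fun k => ⟪a₂ x, e₂ k⟫_ℂ) (fun k => ⟪a₁ x, e₁ k⟫_ℂ) with hα
  set β : X → κ₂ ⊕ κ₁ → ℂ := fun x =>
    Sum.elim (fun k => ⟪e₂ k, b₂ x⟫_ℂ) (fun k => ⟪e₁ k, b₁ x⟫_ℂ) with hβ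
  set γ : X → κ₂ ⊕ κ₁ → ℂ := fun x =>
    Sum.elim (fun k => ⟪e₂ k, c₂ x⟫_ℂ) (fun k => ⟪e₁ k, c₁ x⟫_ℂ) with hγ
  have fα : IsEllTwoField ν α :=
    (D.field_a₂.ellTwo_left e₂).sumElim (D.field_a₁.ellTwo_left e₁)
  have fβ : IsEllTwoField ν β :=
    (D.field_b₂.ellTwo_right e₂).sumElim (D.field_b₁.ellTwo_right e₁)
  have fγ : IsEllTwoField ν γ := (hc₂.ellTwo_right e₂).sumElim (hc₁.ellTwo_right e₁)
  set Γ₁ : κ₂ ⊕ κ₁ → κ₂ ⊕ κ₁ → ℂ := fun k l => G (Sum.inr k) (Sum.inr l) with hΓ₁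
  set Γ₂ : κ₂ ⊕ κ₁ → κ₂ ⊕ κ₁ → ℂ := fun k l => ∫ x, γ x k * α x l ∂ν with hΓ₂
  have dΓ₁ : IsEllTwoDominated Γ₁ := by
    obtain ⟨φ, ψ, p1, p2, p3, p4, p5⟩ := dG
    exact ⟨fun k => φ (Sum.inr k), fun k => ψ (Sum.inr k), fun k => p1 _, fun k => p2 _,
      p3.comp_injective Sum.inr_injective, p4.comp_injective Sum.inr_injective,
      fun k l => p5 _ _⟩
  have dΓ₂ : IsEllTwoDominated Γ₂ := isEllTwoDominated_integral fα fγ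
  have g22 : ∀ k l, Γ₁ (Sum.inl k) (Sum.inl l) = 0 := fun k l => D.block₂₂ _ _
  have g11 : ∀ k l, Γ₁ (Sum.inr k) (Sum.inr l) = 0 := fun k l => D.block₁₁ _ _
  have g21 : ∀ k l, Γ₁ (Sum.inl k) (Sum.inr l) = -⟪e₂ k, Bo (e₁ l)⟫_ℂ := fun k l =>
    D.block₂₁ _ _
  have g12 : ∀ k l, Γ₁ (Sum.inr k) (Sum.inl l) = -⟪e₁ k, Bt (e₂ l)⟫_ℂ := fun k l =>
    D.block₁₂ _ _
  have gcol : ∀ k m, G (Sum.inr k) (Sum.inl m) = -∫ x, β x k * e₀ m x ∂ν := by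
    rintro (k | k) m
    · exact D.block₂₀ _ _
    · exact D.block₁₀ _ _
  have grow : ∀ m l, G (Sum.inl m) (Sum.inr l) =
      -∫ x, starRingEnd ℂ (e₀ m x) * α x l ∂ν := by
    rintro m (l | l)
    · exact D.block₀₂ _ _
    · exact D.block₀₁ _ _
  -- the rows of `1 - Γ₁` applied to `γ` give `β`
  have hrow : ∀ x k, HasSum (fun m => Γ₁ k m * γ x m) (γ x k - β x k) := by
    rintro x (k | k)
    · have hs : HasSum (fun m => Γ₁ (Sum.inl k) m * γ x m) (0 + -⟪e₂ k, Bo (c₁ x)⟫_ℂ) := by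
        refine HasSum.sum ?_ ?_
        · convert! (hasSum_zero : HasSum (fun _ : κ₂ => (0 : ℂ)) 0) using 1
          funext m
          simp only [Function.comp_apply, g22, zero_mul]
        · convert! (tsum_inner_clm e₁ Bo (e₂ k) (c₁ x)).neg using 1
          funext m
          simp only [Function.comp_apply, g21, hγ, Sum.elim_inr, neg_mul]
      convert! hs using 1
      simp only [hγ, hβ, Sum.elim_inl, ← h₂, inner_add_right]
      ring
    · have hs : HasSum (fun m => Γ₁ (Sum.inr k) m * γ x m) (-⟪e₁ k, Bt (c₂ x)⟫_ℂ + 0) := by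
        refine HasSum.sum ?_ ?_
        · convert! (tsum_inner_clm e₂ Bt (e₁ k) (c₂ x)).neg using 1
          funext m
          simp only [Function.comp_apply, g12, hγ, Sum.elim_inl, neg_mul]
        · convert! (hasSum_zero : HasSum (fun _ : κ₁ => (0 : ℂ)) 0) using 1
          funext m
          simp only [Function.comp_apply, g11, zero_mul]
      convert! hs using 1
      simp only [hγ, hβ, Sum.elim_inr, ← h₁, inner_add_right]
      ring
  have sΓ₁ : ∀ k, Summable fun l => ‖Γ₁ k l‖ ^ 2 := by
    obtain ⟨φ, ψ, p1, p2, p3, p4, p5⟩ := dΓ₁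
    exact summable_sq_row p4 p5
  have hprod : ∀ k l, ∑' m, Γ₁ k m * Γ₂ m l = Γ₂ k l - ∫ x, β x k * α x l ∂ν := by
    intro k l
    have e := tsum_mul_integral (sΓ₁ k) fγ (fα.ae_memLp l)
    simp only [(hrow _ k).tsum_eq, sub_mul] at e
    rw [hΓ₂]
    simp only
    rw [e, integral_sub]
    · exact (fγ.ae_memLp k).integrable_mul (fα.ae_memLp l)
    · exact (fβ.ae_memLp k).integrable_mul (fα.ae_memLp l)
  -- the vanishing diagonal block of `L²(ν)` is eliminated first
  rw [fredholmDet_schur dG fun i j => D.block₀₀ _ _]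
  have hsch : (fun k l => G (Sum.inr k) (Sum.inr l) +
      ∑' m, G (Sum.inr k) (Sum.inl m) * G (Sum.inl m) (Sum.inr l)) =
      fun k l => Γ₁ k l + Γ₂ k l - ∑' m, Γ₁ k m * Γ₂ m l := by
    funext k l
    simp only [gcol, grow, neg_mul_neg]
    rw [tsum_integral_mul_integral e₀ (fβ.ae_memLp k) (fα.ae_memLp l), hprod]
    simp only [hΓ₁]
    ring
  -- `1 - Γ₁ - β α = (1 - Γ₁) (1 - γ α)`, since `(1 - Γ₁) γ = β`
  rw [hsch, ← fredholmDet_mul dΓ₁ dΓ₂]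
  congr 1
  · rw [fredholmDet_schur dΓ₁ g22]
    congr 1
    funext k l
    simp only [g11, g12, g21, neg_mul_neg, zero_add]
    exact (tsum_inner_clm e₂ Bt (e₁ k) (Bo (e₁ l))).tsum_eq
  · rw [hΓ₂, ← fredholmDet_tsum fα fγ]
    congr 1
    funext x y
    exact HasSum.tsum_eq (HasSum.sum (e₂.hasSum_inner_mul_inner _ _)
      (e₁.hasSum_inner_mul_inner _ _))

omit [SigmaFinite ν] [CompleteSpace H₂] in
/-- The determinant of `1 - Bt Bo` does not vanish if the operator is invertible. -/
theorem BlockFactorization.fredholmDet_ne_zero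
    (D : BlockFactorization μ ν V₀ W₀ V₁ W₁ V₂ W₂ Bo Bt a₁ b₁ a₂ b₂)
    (e₁ : HilbertBasis κ₁ ℂ H₁) {R : H₂ →L[ℂ] H₂}
    (hR : ∀ v, R v - Bo (Bt (R v)) = v) :
    fredholmDet Measure.count (fun k l => ⟪e₁ k, Bt (Bo (e₁ l))⟫_ℂ) ≠ 0 := by
  have d₁ : IsEllTwoDominated fun k l => ⟪e₁ k, Bt (Bo (e₁ l))⟫_ℂ :=
    D.block₁₂.isEllTwoDominated_comp D.field_W₁ D.field_V₂ D.block₂₁ D.field_W₂ D.field_V₁ e₁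
      (ContinuousLinearMap.id ℂ H₂)
  -- `(1 - Bt Bo)⁻¹ = 1 + Bt R Bo`
  have d₂ : IsEllTwoDominated fun k l => ⟪e₁ k, Bt ((-R) (Bo (e₁ l)))⟫_ℂ :=
    D.block₁₂.isEllTwoDominated_comp D.field_W₁ D.field_V₂ D.block₂₁ D.field_W₂ D.field_V₁ e₁
      (-R)
  have h := fredholmDet_mul d₁ d₂
  have h0 : (fun k l => ⟪e₁ k, Bt (Bo (e₁ l))⟫_ℂ + ⟪e₁ k, Bt ((-R) (Bo (e₁ l)))⟫_ℂ -
      ∑' m, ⟪e₁ k, Bt (Bo (e₁ m))⟫_ℂ * ⟪e₁ m, Bt ((-R) (Bo (e₁ l)))⟫_ℂ) =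
      fun _ _ => (0 : ℂ) := by
    funext k l
    have hs : ∑' m, ⟪e₁ k, Bt (Bo (e₁ m))⟫_ℂ * ⟪e₁ m, Bt ((-R) (Bo (e₁ l)))⟫_ℂ =
        ⟪e₁ k, (Bt ∘L Bo) (Bt ((-R) (Bo (e₁ l))))⟫_ℂ :=
      (tsum_inner_clm e₁ (Bt ∘L Bo) (e₁ k) (Bt ((-R) (Bo (e₁ l))))).tsum_eq
    rw [hs, ← inner_add_right, ← inner_sub_right]
    have : Bt (Bo (e₁ l)) + Bt ((-R) (Bo (e₁ l))) -
        (Bt ∘L Bo) (Bt ((-R) (Bo (e₁ l)))) = 0 := by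
      have h1 := hR (Bo (e₁ l))
      simp only [ContinuousLinearMap.comp_apply, neg_apply, map_neg]
      nth_rewrite 1 [← h1]
      rw [map_sub]
      abel
    rw [this, inner_zero_right]
  rw [h0] at h
  have h1 : fredholmDet (Measure.count : Measure κ₁) (fun _ _ => (0 : ℂ)) = 1 := by
    rw [fredholmDet, tsum_eq_single 0]
    · simp [fredholmTerm, measureReal_def]
    · intro n hn
      obtain ⟨m, rfl⟩ := Nat.exists_eq_succ_of_ne_zero hn
      have : Matrix.det (Matrix.of fun _ _ : Fin (m + 1) => (0 : ℂ)) = 0 :=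
        Matrix.det_eq_zero_of_row_eq_zero 0 fun _ => rfl
      simp only [fredholmTerm, this, integral_zero, mul_zero]
  rw [h1] at h
  exact left_ne_zero_of_mul (h ▸ one_ne_zero)

end Elimination

/-! ### Kernels dominated by a product of square integrable functions -/

section HilbertBasis

/-- A separable Hilbert space has a countable Hilbert basis. -/
theorem exists_countable_hilbertBasis (H : Type) [NormedAddCommGroup H] [InnerProductSpace ℂ H]
    [CompleteSpace H] [SecondCountableTopology H] :
    ∃ κ : Type, ∃ _ : Countable κ, Nonempty (HilbertBasis κ ℂ H) := by
  obtain ⟨w, b, hb⟩ := exists_hilbertBasis ℂ H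
  refine ⟨w, ?_, ⟨b⟩⟩
  have ho := b.orthonormal
  -- the balls of radius `1/2` around the basis vectors are disjoint
  have hd : Pairwise (Function.onFun Disjoint fun i : w => Metric.ball (b i) (1 / 2)) := by
    intro i j hij
    refine Metric.ball_disjoint_ball ?_
    have h1 : ‖b i - b j‖ ^ 2 = 2 := by
      rw [@norm_sub_sq ℂ, ho.1 i, ho.1 j, ho.2 hij]
      norm_num
    rw [dist_eq_norm]
    nlinarith [norm_nonneg (b i - b j)]
  rw [← Set.countable_univ_iff]
  refine Set.PairwiseDisjoint.countable_of_isOpen (s := fun i : w => Metric.ball (b i) (1 / 2))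
    (fun i _ j _ hij => hd hij) (fun _ _ => Metric.isOpen_ball) fun i _ => ⟨b i, by simp⟩

/-- Separability of `Lp` is an instance for finite exponents, given as a `Fact`. -/
instance fact_two_ne_top : Fact ((2 : ENNReal) ≠ ⊤) := ⟨by simp⟩

end HilbertBasis

section ProductBound

variable {X Y Z : Type} [MeasurableSpace X] [MeasurableSpace Y] [MeasurableSpace Z]
  {μ : Measure X} {ν : Measure Y} {ρ : Measure Z}

theorem toL2_of_memLp {f : X → ℂ} (hf : MemLp f 2 μ) : toL2 μ f = hf.toLp f := by
  rw [toL2, dif_pos hf]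

theorem coeFn_toL2 {f : X → ℂ} (hf : MemLp f 2 μ) : toL2 μ f =ᵐ[μ] f := by
  rw [toL2_of_memLp hf]
  exact hf.coeFn_toLp

theorem inner_toL2_right {f : X → ℂ} (hf : MemLp f 2 μ) (h : Lp ℂ 2 μ) :
    ⟪h, toL2 μ f⟫_ℂ = ∫ x, starRingEnd ℂ (h x) * f x ∂μ := by
  rw [L2.inner_def]
  refine integral_congr_ae ?_
  filter_upwards [coeFn_toL2 hf] with x hx
  rw [hx, RCLike.inner_apply, mul_comm]

theorem inner_toL2_left {f : X → ℂ} (hf : MemLp f 2 μ) (h : Lp ℂ 2 μ) :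
    ⟪toL2 μ f, h⟫_ℂ = ∫ x, starRingEnd ℂ (f x) * h x ∂μ := by
  rw [L2.inner_def]
  refine integral_congr_ae ?_
  filter_upwards [coeFn_toL2 hf] with x hx
  rw [hx, RCLike.inner_apply, mul_comm]

theorem norm_sq_eq_integral (h : Lp ℂ 2 μ) : ‖h‖ ^ 2 = ∫ x, ‖h x‖ ^ 2 ∂μ := by
  have h1 : ⟪h, h⟫_ℂ = ((∫ x, ‖h x‖ ^ 2 ∂μ : ℝ) : ℂ) := by
    rw [L2.inner_def, ← integral_complex_ofReal]
    refine integral_congr_ae (Filter.Eventually.of_forall fun x => ?_)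
    simp only [RCLike.inner_apply, Complex.mul_conj, Complex.normSq_eq_norm_sq]
  rw [inner_self_eq_norm_sq_to_K] at h1
  exact Complex.ofReal_injective ((Complex.ofReal_pow _ _).trans h1)

theorem norm_toL2_le {f : X → ℂ} {φ : ℝ} (hφ : 0 ≤ φ)
    (h : MemLp f 2 μ → ∫ x, ‖f x‖ ^ 2 ∂μ ≤ φ ^ 2) : ‖toL2 μ f‖ ≤ φ := by
  by_cases hf : MemLp f 2 μ
  · refine le_of_sq_le_sq ?_ hφ
    rw [norm_sq_eq_integral]
    refine le_trans (le_of_eq (integral_congr_ae ?_)) (h hf)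
    filter_upwards [coeFn_toL2 hf] with x hx
    rw [hx]
  · rw [toL2, dif_neg hf, norm_zero]
    exact hφ

/-- A measurable kernel bounded almost everywhere by a product of two square integrable
functions. -/
structure IsProductBounded (μ : Measure X) (ν : Measure Y) (F : X → Y → ℂ) : Prop where
  measurable : Measurable (Function.uncurry F)
  exists_bound : ∃ (S : Set X) (T : Set Y) (φ : X → ℝ) (ψ : Y → ℝ), (∀ᵐ x ∂μ, x ∈ S) ∧
    (∀ᵐ y ∂ν, y ∈ T) ∧ (∀ x, 0 ≤ φ x) ∧ (∀ y, 0 ≤ ψ y) ∧ MemLp φ 2 μ ∧ MemLp ψ 2 ν ∧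
    ∀ x ∈ S, ∀ y ∈ T, ‖F x y‖ ≤ φ x * ψ y

variable {F : X → Y → ℂ}

theorem IsProductBounded.swap (hF : IsProductBounded μ ν F) :
    IsProductBounded ν μ fun y x => F x y := by
  obtain ⟨S, T, φ, ψ, hS, hT, h1, h2, h3, h4, h5⟩ := hF.exists_bound
  exact ⟨hF.measurable.comp measurable_swap, T, S, ψ, φ, hT, hS, h2, h1, h4, h3,
    fun y hy x hx => (h5 x hx y hy).trans_eq (mul_comm _ _)⟩

theorem IsProductBounded.conj (hF : IsProductBounded μ ν F) :
    IsProductBounded μ ν fun x y => starRingEnd ℂ (F x y) := by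
  obtain ⟨S, T, φ, ψ, hS, hT, h1, h2, h3, h4, h5⟩ := hF.exists_bound
  exact ⟨Complex.continuous_conj.measurable.comp hF.measurable, S, T, φ, ψ, hS, hT, h1, h2, h3, h4,
    fun x hx y hy => by rw [RCLike.norm_conj]; exact h5 x hx y hy⟩

theorem IsProductBounded.add {G : X → Y → ℂ} (hF : IsProductBounded μ ν F)
    (hG : IsProductBounded μ ν G) : IsProductBounded μ ν fun x y => F x y + G x y := by
  obtain ⟨S, T, φ, ψ, hS, hT, h1, h2, h3, h4, h5⟩ := hF.exists_bound
  obtain ⟨S', T', φ', ψ', hS', hT', h1', h2', h3', h4', h5'⟩ := hG.exists_bound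
  refine ⟨hF.measurable.add hG.measurable, S ∩ S', T ∩ T', fun x => φ x + φ' x,
    fun y => ψ y + ψ' y, hS.and hS', hT.and hT', fun x => add_nonneg (h1 x) (h1' x),
    fun y => add_nonneg (h2 y) (h2' y), h3.add h3', h4.add h4', fun x hx y hy => ?_⟩
  refine (norm_add_le _ _).trans ?_
  have := h5 x hx.1 y hy.1
  have := h5' x hx.2 y hy.2
  nlinarith [mul_nonneg (h1 x) (h2' y), mul_nonneg (h1' x) (h2 y)]

theorem IsProductBounded.section_memLp (hF : IsProductBounded μ ν F) :
    ∀ᵐ x ∂μ, MemLp (F x) 2 ν := by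
  obtain ⟨S, T, φ, ψ, hS, hT, h1, h2, h3, h4, h5⟩ := hF.exists_bound
  filter_upwards [hS] with x hx
  refine (h4.const_mul (φ x)).of_le
    (hF.measurable.comp measurable_prodMk_left).aestronglyMeasurable ?_
  filter_upwards [hT] with y hy
  rw [Real.norm_of_nonneg (mul_nonneg (h1 x) (h2 y))]
  exact h5 x hx y hy

variable [SFinite ν] [SFinite μ] [SFinite ρ]

omit [SFinite μ] in
/-- The sections of a product bounded kernel form a square integrable vector field. -/
theorem IsProductBounded.field (hF : IsProductBounded μ ν F) :
    IsSquareIntegrableField μ fun x => toL2 ν (F x) := by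
  refine ⟨fun h => ?_, ?_⟩
  · have hm : MeasurableSet {x | MemLp (F x) 2 ν} := by
      have : {x | MemLp (F x) 2 ν} = {x | ∫⁻ y, ‖F x y‖ₑ ^ (2 : ℝ) ∂ν < ⊤} := by
        ext x
        have hx := (hF.measurable.comp (measurable_prodMk_left (x := x))).aestronglyMeasurable
          (μ := ν)
        have := eLpNorm_lt_top_iff_lintegral_rpow_enorm_lt_top (f := F x) (μ := ν) (p := 2)
          (by simp) (by simp)
        simp only [ENNReal.toReal_ofNat] at this
        exact ⟨fun h => this.mp h.2, fun h => ⟨hx, this.mpr h⟩⟩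
      rw [this]
      refine measurableSet_lt (Measurable.lintegral_prod_right' (f := fun p : X × Y =>
        ‖F p.1 p.2‖ₑ ^ (2 : ℝ)) ?_) measurable_const
      exact (hF.measurable.enorm).pow_const _
    have h2 : (fun x => ⟪h, toL2 ν (F x)⟫_ℂ) = indicator {x | MemLp (F x) 2 ν}
        fun x => ∫ y, starRingEnd ℂ (h y) * F x y ∂ν := by
      funext x
      by_cases hx : MemLp (F x) 2 ν
      · rw [indicator_of_mem (by exact hx), inner_toL2_right hx]
      · rw [indicator_of_notMem (by exact hx), toL2, dif_neg hx, inner_zero_right]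
    rw [h2]
    refine Measurable.indicator ?_ hm
    have h3 : Measurable fun p : X × Y => starRingEnd ℂ (h p.2) * F p.1 p.2 :=
      (Complex.continuous_conj.measurable.comp
        ((Lp.stronglyMeasurable h).measurable.comp measurable_snd)).mul hF.measurable
    exact (h3.stronglyMeasurable.integral_prod_right' (ν := ν)).measurable
  · obtain ⟨S, T, φ, ψ, hS, hT, h1, h2, h3, h4, h5⟩ := hF.exists_bound
    refine ⟨fun x => φ x * √(∫ y, ψ y ^ 2 ∂ν), fun x => mul_nonneg (h1 x) (Real.sqrt_nonneg _),
      h3.mul_const _, ?_⟩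
    filter_upwards [hS] with x hx
    refine norm_toL2_le (mul_nonneg (h1 x) (Real.sqrt_nonneg _)) fun hf => ?_
    rw [mul_pow, Real.sq_sqrt (integral_nonneg fun _ => by positivity), ← integral_const_mul]
    refine integral_mono_ae hf.norm.integrable_sq (h4.integrable_sq.const_mul _) ?_
    filter_upwards [hT] with y hy
    rw [← mul_pow]
    exact pow_le_pow_left₀ (norm_nonneg _) (h5 x hx y hy) 2

omit [SFinite ν] [SFinite μ] in
/-- The absolute convergence behind the exchange of integrals. -/
theorem IsProductBounded.integrable_mul (hF : IsProductBounded μ ν F) {f : X → ℂ} {g : Y → ℂ}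
    (hf : MemLp f 2 μ) (hg : MemLp g 2 ν) :
    Integrable (fun p : X × Y => f p.1 * (F p.1 p.2 * g p.2)) (μ.prod ν) := by
  obtain ⟨S, T, φ, ψ, hS, hT, h1, h2, h3, h4, h5⟩ := hF.exists_bound
  have hb := ((hf.norm.integrable_mul h3).mul_prod (hg.norm.integrable_mul h4))
  refine hb.mono ?_ ?_
  · exact hf.1.comp_fst.mul (hF.measurable.aestronglyMeasurable.mul hg.1.comp_snd)
  · filter_upwards [Measure.quasiMeasurePreserving_fst.tendsto_ae.eventually hS,
      Measure.quasiMeasurePreserving_snd.tendsto_ae.eventually hT] with p hp1 hp2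
    simp only [Pi.mul_apply, norm_mul, norm_norm, Real.norm_of_nonneg (h1 _),
      Real.norm_of_nonneg (h2 _)]
    have := h5 _ hp1 _ hp2
    calc _ ≤ ‖f p.1‖ * ((φ p.1 * ψ p.2) * ‖g p.2‖) := by gcongr
      _ = _ := by ring

omit [SFinite ν] [SFinite μ] in
theorem IsProductBounded.integral_norm_sq_le (hF : IsProductBounded μ ν F) :
    ∃ φ : X → ℝ, (∀ x, 0 ≤ φ x) ∧ MemLp φ 2 μ ∧ ∀ g : Y → ℂ, MemLp g 2 ν → ∀ᵐ x ∂μ,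
      Integrable (fun y => F x y * g y) ν ∧
      ‖∫ y, F x y * g y ∂ν‖ ≤ φ x * √(∫ y, ‖g y‖ ^ 2 ∂ν) := by
  obtain ⟨S, T, φ, ψ, hS, hT, h1, h2, h3, h4, h5⟩ := hF.exists_bound
  refine ⟨fun x => φ x * √(∫ y, ψ y ^ 2 ∂ν), fun x => mul_nonneg (h1 x) (Real.sqrt_nonneg _),
    h3.mul_const _, fun g hg => ?_⟩
  filter_upwards [hS, hF.section_memLp] with x hx hm
  refine ⟨hm.integrable_mul hg, (norm_integral_mul_le_sqrt hm hg).trans ?_⟩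
  refine mul_le_mul_of_nonneg_right ?_ (Real.sqrt_nonneg _)
  refine Real.sqrt_le_iff.mpr ⟨mul_nonneg (h1 x) (Real.sqrt_nonneg _), ?_⟩
  rw [mul_pow, Real.sq_sqrt (integral_nonneg fun _ => by positivity), ← integral_const_mul]
  refine integral_mono_ae hm.norm.integrable_sq (h4.integrable_sq.const_mul _) ?_
  filter_upwards [hT] with y hy
  rw [← mul_pow]
  exact pow_le_pow_left₀ (norm_nonneg _) (h5 x hx y hy) 2

/-- `T` is the bounded operator from `L²(ν)` to `L²(μ)` with integral kernel `F`. -/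
def HasKernel (μ : Measure X) (ν : Measure Y) (F : X → Y → ℂ) (T : Lp ℂ 2 ν →L[ℂ] Lp ℂ 2 μ) :
    Prop :=
  ∀ g : Lp ℂ 2 ν, ∀ᵐ x ∂μ, Integrable (fun y => F x y * g y) ν ∧ T g x = ∫ y, F x y * g y ∂ν

omit [SFinite μ] in
theorem IsProductBounded.memLp_integral (hF : IsProductBounded μ ν F) {g : Y → ℂ}
    (hg : MemLp g 2 ν) : MemLp (fun x => ∫ y, F x y * g y ∂ν) 2 μ := by
  obtain ⟨φ, hφ0, hφ, hb⟩ := hF.integral_norm_sq_le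
  refine (hφ.mul_const (√(∫ y, ‖g y‖ ^ 2 ∂ν))).of_le ?_ ?_
  · exact (hF.measurable.aestronglyMeasurable.mul hg.1.comp_snd).integral_prod_right'
  · filter_upwards [hb g hg] with x hx
    rw [Real.norm_of_nonneg (mul_nonneg (hφ0 x) (Real.sqrt_nonneg _))]
    exact hx.2

omit [SFinite μ] in
theorem IsProductBounded.exists_hasKernel (hF : IsProductBounded μ ν F) :
    ∃ T, HasKernel μ ν F T := by
  obtain ⟨φ, hφ0, hφ, hb⟩ := hF.integral_norm_sq_le
  have hm : ∀ g : Lp ℂ 2 ν, MemLp (fun x => ∫ y, F x y * g y ∂ν) 2 μ := fun g =>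
    hF.memLp_integral (Lp.memLp g)
  let T₀ : Lp ℂ 2 ν →ₗ[ℂ] Lp ℂ 2 μ :=
    { toFun := fun g => toL2 μ fun x => ∫ y, F x y * g y ∂ν
      map_add' := fun g g' => by
        refine Lp.ext ?_
        filter_upwards [coeFn_toL2 (hm g), coeFn_toL2 (hm g'), coeFn_toL2 (hm (g + g')),
          Lp.coeFn_add (toL2 μ fun x => ∫ y, F x y * g y ∂ν)
            (toL2 μ fun x => ∫ y, F x y * g' y ∂ν), hb g (Lp.memLp g), hb g' (Lp.memLp g')]
          with x e1 e2 e3 e4 i1 i2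
        rw [e3, e4, Pi.add_apply, e1, e2, ← integral_add i1.1 i2.1]
        refine integral_congr_ae ?_
        filter_upwards [Lp.coeFn_add g g'] with y hy
        rw [hy, Pi.add_apply, mul_add]
      map_smul' := fun c g => by
        refine Lp.ext ?_
        filter_upwards [coeFn_toL2 (hm g), coeFn_toL2 (hm (c • g)),
          Lp.coeFn_smul c (toL2 μ fun x => ∫ y, F x y * g y ∂ν)] with x e1 e2 e3
        simp only [RingHom.id_apply]
        rw [e2, e3, Pi.smul_apply, e1, smul_eq_mul, ← integral_const_mul]
        refine integral_congr_ae ?_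
        filter_upwards [Lp.coeFn_smul c g] with y hy
        rw [hy, Pi.smul_apply, smul_eq_mul]
        ring }
  have hbound : ∀ g, ‖T₀ g‖ ≤ √(∫ x, φ x ^ 2 ∂μ) * ‖g‖ := fun g => by
    refine norm_toL2_le (by positivity) fun hf => ?_
    rw [mul_pow, Real.sq_sqrt (integral_nonneg fun _ => by positivity), norm_sq_eq_integral,
      ← integral_mul_const]
    refine integral_mono_ae hf.norm.integrable_sq (hφ.integrable_sq.mul_const _) ?_
    filter_upwards [hb g (Lp.memLp g)] with x hx
    refine (pow_le_pow_left₀ (norm_nonneg _) hx.2 2).trans_eq ?_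
    rw [mul_pow, Real.sq_sqrt (integral_nonneg fun _ => by positivity)]
  refine ⟨T₀.mkContinuous _ hbound, fun g => ?_⟩
  filter_upwards [coeFn_toL2 (hm g), hb g (Lp.memLp g)] with x e1 e2
  exact ⟨e2.1, e1⟩

omit [SFinite ν] [SFinite μ] in
theorem HasKernel.inner_eq {T : Lp ℂ 2 ν →L[ℂ] Lp ℂ 2 μ} (hT : HasKernel μ ν F T) (h : Lp ℂ 2 μ)
    (g : Lp ℂ 2 ν) :
    ⟪h, T g⟫_ℂ = ∫ x, starRingEnd ℂ (h x) * ∫ y, F x y * g y ∂ν ∂μ := by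
  rw [L2.inner_def]
  refine integral_congr_ae ?_
  filter_upwards [hT g] with x hx
  rw [RCLike.inner_apply, hx.2, mul_comm]

/-- `⟪h, T g⟫` integrated in the other order. -/
theorem HasKernel.inner_eq_swap {T : Lp ℂ 2 ν →L[ℂ] Lp ℂ 2 μ} (hT : HasKernel μ ν F T)
    (hF : IsProductBounded μ ν F) (h : Lp ℂ 2 μ) (g : Lp ℂ 2 ν) :
    ⟪h, T g⟫_ℂ = ∫ y, ⟪h, toL2 μ fun x => F x y⟫_ℂ * g y ∂ν := by
  have hi := hF.integrable_mul (Lp.memLp h).star (Lp.memLp g)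
  rw [hT.inner_eq]
  simp only [← integral_const_mul]
  refine (integral_integral_swap hi).trans (integral_congr_ae ?_)
  filter_upwards [hF.swap.section_memLp] with y hy
  rw [inner_toL2_right hy, ← integral_mul_const]
  refine integral_congr_ae (Filter.Eventually.of_forall fun x => ?_)
  simp only
  ring

omit [SFinite ν] [SFinite μ] in
theorem HasKernel.unique {T T' : Lp ℂ 2 ν →L[ℂ] Lp ℂ 2 μ} (hT : HasKernel μ ν F T)
    (hT' : HasKernel μ ν F T') : T = T' := by
  ext1 g
  refine Lp.ext ?_
  filter_upwards [hT g, hT' g] with x h1 h2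
  rw [h1.2, h2.2]

omit [SFinite μ] in
theorem HasKernel.integralOperator_eq {K : X → X → ℂ} {T : Lp ℂ 2 μ →L[ℂ] Lp ℂ 2 μ}
    (hT : HasKernel μ μ K T) : integralOperator μ K = T := by
  have h : ∃ T, IsIntegralOperator μ K T := ⟨T, hT⟩
  rw [integralOperator, dif_pos h]
  exact HasKernel.unique h.choose_spec hT

omit [SFinite ν] [SFinite μ] in
theorem HasKernel.congr {F' : X → Y → ℂ} {T : Lp ℂ 2 ν →L[ℂ] Lp ℂ 2 μ} (hT : HasKernel μ ν F T)
    (h : ∀ᵐ x ∂μ, ∀ᵐ y ∂ν, F' x y = F x y) : HasKernel μ ν F' T := by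
  intro g
  filter_upwards [hT g, h] with x hx h'
  have e : (fun y => F' x y * g y) =ᵐ[ν] fun y => F x y * g y := h'.mono fun y hy => by
    simp only [hy]
  exact ⟨hx.1.congr e.symm, hx.2.trans (integral_congr_ae e.symm)⟩

omit [SFinite μ] [SFinite ρ] in
/-- Composition of kernels. -/
theorem IsProductBounded.comp {G : Y → Z → ℂ} (hF : IsProductBounded μ ν F)
    (hG : IsProductBounded ν ρ G) :
    IsProductBounded μ ρ fun x z => ∫ y, F x y * G y z ∂ν := by
  obtain ⟨S, T, φ, ψ, hS, hT, h1, h2, h3, h4, h5⟩ := hF.exists_bound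
  obtain ⟨S', T', φ', ψ', hS', hT', h1', h2', h3', h4', h5'⟩ := hG.exists_bound
  refine ⟨?_, S, T', fun x => φ x * ∫ y, ψ y * φ' y ∂ν, ψ', hS, hT',
    fun x => mul_nonneg (h1 x) (integral_nonneg fun y => mul_nonneg (h2 y) (h1' y)), h2',
    h3.mul_const _, h4', fun x hx z hz => ?_⟩
  · have : Measurable fun p : (X × Z) × Y => F p.1.1 p.2 * G p.2 p.1.2 :=
      (hF.measurable.comp ((measurable_fst.comp measurable_fst).prodMk measurable_snd)).mul
        (hG.measurable.comp (measurable_snd.prodMk (measurable_snd.comp measurable_fst)))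
    exact (this.stronglyMeasurable.integral_prod_right' (ν := ν)).measurable
  · refine (norm_integral_le_integral_norm _).trans ?_
    rw [mul_assoc, ← integral_mul_const, ← integral_const_mul]
    have hi : Integrable (fun y => φ x * (ψ y * φ' y * ψ' z)) ν :=
      ((h4.integrable_mul h3').mul_const _).const_mul _
    refine integral_mono_of_nonneg (Filter.Eventually.of_forall fun _ => norm_nonneg _) hi ?_
    filter_upwards [hT, hS'] with y hy hy'
    rw [norm_mul]
    refine (mul_le_mul (h5 x hx y hy) (h5' y hy' z hz) (norm_nonneg _)
      (mul_nonneg (h1 x) (h2 y))).trans_eq (by ring)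

omit [SFinite μ] in
theorem HasKernel.comp {G : Y → Z → ℂ} {T : Lp ℂ 2 ν →L[ℂ] Lp ℂ 2 μ} {T' : Lp ℂ 2 ρ →L[ℂ] Lp ℂ 2 ν}
    (hT : HasKernel μ ν F T) (hT' : HasKernel ν ρ G T') (hF : IsProductBounded μ ν F)
    (hG : IsProductBounded ν ρ G) :
    HasKernel μ ρ (fun x z => ∫ y, F x y * G y z ∂ν) (T ∘L T') := by
  intro g
  obtain ⟨φ, _, _, hb⟩ := (hF.comp hG).integral_norm_sq_le
  filter_upwards [hb g (Lp.memLp g), hT (T' g), hF.section_memLp] with x h1 h2 h3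
  refine ⟨h1.1, h2.2.trans ?_⟩
  have hi := hG.integrable_mul h3 (Lp.memLp g)
  have e1 : ∫ y, F x y * T' g y ∂ν = ∫ y, ∫ z, F x y * (G y z * g z) ∂ρ ∂ν := by
    refine integral_congr_ae ?_
    filter_upwards [hT' g] with y hy
    rw [hy.2, integral_const_mul]
  rw [e1, integral_integral_swap hi]
  refine integral_congr_ae (Filter.Eventually.of_forall fun z => ?_)
  simp only [← integral_mul_const, mul_assoc]

/-- The integral over the middle variable, in weak form. -/
theorem integral_inner_mul_inner {A : X → Z → ℂ} {B : Y → X → ℂ}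
    (hB : IsProductBounded ν μ B) (hA : IsProductBounded μ ρ A) (h : Lp ℂ 2 ν) (g : Lp ℂ 2 ρ) :
    ∫ p, ⟪h, toL2 ν fun y => B y p⟫_ℂ * ⟪toL2 ρ fun z => starRingEnd ℂ (A p z), g⟫_ℂ ∂μ =
      ∫ y, starRingEnd ℂ (h y) * ∫ z, (∫ p, B y p * A p z ∂μ) * g z ∂ρ ∂ν := by
  obtain ⟨T, hT⟩ := hB.exists_hasKernel
  obtain ⟨T', hT'⟩ := hA.exists_hasKernel
  rw [← (hT.comp hT' hB hA).inner_eq, ContinuousLinearMap.comp_apply, hT.inner_eq_swap hB]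
  refine integral_congr_ae ?_
  filter_upwards [hT' g, hA.section_memLp] with p hp hm
  have hm' : MemLp (fun z => starRingEnd ℂ (A p z)) 2 ρ := hm.star
  rw [hp.2, inner_toL2_left hm']
  simp

omit [SFinite μ] in
/-- The Fredholm series of a composition of product bounded kernels converges. -/
theorem IsProductBounded.fredholmConverges {K : X → X → ℂ} (hK : IsProductBounded μ μ K)
    [SigmaFinite μ] : FredholmConverges μ K := by
  obtain ⟨S, T, φ, ψ, hS, hT, h1, h2, h3, h4, h5⟩ := hK.exists_bound
  exact IsDominatedBy.fredholmConverges (S := S ∩ T) (φ := φ) (ψ := ψ)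
    ⟨hS.and hT, h1, h2, h3.integrable_mul h4, fun x hx y hy => h5 x hx.1 y hy.2⟩ hK.measurable

end ProductBound

/-! ### Contour integrals of `e^{cubic}` -/

section Contour

/-- A piecewise `C¹` contour which outside a compact set consists of two half-lines in the
directions `e^{± iπ/3}`. -/
structure IsWedgeContour (γ : ℝ → ℂ) : Prop where
  continuous : Continuous γ
  differentiableAt : ∃ S : Finset ℝ, ∀ t ∉ S, DifferentiableAt ℝ γ t
  deriv_le : ∃ D : ℝ, ∀ t, ‖deriv γ t‖ ≤ D
  upper_ray : ∃ T c : ℝ, 0 < c ∧ ∀ u ≥ 0,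
    γ (T + u / c) = γ T + (u : ℂ) * Complex.exp ((Real.pi / 3 : ℝ) * Complex.I)
  lower_ray : ∃ T c : ℝ, 0 < c ∧ ∀ u ≥ 0,
    γ (T - u / c) = γ T + (u : ℂ) * Complex.exp (-((Real.pi / 3 : ℝ) * Complex.I))

theorem exp_pi_div_three_cube : Complex.exp ((Real.pi / 3 : ℝ) * Complex.I) ^ 3 = -1 := by
  rw [← Complex.exp_nat_mul, ← Complex.exp_pi_mul_I]
  congr 1
  push_cast
  ring

theorem exp_neg_pi_div_three_cube :
    Complex.exp (-((Real.pi / 3 : ℝ) * Complex.I)) ^ 3 = -1 := by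
  rw [Complex.exp_neg, inv_pow, exp_pi_div_three_cube]
  norm_num

theorem norm_exp_pi_div_three : ‖Complex.exp ((Real.pi / 3 : ℝ) * Complex.I)‖ = 1 :=
  Complex.norm_exp_ofReal_mul_I _

theorem norm_exp_neg_pi_div_three : ‖Complex.exp (-((Real.pi / 3 : ℝ) * Complex.I))‖ = 1 := by
  rw [Complex.exp_neg, norm_inv, norm_exp_pi_div_three, inv_one]

/-- A cubic with negative leading coefficient is bounded above on `[0, ∞)`. -/
theorem exists_cubic_le (κ : ℝ) (hκ : 0 < κ) (A B : ℝ) :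
    ∃ C, ∀ u : ℝ, 0 ≤ u → A * u ^ 2 + B * u - κ * u ^ 3 ≤ C := by
  refine ⟨|A| * (1 + (|A| + |B|) / κ) ^ 2 + |B| * (1 + (|A| + |B|) / κ), fun u hu => ?_⟩
  set U := 1 + (|A| + |B|) / κ with hU
  have hU1 : 1 ≤ U := by
    have : 0 ≤ (|A| + |B|) / κ := by positivity
    linarith
  have h1 : A * u ^ 2 ≤ |A| * u ^ 2 := mul_le_mul_of_nonneg_right (le_abs_self A) (by positivity)
  have h2 : B * u ≤ |B| * u := mul_le_mul_of_nonneg_right (le_abs_self B) hu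
  rcases le_total u U with h | h
  · have h3 : |A| * u ^ 2 ≤ |A| * U ^ 2 := by gcongr
    have h4 : |B| * u ≤ |B| * U := by gcongr
    have h5 : 0 ≤ κ * u ^ 3 := by positivity
    linarith
  · have h3 : |A| + |B| ≤ κ * u := by
      have : (|A| + |B|) / κ ≤ u := by linarith
      rw [div_le_iff₀ hκ] at this
      linarith
    have h4 : (|A| + |B|) * u ^ 2 ≤ κ * u ^ 3 := by nlinarith [sq_nonneg u]
    have h5 : |B| * u ≤ |B| * u ^ 2 := by
      have : u ≤ u ^ 2 := by nlinarith
      gcongr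
    have h6 : 0 ≤ |A| * U ^ 2 + |B| * U := by positivity
    linarith

/-- Decay of `e^{κ λ³ + ⋯}` along a ray whose direction `ω` satisfies `ω³ = -1`, uniformly in the
initial point. -/
theorem exists_ray_decay (κ : ℝ) (hκ : 0 < κ) (a b k M : ℝ) (ha : 0 ≤ a) (hb : 0 ≤ b) :
    ∃ C, ∀ ω : ℂ, ‖ω‖ = 1 → ω ^ 3 = -1 → ∀ z : ℂ, ‖z‖ ≤ M → ∀ u : ℝ, 0 ≤ u →
      (κ * (z + u * ω) ^ 3).re + a * ‖z + u * ω‖ ^ 2 + b * ‖z + u * ω‖ ≤ C - k * u := by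
  obtain ⟨C, hC⟩ := exists_cubic_le κ hκ (3 * κ * M + a) (3 * κ * M ^ 2 + 2 * a * M + b + k)
  refine ⟨C + κ * M ^ 3 + a * M ^ 2 + b * M, fun ω h1 h3 z hz u hu => ?_⟩
  have hM : 0 ≤ M := (norm_nonneg z).trans hz
  have hn : ‖z + u * ω‖ ≤ M + u := by
    refine (norm_add_le _ _).trans (add_le_add hz ?_)
    rw [norm_mul, h1, mul_one, Complex.norm_real, Real.norm_of_nonneg hu]
  have hre : (κ * (z + u * ω) ^ 3).re ≤
      κ * (M ^ 3 + 3 * u * M ^ 2 + 3 * u ^ 2 * M) - κ * u ^ 3 := by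
    have e : (κ : ℂ) * (z + u * ω) ^ 3 =
        κ * (z ^ 3 + 3 * u * z ^ 2 * ω + 3 * u ^ 2 * z * ω ^ 2) + ((-(κ * u ^ 3) : ℝ) : ℂ) := by
      push_cast
      linear_combination (κ : ℂ) * u ^ 3 * h3
    rw [e, Complex.add_re, Complex.ofReal_re, ← sub_eq_add_neg]
    gcongr
    refine (Complex.re_le_norm _).trans ?_
    rw [norm_mul, Complex.norm_real, Real.norm_of_nonneg hκ.le]
    gcongr
    refine (norm_add_le _ _).trans (add_le_add ((norm_add_le _ _).trans (add_le_add ?_ ?_)) ?_)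
    · rw [norm_pow]; gcongr
    · rw [norm_mul, norm_mul, norm_mul, norm_pow, h1, Complex.norm_real, Real.norm_of_nonneg hu,
        Complex.norm_ofNat, mul_one]
      gcongr
    · rw [norm_mul, norm_mul, norm_mul, norm_pow, norm_pow, h1, Complex.norm_real,
        Real.norm_of_nonneg hu, Complex.norm_ofNat, one_pow, mul_one]
      gcongr
  have h4 : a * ‖z + u * ω‖ ^ 2 ≤ a * (M + u) ^ 2 := by gcongr
  have h5 : b * ‖z + u * ω‖ ≤ b * (M + u) := by gcongr
  have := hC u hu
  nlinarith

variable {γ : ℝ → ℂ}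

/-- Along a contour with ends in the directions `e^{± iπ/3}` the exponential `e^{κ λ³}` beats every
exponential of a quadratic in `|λ|`, with room for a factor `e^{-|t|}`. All integrability statements
on the contours rest on this bound. -/
theorem IsWedgeContour.exists_decay (hγ : IsWedgeContour γ) (κ : ℝ) (hκ : 0 < κ) (a b : ℝ)
    (ha : 0 ≤ a) (hb : 0 ≤ b) :
    ∃ C, ∀ t, (κ * γ t ^ 3).re + a * ‖γ t‖ ^ 2 + b * ‖γ t‖ ≤ C - |t| := by
  obtain ⟨T, c, hc, hup⟩ := hγ.upper_ray
  obtain ⟨T', c', hc', hlo⟩ := hγ.lower_ray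
  obtain ⟨C₁, h₁⟩ := exists_ray_decay κ hκ a b (1 / c) ‖γ T‖ ha hb
  obtain ⟨C₂, h₂⟩ := exists_ray_decay κ hκ a b (1 / c') ‖γ T'‖ ha hb
  have hcont : Continuous fun t => (κ * γ t ^ 3).re + a * ‖γ t‖ ^ 2 + b * ‖γ t‖ + |t| := by
    have := hγ.continuous
    fun_prop
  obtain ⟨C₃, h₃⟩ := (isCompact_Icc (a := T') (b := T)).bddAbove_image hcont.continuousOn
  have h₁' := h₁ _ norm_exp_pi_div_three exp_pi_div_three_cube _ le_rfl
  have h₂' := h₂ _ norm_exp_neg_pi_div_three exp_neg_pi_div_three_cube _ le_rfl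
  refine ⟨max (C₁ + |T|) (max (C₂ + |T'|) C₃), fun t => ?_⟩
  rcases le_total T t with ht | ht
  · have hu : 0 ≤ c * (t - T) := mul_nonneg hc.le (by linarith)
    have e := h₁' _ hu
    rw [← hup _ hu, mul_div_cancel_left₀ _ hc.ne', add_sub_cancel] at e
    have h6 : 1 / c * (c * (t - T)) = t - T := by field_simp
    have h7 : |t| ≤ |T| + (t - T) := by
      have := abs_add_le T (t - T)
      rwa [add_sub_cancel, abs_of_nonneg (sub_nonneg.mpr ht)] at this
    have := le_max_left (C₁ + |T|) (max (C₂ + |T'|) C₃)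
    linarith
  rcases le_total t T' with ht' | ht'
  · have hu : 0 ≤ c' * (T' - t) := mul_nonneg hc'.le (by linarith)
    have e := h₂' _ hu
    rw [← hlo _ hu, mul_div_cancel_left₀ _ hc'.ne', sub_sub_cancel] at e
    have h6 : 1 / c' * (c' * (T' - t)) = T' - t := by field_simp
    have h7 : |t| ≤ |T'| + (T' - t) := by
      have := abs_sub T' (T' - t)
      rwa [sub_sub_cancel, abs_of_nonneg (sub_nonneg.mpr ht')] at this
    have := (le_max_left (C₂ + |T'|) C₃).trans (le_max_right (C₁ + |T|) _)
    linarith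
  · have := h₃ (mem_image_of_mem _ (show t ∈ Icc T' T from ⟨ht', ht⟩))
    have h8 := (le_max_right (C₂ + |T'|) C₃).trans (le_max_right (C₁ + |T|) _)
    linarith

theorem integrable_exp_neg_abs : Integrable fun t : ℝ => Real.exp (-|t|) := by
  have h1 : IntegrableOn (fun t : ℝ => Real.exp (-|t|)) (Ioi 0) :=
    (integrableOn_exp_neg_Ioi 0).congr_fun (fun t ht => by
      simp only [abs_of_pos (mem_Ioi.mp ht)]) measurableSet_Ioi
  have h2 : IntegrableOn (fun t : ℝ => Real.exp (-|t|)) (Iic 0) :=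
    (integrableOn_exp_Iic 0).congr_fun (fun t ht => by
      simp only [abs_of_nonpos (mem_Iic.mp ht), neg_neg]) measurableSet_Iic
  rw [← integrableOn_univ, ← Iic_union_Ioi (a := (0 : ℝ))]
  exact h2.union h1

theorem norm_exp_cubic_le (κ τ x : ℝ) (z : ℂ) :
    ‖Complex.exp (κ * z ^ 3 + τ * z ^ 2 - x * z)‖ ≤
      Real.exp ((κ * z ^ 3).re + |τ| * ‖z‖ ^ 2 + |x| * ‖z‖) := by
  rw [Complex.norm_exp]
  refine Real.exp_le_exp.mpr ?_
  rw [Complex.sub_re, Complex.add_re, sub_eq_add_neg, ← Complex.neg_re]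
  gcongr
  · refine (Complex.re_le_norm _).trans ?_
    rw [norm_mul, norm_pow, Complex.norm_real, Real.norm_eq_abs]
  · refine (Complex.re_le_norm _).trans ?_
    rw [norm_neg, norm_mul, Complex.norm_real, Real.norm_eq_abs]

theorem IsWedgeContour.integrable (hγ : IsWedgeContour γ) {κ : ℝ} (hκ : 0 < κ) (τ x : ℝ) :
    Integrable fun t => Complex.exp (κ * γ t ^ 3 + τ * γ t ^ 2 - x * γ t) * deriv γ t := by
  obtain ⟨C, hC⟩ := hγ.exists_decay κ hκ |τ| |x| (abs_nonneg _) (abs_nonneg _)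
  obtain ⟨D, hD⟩ := hγ.deriv_le
  refine ((integrable_exp_neg_abs.const_mul (Real.exp C)).mul_const D).mono' ?_ ?_
  · have := hγ.continuous
    exact (Continuous.measurable (by fun_prop)).aestronglyMeasurable.mul
      (measurable_deriv γ).aestronglyMeasurable
  · refine Filter.Eventually.of_forall fun t => ?_
    rw [norm_mul, ← Real.exp_add]
    refine mul_le_mul ((norm_exp_cubic_le κ τ x (γ t)).trans (Real.exp_le_exp.mpr ?_)) (hD t)
      (norm_nonneg _) (Real.exp_nonneg _)
    exact (hC t).trans_eq (sub_eq_add_neg _ _)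

/-- The integral along a contour is the limit of the differences of a primitive. -/
theorem tendsto_contour_integral {f F : ℂ → ℂ} (hF : ∀ z, HasDerivAt F (f z) z)
    (hc : Continuous γ) {S : Finset ℝ} (hS : ∀ t ∉ S, DifferentiableAt ℝ γ t)
    (hi : Integrable fun t => f (γ t) * deriv γ t) {a b : ℝ → ℝ}
    (ha : Filter.Tendsto a Filter.atTop Filter.atBot)
    (hb : Filter.Tendsto b Filter.atTop Filter.atTop) :
    Filter.Tendsto (fun u => F (γ (b u)) - F (γ (a u))) Filter.atTop
      (nhds (∫ t, f (γ t) * deriv γ t)) := by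
  have h := intervalIntegral_tendsto_integral hi ha hb
  refine h.congr fun u => ?_
  refine integral_eq_of_hasDerivAt_off_countable (fun t => F (γ t)) _
    (S.countable_toSet) ?_ ?_ hi.intervalIntegrable
  · have : Continuous F := continuous_iff_continuousAt.mpr fun z => (hF z).continuousAt
    exact (this.comp hc).continuousOn
  · intro t ht
    exact (hF (γ t)).comp_of_eq t (hS t fun h => ht.2 (by exact_mod_cast h)).hasDerivAt rfl

/-- Independence of the contour: two contour integrals of `f = F'` agree if the values of `F` at
corresponding ends become equal in the limit. -/
theorem integral_eq_of_tendsto_ends {γ₁ γ₂ : ℝ → ℂ} {f F : ℂ → ℂ} (hF : ∀ z, HasDerivAt F (f z) z)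
    (hc₁ : Continuous γ₁) (hc₂ : Continuous γ₂)
    (hS₁ : ∃ S : Finset ℝ, ∀ t ∉ S, DifferentiableAt ℝ γ₁ t)
    (hS₂ : ∃ S : Finset ℝ, ∀ t ∉ S, DifferentiableAt ℝ γ₂ t)
    (hi₁ : Integrable fun t => f (γ₁ t) * deriv γ₁ t)
    (hi₂ : Integrable fun t => f (γ₂ t) * deriv γ₂ t) {a₁ b₁ a₂ b₂ : ℝ → ℝ}
    (ha₁ : Filter.Tendsto a₁ Filter.atTop Filter.atBot)
    (hb₁ : Filter.Tendsto b₁ Filter.atTop Filter.atTop)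
    (ha₂ : Filter.Tendsto a₂ Filter.atTop Filter.atBot)
    (hb₂ : Filter.Tendsto b₂ Filter.atTop Filter.atTop)
    (hb : Filter.Tendsto (fun u => F (γ₁ (b₁ u)) - F (γ₂ (b₂ u))) Filter.atTop (nhds 0))
    (ha : Filter.Tendsto (fun u => F (γ₁ (a₁ u)) - F (γ₂ (a₂ u))) Filter.atTop (nhds 0)) :
    ∫ t, f (γ₁ t) * deriv γ₁ t = ∫ t, f (γ₂ t) * deriv γ₂ t := by
  obtain ⟨S₁, hS₁⟩ := hS₁
  obtain ⟨S₂, hS₂⟩ := hS₂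
  have h₁ := tendsto_contour_integral hF hc₁ hS₁ hi₁ ha₁ hb₁
  have h₂ := tendsto_contour_integral hF hc₂ hS₂ hi₂ ha₂ hb₂
  have h := (h₁.sub h₂).sub (hb.sub ha)
  rw [sub_zero, sub_zero] at h
  refine sub_eq_zero.mp (tendsto_nhds_unique h (tendsto_const_nhds.congr fun u => ?_))
  ring

theorem norm_primitive_sub_le {f F : ℂ → ℂ} (hF : ∀ z, HasDerivAt F (f z) z) {z w : ℂ} {C : ℝ}
    (hC : ∀ v ∈ segment ℝ w z, ‖f v‖ ≤ C) : ‖F z - F w‖ ≤ C * ‖z - w‖ :=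
  (convex_segment w z).norm_image_sub_le_of_norm_hasDerivWithin_le
    (fun v _ => (hF v).hasDerivWithinAt) hC (left_mem_segment ℝ w z) (right_mem_segment ℝ w z)

/-- Along two parallel rays in a direction `ω` with `ω³ = -1`, a primitive of
`e^{κ z³ + τ z² - x z}` has the same limit: the segments joining the rays have constant length, and
the exponential decays uniformly on them. -/
theorem tendsto_primitive_sub_ray {κ : ℝ} (hκ : 0 < κ) (τ x : ℝ) {F : ℂ → ℂ}
    (hF : ∀ z, HasDerivAt F (Complex.exp (κ * z ^ 3 + τ * z ^ 2 - x * z)) z) {ω : ℂ}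
    (h1 : ‖ω‖ = 1) (h3 : ω ^ 3 = -1) (z₁ z₂ : ℂ) :
    Filter.Tendsto (fun u : ℝ => F (z₁ + u * ω) - F (z₂ + u * ω)) Filter.atTop (nhds 0) := by
  obtain ⟨C, hC⟩ := exists_ray_decay κ hκ |τ| |x| 1 (max ‖z₁‖ ‖z₂‖) (abs_nonneg _) (abs_nonneg _)
  have h0 : Filter.Tendsto (fun u : ℝ => Real.exp (C - 1 * u) * ‖z₁ - z₂‖) Filter.atTop
      (nhds 0) := by
    have : Filter.Tendsto (fun u : ℝ => C - 1 * u) Filter.atTop Filter.atBot := by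
      simp only [one_mul]
      exact Filter.tendsto_atBot_add_const_left _ C Filter.tendsto_neg_atTop_atBot
    simpa using (Real.tendsto_exp_atBot.comp this).mul_const ‖z₁ - z₂‖
  refine squeeze_zero_norm' ?_ h0
  filter_upwards [Filter.eventually_ge_atTop 0] with u hu
  have h2 : z₁ - z₂ = (z₁ + u * ω) - (z₂ + u * ω) := by ring
  rw [h2]
  refine norm_primitive_sub_le hF fun v hv => ?_
  have hv' : v - u * ω ∈ segment ℝ z₂ z₁ := by
    obtain ⟨a, b, ha, hb, hab, rfl⟩ := hv
    refine ⟨a, b, ha, hb, hab, ?_⟩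
    have : (a : ℂ) + b = 1 := by exact_mod_cast hab
    simp only [Complex.real_smul]
    linear_combination -(u : ℂ) * ω * this
  have hn : ‖v - u * ω‖ ≤ max ‖z₁‖ ‖z₂‖ := by
    have := (convex_closedBall (0 : ℂ) (max ‖z₁‖ ‖z₂‖)).segment_subset (x := z₂) (y := z₁)
      (by simp) (by simp) hv'
    simpa using this
  have := hC ω h1 h3 _ hn u hu
  rw [sub_add_cancel] at this
  exact (norm_exp_cubic_le κ τ x v).trans (Real.exp_le_exp.mpr this)

theorem exists_primitive_exp_cubic (κ τ x : ℂ) :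
    ∃ F : ℂ → ℂ, ∀ z, HasDerivAt F (Complex.exp (κ * z ^ 3 + τ * z ^ 2 - x * z)) z := by
  have : Differentiable ℂ fun z : ℂ => Complex.exp (κ * z ^ 3 + τ * z ^ 2 - x * z) := by fun_prop
  obtain ⟨F, hF⟩ := this.isExactOn_univ
  exact ⟨F, fun z => hF z (mem_univ z)⟩

theorem tendsto_ray_parameter (T : ℝ) {c : ℝ} (hc : 0 < c) :
    Filter.Tendsto (fun u : ℝ => T + u / c) Filter.atTop Filter.atTop ∧
      Filter.Tendsto (fun u : ℝ => T - u / c) Filter.atTop Filter.atBot := by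
  have h : Filter.Tendsto (fun u : ℝ => u / c) Filter.atTop Filter.atTop :=
    Filter.tendsto_id.atTop_div_const hc
  refine ⟨Filter.tendsto_atTop_add_const_left _ T h, ?_⟩
  simp only [sub_eq_add_neg]
  exact Filter.tendsto_atBot_add_const_left _ T (Filter.tendsto_neg_atTop_atBot.comp h)

/-- The integral of `e^{κ λ³ + τ λ² - x λ}` does not depend on the contour. -/
theorem IsWedgeContour.integral_eq {γ₁ γ₂ : ℝ → ℂ} (h₁ : IsWedgeContour γ₁)
    (h₂ : IsWedgeContour γ₂) {κ : ℝ} (hκ : 0 < κ) (τ x : ℝ) :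
    ∫ t, Complex.exp (κ * γ₁ t ^ 3 + τ * γ₁ t ^ 2 - x * γ₁ t) * deriv γ₁ t =
      ∫ t, Complex.exp (κ * γ₂ t ^ 3 + τ * γ₂ t ^ 2 - x * γ₂ t) * deriv γ₂ t := by
  obtain ⟨F, hF⟩ := exists_primitive_exp_cubic κ τ x
  obtain ⟨T₁, c₁, hc₁, hu₁⟩ := h₁.upper_ray
  obtain ⟨T₂, c₂, hc₂, hu₂⟩ := h₂.upper_ray
  obtain ⟨T₁', c₁', hc₁', hl₁⟩ := h₁.lower_ray
  obtain ⟨T₂', c₂', hc₂', hl₂⟩ := h₂.lower_ray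
  refine integral_eq_of_tendsto_ends hF h₁.continuous h₂.continuous h₁.differentiableAt
    h₂.differentiableAt (h₁.integrable hκ τ x) (h₂.integrable hκ τ x)
    (tendsto_ray_parameter T₁' hc₁').2 (tendsto_ray_parameter T₁ hc₁).1
    (tendsto_ray_parameter T₂' hc₂').2 (tendsto_ray_parameter T₂ hc₂).1 ?_ ?_
  · refine (tendsto_primitive_sub_ray hκ τ x hF norm_exp_pi_div_three exp_pi_div_three_cube
      (γ₁ T₁) (γ₂ T₂)).congr' ?_
    filter_upwards [Filter.eventually_ge_atTop 0] with u hu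
    rw [hu₁ u hu, hu₂ u hu]
  · refine (tendsto_primitive_sub_ray hκ τ x hF norm_exp_neg_pi_div_three exp_neg_pi_div_three_cube
      (γ₁ T₁') (γ₂ T₂')).congr' ?_
    filter_upwards [Filter.eventually_ge_atTop 0] with u hu
    rw [hl₁ u hu, hl₂ u hu]

theorem IsWedgeContour.const_mul (hγ : IsWedgeContour γ) {r : ℝ} (hr : 0 < r) :
    IsWedgeContour fun t => (r : ℂ) * γ t := by
  obtain ⟨S, hS⟩ := hγ.differentiableAt
  obtain ⟨D, hD⟩ := hγ.deriv_le
  obtain ⟨T, c, hc, hu⟩ := hγ.upper_ray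
  obtain ⟨T', c', hc', hl⟩ := hγ.lower_ray
  refine ⟨continuous_const.mul hγ.continuous, ⟨S, fun t ht => (hS t ht).const_mul _⟩,
    ⟨r * D, fun t => ?_⟩, ⟨T, r * c, by positivity, fun u h => ?_⟩,
    ⟨T', r * c', by positivity, fun u h => ?_⟩⟩
  · rw [deriv_const_mul_field, norm_mul, Complex.norm_real, Real.norm_of_nonneg hr.le]
    exact mul_le_mul_of_nonneg_left (hD t) hr.le
  · have := hu (u / r) (by positivity)
    rw [div_div] at this
    rw [this]
    have hr' : (r : ℂ) ≠ 0 := by exact_mod_cast hr.ne'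
    push_cast
    field_simp
  · have := hl (u / r) (by positivity)
    rw [div_div] at this
    rw [this]
    have hr' : (r : ℂ) ≠ 0 := by exact_mod_cast hr.ne'
    push_cast
    field_simp

theorem IsAiryContour.isWedgeContour (hγ : IsAiryContour γ) : IsWedgeContour γ := by
  obtain ⟨S, hS⟩ := hγ.piecewise_C1
  obtain ⟨T, hT⟩ := hγ.upper_ray
  obtain ⟨T', hT'⟩ := hγ.lower_ray
  refine ⟨hγ.continuous, ⟨S, fun t ht => (hS t ht).1.differentiableAt (by norm_num)⟩,
    ⟨1 + ∑ t ∈ S, ‖deriv γ t‖, fun t => ?_⟩, ⟨T, 1, one_pos, fun u h => ?_⟩,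
    ⟨T', 1, one_pos, fun u h => ?_⟩⟩
  · have h0 : 0 ≤ ∑ t ∈ S, ‖deriv γ t‖ := Finset.sum_nonneg fun _ _ => norm_nonneg _
    by_cases ht : t ∈ S
    · have := Finset.single_le_sum (f := fun t => ‖deriv γ t‖) (fun _ _ => norm_nonneg _) ht
      linarith
    · rw [(hS t ht).2]
      linarith
  · rw [hT _ (by simpa using h)]
    simp
  · rw [hT' _ (by simpa using h)]
    simp

/-- An Airy contour stays away from the imaginary axis. -/
theorem IsAiryContour.exists_le_re (hγ : IsAiryContour γ) : ∃ r, 0 < r ∧ ∀ t, r ≤ (γ t).re := by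
  obtain ⟨T, hT⟩ := hγ.upper_ray
  obtain ⟨T', hT'⟩ := hγ.lower_ray
  have hcos : 0 ≤ Real.cos (Real.pi / 3) := by rw [Real.cos_pi_div_three]; norm_num
  have h1 : ∀ t ≥ T, (γ T).re ≤ (γ t).re := fun t ht => by
    rw [hT t ht, Complex.add_re, Complex.re_ofReal_mul, Complex.exp_ofReal_mul_I_re]
    nlinarith
  have h2 : ∀ t ≤ T', (γ T').re ≤ (γ t).re := fun t ht => by
    rw [hT' t ht, Complex.add_re, Complex.re_ofReal_mul, ← neg_mul, ← Complex.ofReal_neg,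
      Complex.exp_ofReal_mul_I_re, Real.cos_neg]
    nlinarith
  obtain ⟨t₀, ht₀, hmin⟩ := (isCompact_Icc (a := min T' T) (b := max T' T)).exists_isMinOn
    (nonempty_Icc.mpr (min_le_max)) (Complex.continuous_re.comp hγ.continuous).continuousOn
  refine ⟨(γ t₀).re, hγ.re_pos t₀, fun t => ?_⟩
  rcases le_total T t with ht | ht
  · exact (hmin (show T ∈ Icc (min T' T) (max T' T) by simp)).trans (h1 t ht)
  rcases le_total t T' with ht' | ht'
  · exact (hmin (show T' ∈ Icc (min T' T) (max T' T) by simp)).trans (h2 t ht')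
  · exact hmin (show t ∈ Icc (min T' T) (max T' T) from
      ⟨(min_le_left _ _).trans ht', ht.trans (le_max_right _ _)⟩)

end Contour

/-! ### The Airy functions -/

section Airy

theorem continuous_wedgeContour : Continuous wedgeContour := by
  unfold wedgeContour
  refine Continuous.if_le (by fun_prop) (by fun_prop) continuous_const continuous_id ?_
  rintro t rfl
  simp

theorem one_le_re_wedgeContour (t : ℝ) : 1 ≤ (wedgeContour t).re := by
  unfold wedgeContour
  split_ifs with h
  · rw [Complex.add_re, Complex.re_ofReal_mul, Complex.exp_ofReal_mul_I_re, Real.cos_pi_div_three,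
      Complex.one_re]
    linarith
  · rw [Complex.add_re, Complex.re_ofReal_mul, ← neg_mul, ← Complex.ofReal_neg,
      Complex.exp_ofReal_mul_I_re, Real.cos_neg, Real.cos_pi_div_three, Complex.one_re]
    linarith

theorem hasDerivAt_wedgeContour_pos {t : ℝ} (ht : 0 < t) :
    HasDerivAt wedgeContour (Complex.exp ((Real.pi / 3 : ℝ) * Complex.I)) t := by
  have h : HasDerivAt (fun t : ℝ => 1 + (t : ℂ) * Complex.exp ((Real.pi / 3 : ℝ) * Complex.I))
      (1 * Complex.exp ((Real.pi / 3 : ℝ) * Complex.I)) t :=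
    ((Complex.ofRealCLM.hasDerivAt (x := t)).mul_const _).const_add _
  rw [one_mul] at h
  refine h.congr_of_eventuallyEq ?_
  filter_upwards [eventually_gt_nhds ht] with u hu
  rw [wedgeContour, if_pos hu.le]

theorem hasDerivAt_wedgeContour_neg {t : ℝ} (ht : t < 0) :
    HasDerivAt wedgeContour (-Complex.exp (-((Real.pi / 3 : ℝ) * Complex.I))) t := by
  have h : HasDerivAt (fun t : ℝ => 1 + (t : ℂ) *
      -Complex.exp (-((Real.pi / 3 : ℝ) * Complex.I)))
      (1 * -Complex.exp (-((Real.pi / 3 : ℝ) * Complex.I))) t :=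
    ((Complex.ofRealCLM.hasDerivAt (x := t)).mul_const _).const_add _
  rw [one_mul] at h
  refine h.congr_of_eventuallyEq ?_
  filter_upwards [eventually_lt_nhds ht] with u hu
  rw [wedgeContour, if_neg (not_le.mpr hu)]
  push_cast
  ring

theorem isWedgeContour_wedgeContour : IsWedgeContour wedgeContour := by
  refine ⟨continuous_wedgeContour, ⟨{0}, fun t ht => ?_⟩,
    ⟨1 + ‖deriv wedgeContour 0‖, fun t => ?_⟩, ⟨0, 1, one_pos, fun u hu => ?_⟩,
    ⟨0, 1, one_pos, fun u hu => ?_⟩⟩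
  · rcases lt_or_gt_of_ne (Finset.notMem_singleton.mp ht) with h | h
    · exact (hasDerivAt_wedgeContour_neg h).differentiableAt
    · exact (hasDerivAt_wedgeContour_pos h).differentiableAt
  · rcases lt_trichotomy t 0 with h | rfl | h
    · rw [(hasDerivAt_wedgeContour_neg h).deriv, norm_neg, norm_exp_neg_pi_div_three]
      linarith [norm_nonneg (deriv wedgeContour 0)]
    · linarith
    · rw [(hasDerivAt_wedgeContour_pos h).deriv, norm_exp_pi_div_three]
      linarith [norm_nonneg (deriv wedgeContour 0)]
  · have h0 : (0 : ℝ) ≤ 0 + u / 1 := by simpa using hu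
    simp only [wedgeContour, if_pos h0, le_refl, if_true]
    simp
  · rcases hu.eq_or_lt with rfl | h
    · simp
    · have h0 : ¬ (0 : ℝ) ≤ 0 - u / 1 := by simpa using h
      simp only [wedgeContour, if_neg h0, le_refl, if_true]
      simp

theorem two_pi_I_ne_zero : (2 * Real.pi * Complex.I : ℂ) ≠ 0 := by
  simp [Real.pi_ne_zero]

theorem airyTau_eq (τ x : ℝ) :
    airyTau τ x = (2 * Real.pi * Complex.I)⁻¹ * ∫ t : ℝ,
      Complex.exp ((1 / 3 : ℝ) * wedgeContour t ^ 3 + τ * wedgeContour t ^ 2 - x * wedgeContour t)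
        * deriv wedgeContour t := by
  rw [airyTau]
  congr 2
  funext t
  congr 3
  push_cast
  ring

/-- The change of variables `λ ↦ r λ`, together with the independence of the contour. -/
theorem IsWedgeContour.integral_eq_airyTau {γ : ℝ → ℂ} (hγ : IsWedgeContour γ) {r : ℝ}
    (hr : 0 < r) {κ : ℝ} (hκ : 3 * κ * r ^ 3 = 1) (τ x : ℝ) :
    ∫ t, Complex.exp (κ * γ t ^ 3 + τ * γ t ^ 2 - x * γ t) * deriv γ t =
      2 * Real.pi * Complex.I * (r * airyTau (r ^ 2 * τ) (r * x)) := by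
  have h := (hγ.const_mul (inv_pos.mpr hr)).integral_eq isWedgeContour_wedgeContour
    (κ := 1 / 3) (by norm_num) (r ^ 2 * τ) (r * x)
  rw [airyTau_eq, ← h]
  have hr' : (r : ℂ) ≠ 0 := by exact_mod_cast hr.ne'
  have hκ' : (3 : ℂ) * κ * r ^ 3 = 1 := by exact_mod_cast hκ
  have e : ∀ t, Complex.exp ((1 / 3 : ℝ) * (((r⁻¹ : ℝ) : ℂ) * γ t) ^ 3 +
      ((r ^ 2 * τ : ℝ) : ℂ) * (((r⁻¹ : ℝ) : ℂ) * γ t) ^ 2 -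
      ((r * x : ℝ) : ℂ) * (((r⁻¹ : ℝ) : ℂ) * γ t)) *
      deriv (fun t => ((r⁻¹ : ℝ) : ℂ) * γ t) t = (r : ℂ)⁻¹ *
      (Complex.exp (κ * γ t ^ 3 + τ * γ t ^ 2 - x * γ t) * deriv γ t) := fun t => by
    rw [deriv_const_mul_field]
    have : ((1 / 3 : ℝ) : ℂ) * (((r⁻¹ : ℝ) : ℂ) * γ t) ^ 3 +
      ((r ^ 2 * τ : ℝ) : ℂ) * (((r⁻¹ : ℝ) : ℂ) * γ t) ^ 2 -
      ((r * x : ℝ) : ℂ) * (((r⁻¹ : ℝ) : ℂ) * γ t) = κ * γ t ^ 3 + τ * γ t ^ 2 - x * γ t := by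
      have : (κ : ℂ) = 1 / (3 * r ^ 3) := by
        field_simp
        linear_combination hκ'
      rw [this]
      push_cast
      field_simp
    rw [this]
    push_cast
    ring
  simp only [e]
  rw [integral_const_mul]
  have := two_pi_I_ne_zero
  field_simp

theorem IsWedgeContour.integral_eq_airyAi {γ : ℝ → ℂ} (hγ : IsWedgeContour γ) (x : ℝ) :
    ∫ t, Complex.exp (γ t ^ 3 / 3 - x * γ t) * deriv γ t =
      2 * Real.pi * Complex.I * airyAi x := by
  have := hγ.integral_eq_airyTau one_pos (κ := 1 / 3) (by norm_num) 0 x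
  simp only [one_pow, one_mul, mul_zero, Complex.ofReal_one] at this
  rw [airyAi, ← this]
  congr 1
  funext t
  congr 2
  push_cast
  ring

/-- On a half-line the Airy functions decay exponentially. -/
theorem exists_norm_airyTau_le (τ x₀ : ℝ) :
    ∃ C, 0 ≤ C ∧ ∀ x, x₀ ≤ x → ‖airyTau τ x‖ ≤ C * Real.exp (-x) := by
  set f : ℝ → ℂ := fun t => Complex.exp ((1 / 3 : ℝ) * wedgeContour t ^ 3 +
    τ * wedgeContour t ^ 2 - x₀ * wedgeContour t) * deriv wedgeContour t with hf
  have hi : Integrable f := isWedgeContour_wedgeContour.integrable (by norm_num) τ x₀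
  refine ⟨‖(2 * Real.pi * Complex.I : ℂ)⁻¹‖ * ((∫ t, ‖f t‖) * Real.exp x₀),
    by positivity, fun x hx => ?_⟩
  have e0 : (∫ t, ‖f t‖) * Real.exp x₀ * Real.exp (-x) =
      ∫ t, ‖f t‖ * Real.exp (-(x - x₀)) := by
    rw [integral_mul_const, mul_assoc, ← Real.exp_add]
    ring_nf
  rw [airyTau_eq, norm_mul, mul_assoc ‖(2 * Real.pi * Complex.I : ℂ)⁻¹‖, e0]
  gcongr
  refine (norm_integral_le_integral_norm _).trans (integral_mono_of_nonneg
    (Filter.Eventually.of_forall fun _ => norm_nonneg _) (hi.norm.mul_const _)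
    (Filter.Eventually.of_forall fun t => ?_))
  have e : Complex.exp ((1 / 3 : ℝ) * wedgeContour t ^ 3 + τ * wedgeContour t ^ 2 -
      x * wedgeContour t) * deriv wedgeContour t =
      f t * Complex.exp (-((x - x₀ : ℝ) : ℂ) * wedgeContour t) := by
    rw [hf]
    simp only
    rw [mul_right_comm, ← Complex.exp_add]
    congr 2
    push_cast
    ring
  simp only [e, norm_mul]
  gcongr
  rw [Complex.norm_exp, ← Complex.ofReal_neg, Complex.re_ofReal_mul]
  refine Real.exp_le_exp.mpr ?_
  nlinarith [one_le_re_wedgeContour t]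

theorem measurable_airyTau (τ : ℝ) : Measurable (airyTau τ) := by
  have hw := continuous_wedgeContour
  have h : Measurable fun p : ℝ × ℝ => Complex.exp (wedgeContour p.2 ^ 3 / 3 +
      τ * wedgeContour p.2 ^ 2 - p.1 * wedgeContour p.2) * deriv wedgeContour p.2 :=
    (Continuous.measurable (by fun_prop)).mul ((measurable_deriv _).comp measurable_snd)
  exact ((h.stronglyMeasurable.integral_prod_right' (ν := volume)).measurable).const_mul _

/-- The integral representation of the Airy function on a vertical line. -/
theorem airyAi_eq_integral_vertical {ε : ℝ} (hε : 0 < ε) (hε1 : ε ≤ 1) (x : ℝ) :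
    Integrable (fun ξ : ℝ => Complex.exp ((ε + ξ * Complex.I) ^ 3 / 3 - x * (ε + ξ * Complex.I))) ∧
    airyAi x = (2 * Real.pi)⁻¹ *
      ∫ ξ : ℝ, Complex.exp ((ε + ξ * Complex.I) ^ 3 / 3 - x * (ε + ξ * Complex.I)) := by
  set v : ℝ → ℂ := fun ξ => ε + ξ * Complex.I with hv
  have hvd : ∀ t, HasDerivAt v Complex.I t := fun t => by
    have := ((Complex.ofRealCLM.hasDerivAt (x := t)).mul_const Complex.I).const_add (ε : ℂ)
    simpa [hv] using this
  have hvc : Continuous v := by rw [hv]; fun_prop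
  have hint : Integrable (fun ξ : ℝ => Complex.exp (v ξ ^ 3 / 3 - x * v ξ)) := by
    have hg : Integrable fun ξ : ℝ => Real.exp (ε ^ 3 / 3 - x * ε) * Real.exp (-ε * ξ ^ 2) :=
      (integrable_exp_neg_mul_sq hε).const_mul _
    refine hg.mono' (Continuous.aestronglyMeasurable (by fun_prop))
      (Filter.Eventually.of_forall fun ξ => ?_)
    rw [Complex.norm_exp, ← Real.exp_add]
    refine Real.exp_le_exp.mpr (le_of_eq ?_)
    have : v ξ ^ 3 / 3 - x * v ξ = ((ε ^ 3 / 3 - x * ε + -ε * ξ ^ 2 : ℝ) : ℂ) +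
        ((ε ^ 2 * ξ - ξ ^ 3 / 3 - x * ξ : ℝ) : ℂ) * Complex.I := by
      rw [hv]
      push_cast
      linear_combination ((ε : ℂ) * ξ ^ 2 + ξ ^ 3 * Complex.I / 3) * Complex.I_sq
    rw [this, Complex.add_re, Complex.ofReal_re, Complex.re_ofReal_mul, Complex.I_re]
    ring
  refine ⟨hint, ?_⟩
  obtain ⟨F, hF⟩ := exists_primitive_exp_cubic ((1 / 3 : ℝ) : ℂ) ((0 : ℝ) : ℂ) x
  have hpoly : ∀ z : ℂ, ((1 / 3 : ℝ) : ℂ) * z ^ 3 + ((0 : ℝ) : ℂ) * z ^ 2 - x * z =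
      z ^ 3 / 3 - x * z := fun z => by push_cast; ring
  simp only [hpoly] at hF
  -- along the horizontal segment at height `± u √3 / 2` the real part of `z³ / 3` is at most
  -- `- (5/12) ε u²`
  have hend : ∀ s : ℝ, s ^ 2 = 3 / 4 → Filter.Tendsto (fun u : ℝ =>
      F (v (s * u)) - F (((1 + u / 2 : ℝ) : ℂ) + ((s * u : ℝ) : ℂ) * Complex.I))
      Filter.atTop (nhds 0) := fun s hs => by
    obtain ⟨C, hC⟩ : ∃ C, ∀ u : ℝ, 0 ≤ u → (|x| + 1) * u + u - 5 / 12 * ε * u ^ 2 ≤ C := by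
      refine ⟨(|x| + 2) ^ 2 / (4 * (5 / 12 * ε)), fun u hu => ?_⟩
      rw [le_div_iff₀ (by positivity)]
      nlinarith [sq_nonneg (2 * (5 / 12 * ε) * u - (|x| + 2))]
    have h0 : Filter.Tendsto (fun u : ℝ => Real.exp (C - u)) Filter.atTop (nhds 0) := by
      have : Filter.Tendsto (fun u : ℝ => C - u) Filter.atTop Filter.atBot := by
        simp only [sub_eq_add_neg]
        exact Filter.tendsto_atBot_add_const_left _ C Filter.tendsto_neg_atTop_atBot
      exact Real.tendsto_exp_atBot.comp this
    refine squeeze_zero_norm' ?_ h0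
    filter_upwards [Filter.eventually_ge_atTop 2] with u hu
    have hle : ∀ w ∈ segment ℝ (((1 + u / 2 : ℝ) : ℂ) + ((s * u : ℝ) : ℂ) * Complex.I)
        (v (s * u)), ‖Complex.exp (w ^ 3 / 3 - x * w)‖ ≤
          Real.exp (|x| * u - 5 / 12 * ε * u ^ 2) := fun w hw => by
      obtain ⟨y, hy1, hy2, rfl⟩ : ∃ y : ℝ, ε ≤ y ∧ y ≤ u ∧
          w = (y : ℂ) + ((s * u : ℝ) : ℂ) * Complex.I := by
        obtain ⟨a, b, ha, hb, hab, rfl⟩ := hw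
        refine ⟨a * (1 + u / 2) + b * ε, by nlinarith, by nlinarith, ?_⟩
        have : (a : ℂ) + b = 1 := by exact_mod_cast hab
        rw [hv]
        simp only [Complex.real_smul]
        push_cast
        linear_combination ((s : ℂ) * u * Complex.I) * this
      have e : ((y : ℂ) + ((s * u : ℝ) : ℂ) * Complex.I) ^ 3 / 3 -
          x * ((y : ℂ) + ((s * u : ℝ) : ℂ) * Complex.I) =
          ((y ^ 3 / 3 - y * (s * u) ^ 2 - x * y : ℝ) : ℂ) +
          ((y ^ 2 * (s * u) - (s * u) ^ 3 / 3 - x * (s * u) : ℝ) : ℂ) * Complex.I := by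
        push_cast
        linear_combination ((y : ℂ) * (s * u) ^ 2 + (s * u) ^ 3 * Complex.I / 3) * Complex.I_sq
      rw [Complex.norm_exp, e, Complex.add_re, Complex.ofReal_re, Complex.re_ofReal_mul,
        Complex.I_re, mul_zero, add_zero]
      refine Real.exp_le_exp.mpr ?_
      have h1 : -(x * y) ≤ |x| * u := by
        have : -(x * y) ≤ |x| * y := by
          rw [← neg_mul]
          exact mul_le_mul_of_nonneg_right (neg_le_abs x) (hε.le.trans hy1)
        exact this.trans (by gcongr)
      have h2 : y ^ 3 / 3 - y * (s * u) ^ 2 ≤ -(5 / 12 * ε * u ^ 2) := by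
        rw [mul_pow, hs]
        have h3 : y ^ 2 ≤ u ^ 2 := pow_le_pow_left₀ (hε.le.trans hy1) hy2 2
        have h4 : y * y ^ 2 ≤ y * u ^ 2 := mul_le_mul_of_nonneg_left h3 (hε.le.trans hy1)
        have h5 : ε * u ^ 2 ≤ y * u ^ 2 := mul_le_mul_of_nonneg_right hy1 (sq_nonneg u)
        nlinarith
      linarith
    refine (norm_primitive_sub_le hF hle).trans ?_
    have hlen : ‖v (s * u) - (((1 + u / 2 : ℝ) : ℂ) + ((s * u : ℝ) : ℂ) * Complex.I)‖ ≤ u := by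
      have : v (s * u) - (((1 + u / 2 : ℝ) : ℂ) + ((s * u : ℝ) : ℂ) * Complex.I) =
          ((ε - (1 + u / 2) : ℝ) : ℂ) := by
        rw [hv]
        push_cast
        ring
      rw [this, Complex.norm_real, Real.norm_eq_abs, abs_le]
      constructor <;> linarith
    calc _ ≤ Real.exp (|x| * u - 5 / 12 * ε * u ^ 2) * Real.exp u := by
          gcongr
          exact hlen.trans (by linarith [Real.add_one_le_exp u])
      _ ≤ _ := by
          rw [← Real.exp_add]
          exact Real.exp_le_exp.mpr (by linarith [hC u (by linarith)])
  have hω : ∀ u : ℝ, 0 ≤ u → wedgeContour u =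
      ((1 + u / 2 : ℝ) : ℂ) + ((√3 / 2 * u : ℝ) : ℂ) * Complex.I := fun u hu => by
    rw [wedgeContour, if_pos hu, Complex.exp_mul_I, ← Complex.ofReal_cos, ← Complex.ofReal_sin,
      Real.cos_pi_div_three, Real.sin_pi_div_three]
    push_cast
    ring
  have hω' : ∀ u : ℝ, 0 ≤ u → wedgeContour (-u) =
      ((1 + u / 2 : ℝ) : ℂ) + ((-(√3 / 2) * u : ℝ) : ℂ) * Complex.I := fun u hu => by
    rcases hu.eq_or_lt with rfl | h
    · simp [wedgeContour]
    rw [wedgeContour, if_neg (by linarith), ← neg_mul, ← Complex.ofReal_neg, Complex.exp_mul_I,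
      ← Complex.ofReal_cos, ← Complex.ofReal_sin, Real.cos_neg, Real.sin_neg,
      Real.cos_pi_div_three, Real.sin_pi_div_three]
    push_cast
    ring
  have hs3 : (√3 / 2) ^ 2 = 3 / 4 := by
    rw [div_pow, Real.sq_sqrt (by norm_num)]
    norm_num
  have hs0 : (0 : ℝ) < √3 / 2 := by positivity
  have hw := isWedgeContour_wedgeContour
  have hiw : Integrable fun t => Complex.exp (wedgeContour t ^ 3 / 3 - x * wedgeContour t) *
      deriv wedgeContour t := by
    have := hw.integrable (κ := 1 / 3) (by norm_num) 0 x
    simpa only [hpoly] using this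
  have key : ∫ t, Complex.exp (v t ^ 3 / 3 - x * v t) * deriv v t =
      ∫ t, Complex.exp (wedgeContour t ^ 3 / 3 - x * wedgeContour t) * deriv wedgeContour t := by
    refine integral_eq_of_tendsto_ends hF hvc hw.continuous
      ⟨∅, fun t _ => (hvd t).differentiableAt⟩ hw.differentiableAt ?_ hiw
      (a₁ := fun u => -(√3 / 2) * u) (b₁ := fun u => √3 / 2 * u) (a₂ := fun u => -u)
      (b₂ := fun u => u) ?_ ?_ Filter.tendsto_neg_atTop_atBot Filter.tendsto_id ?_ ?_
    · simp only [(hvd _).deriv]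
      exact hint.mul_const _
    · exact Filter.tendsto_id.const_mul_atTop_of_neg (by linarith)
    · exact Filter.tendsto_id.const_mul_atTop hs0
    · refine (hend _ hs3).congr' ?_
      filter_upwards [Filter.eventually_ge_atTop 0] with u hu
      rw [hω u hu]
    · refine (hend _ (by rw [neg_sq]; exact hs3)).congr' ?_
      filter_upwards [Filter.eventually_ge_atTop 0] with u hu
      rw [hω' u hu]
  rw [hw.integral_eq_airyAi] at key
  simp only [(hvd _).deriv] at key
  rw [integral_mul_const] at key
  have hpi : (Real.pi : ℂ) ≠ 0 := by exact_mod_cast Real.pi_ne_zero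
  have hI := Complex.I_ne_zero
  have key' : ∫ ξ, Complex.exp (v ξ ^ 3 / 3 - x * v ξ) = 2 * Real.pi * airyAi x :=
    mul_right_cancel₀ hI (key.trans (by ring))
  change airyAi x = _ * ∫ ξ, Complex.exp (v ξ ^ 3 / 3 - x * v ξ)
  rw [key']
  push_cast
  field_simp

end Airy

/-! ### Plancherel's theorem -/

section Plancherel

open scoped FourierTransform SchwartzMap

theorem Real.fourier_continuous_of_integrable {h : ℝ → ℂ} (h1 : Integrable h) :
    Continuous (𝓕 h) :=
  VectorFourier.fourierIntegral_continuous Real.continuous_fourierChar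
    (by exact (innerₗ ℝ).toContinuousBilinearMap.continuous₂) h1

theorem Real.norm_fourier_le {h : ℝ → ℂ} (w : ℝ) : ‖𝓕 h w‖ ≤ ∫ v, ‖h v‖ :=
  VectorFourier.norm_fourierIntegral_le_integral_norm _ _ _ _ _

/-- The Fourier transform of an integrable function represents its Fourier transform in `L²`. -/
theorem fourier_toLp_ae_eq {h : ℝ → ℂ} (h1 : Integrable h) (h2 : MemLp h 2) :
    (𝓕 (h2.toLp h) : Lp ℂ 2 (volume : Measure ℝ)) =ᵐ[volume] 𝓕 h := by
  refine ae_eq_of_integral_contDiff_smul_eq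
    ((Lp.memLp _).locallyIntegrable (by norm_num))
    (Real.fourier_continuous_of_integrable h1).locallyIntegrable fun g hg hgc => ?_
  have hg₁ : HasCompactSupport (Complex.ofRealCLM ∘ g) := hgc.comp_left rfl
  have hg₂ : ContDiff ℝ (⊤ : ℕ∞) (Complex.ofRealCLM ∘ g) := by fun_prop
  set φ : 𝓢(ℝ, ℂ) := hg₁.toSchwartzMap hg₂ with hφ
  have e1 := congrArg (fun T => T φ) (Lp.fourier_toTemperedDistribution_eq (h2.toLp h))
  simp only [TemperedDistribution.fourier_apply, Lp.toTemperedDistribution_apply] at e1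
  have e2 : ∫ ξ, 𝓕 (φ : ℝ → ℂ) ξ • h ξ = ∫ x, φ x • 𝓕 h x := by
    have := VectorFourier.integral_fourierIntegral_smul_eq_flip (μ := (volume : Measure ℝ))
      (ν := (volume : Measure ℝ)) (L := innerₗ ℝ) (f := φ) (g := h) Real.continuous_fourierChar
      (by exact (innerₗ ℝ).toContinuousBilinearMap.continuous₂) φ.integrable h1
    rw [flip_innerₗ] at this
    exact this
  calc ∫ x, g x • (𝓕 (h2.toLp h) : Lp ℂ 2 (volume : Measure ℝ)) x
      = ∫ x, φ x • (𝓕 (h2.toLp h) : Lp ℂ 2 (volume : Measure ℝ)) x := by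
        simp [hφ]
    _ = ∫ x, (𝓕 φ) x • (h2.toLp h) x := e1.symm
    _ = ∫ ξ, 𝓕 (φ : ℝ → ℂ) ξ • h ξ := by
        refine integral_congr_ae ?_
        filter_upwards [h2.coeFn_toLp] with x hx
        rw [hx, SchwartzMap.fourier_coe]
    _ = _ := e2
    _ = _ := by simp [hφ]

/-- Plancherel's theorem for integrable and square integrable functions. -/
theorem plancherel {h : ℝ → ℂ} (h1 : Integrable h) (h2 : MemLp h 2) :
    MemLp (𝓕 h) 2 ∧ ∫ w, ‖𝓕 h w‖ ^ 2 = ∫ x, ‖h x‖ ^ 2 := by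
  have e := fourier_toLp_ae_eq h1 h2
  refine ⟨(Lp.memLp (𝓕 (h2.toLp h) : Lp ℂ 2 (volume : Measure ℝ))).ae_eq e, ?_⟩
  have hn : ‖(𝓕 (h2.toLp h) : Lp ℂ 2 (volume : Measure ℝ))‖ ^ 2 = ‖h2.toLp h‖ ^ 2 := by
    rw [Lp.norm_fourier_eq]
  rw [norm_sq_eq_integral, norm_sq_eq_integral] at hn
  calc _ = ∫ w, ‖(𝓕 (h2.toLp h) : Lp ℂ 2 (volume : Measure ℝ)) w‖ ^ 2 := by
        refine integral_congr_ae ?_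
        filter_upwards [e] with w hw
        rw [hw]
    _ = _ := hn
    _ = _ := by
        refine integral_congr_ae ?_
        filter_upwards [h2.coeFn_toLp] with w hw
        rw [hw]

end Plancherel

/-! ### Compactness of integral operators -/

section Compact

variable {X Y : Type} [MeasurableSpace X] [MeasurableSpace Y] {μ : Measure X} {ν : Measure Y}

/-- An operator with a product bounded kernel is compact. -/
theorem HasKernel.isCompactOperator [SigmaFinite μ] [SFinite ν]
    [SecondCountableTopology (Lp ℂ 2 ν)] {F : X → Y → ℂ} {T : Lp ℂ 2 ν →L[ℂ] Lp ℂ 2 μ}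
    (hT : HasKernel μ ν F T) (hF : IsProductBounded μ ν F) : IsCompactOperator T := by
  obtain ⟨κ, hκ, ⟨e⟩⟩ := exists_countable_hilbertBasis (Lp ℂ 2 ν)
  let _ : MeasurableSpace κ := ⊤
  refine isCompactOperator_of_summable_sq e ?_
  refine (hF.conj.field.ellTwo_left e).summable_integral.congr fun k => ?_
  rw [norm_sq_eq_integral]
  refine integral_congr_ae ?_
  filter_upwards [hT (e k), hF.section_memLp] with x h1 h2
  have h3 : MemLp (fun y => starRingEnd ℂ (F x y)) 2 ν := h2.star
  rw [h1.2, inner_toL2_left h3]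
  simp

end Compact

/-! ### Square integrability of the Airy functions -/

section AiryBound

theorem memLp_exp_neg_mul_Ici {r : ℝ} (hr : 0 < r) (a : ℝ) :
    MemLp (fun x : ℝ => Real.exp (-(r * x))) 2 (volume.restrict (Ici a)) := by
  have hm : Continuous fun x : ℝ => Real.exp (-(r * x)) := by fun_prop
  rw [memLp_two_iff_integrable_sq hm.aestronglyMeasurable]
  have : (fun x : ℝ => Real.exp (-(r * x)) ^ 2) = fun x => Real.exp (-(2 * r) * x) := by
    funext x
    rw [← Real.exp_nat_mul]
    congr 1
    push_cast
    ring
  rw [this, ← Measure.restrict_congr_set Ioi_ae_eq_Ici]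
  exact integrableOn_exp_mul_Ioi (by linarith) a

theorem memLp_exp_neg_mul_Ioi {r : ℝ} (hr : 0 < r) (a : ℝ) :
    MemLp (fun x : ℝ => Real.exp (-(r * x))) 2 (volume.restrict (Ioi a)) :=
  (memLp_exp_neg_mul_Ici hr a).mono_measure (Measure.restrict_mono_set _ Ioi_subset_Ici_self)

theorem memLp_exp_neg_Ici (a : ℝ) :
    MemLp (fun x : ℝ => Real.exp (-x)) 2 (volume.restrict (Ici a)) := by
  simpa only [one_mul] using memLp_exp_neg_mul_Ici one_pos a

variable {X Y : Type} [MeasurableSpace X] [MeasurableSpace Y] {μ : Measure X} {ν : Measure Y}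

/-- `Ai^{(τ)}` decays faster than `e^{-x}`, and `e^{-(p + q)}` is a product; so the kernel
`Ai^{(τ)}(p + q)` is product bounded as soon as `e^{-p}` and `e^{-q}` are square integrable. -/
theorem isProductBounded_airyTau (τ : ℝ) {p : X → ℝ} {q : Y → ℝ} (hp : Measurable p)
    (hq : Measurable q) {p₀ q₀ : ℝ} (hp₀ : ∀ᵐ x ∂μ, p₀ ≤ p x) (hq₀ : ∀ᵐ y ∂ν, q₀ ≤ q y)
    (hpm : MemLp (fun x => Real.exp (-p x)) 2 μ) (hqm : MemLp (fun y => Real.exp (-q y)) 2 ν) :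
    IsProductBounded μ ν fun x y => airyTau τ (p x + q y) := by
  obtain ⟨C, hC, hb⟩ := exists_norm_airyTau_le τ (p₀ + q₀)
  refine ⟨(measurable_airyTau τ).comp ((hp.comp measurable_fst).add (hq.comp measurable_snd)),
    {x | p₀ ≤ p x}, {y | q₀ ≤ q y}, fun x => C * Real.exp (-p x), fun y => Real.exp (-q y),
    hp₀, hq₀, fun x => by positivity, fun y => (Real.exp_pos _).le, hpm.const_mul C, hqm,
    fun x hx y hy => (hb _ (add_le_add hx hy)).trans_eq ?_⟩
  rw [neg_add, Real.exp_add, mul_assoc]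

theorem isProductBounded_airyAi (a b : ℝ) :
    IsProductBounded (volume.restrict (Ici a)) (volume.restrict (Ioi b))
      fun z u => airyAi (z + u) :=
  isProductBounded_airyTau 0 measurable_id measurable_id
    (ae_restrict_of_forall_mem measurableSet_Ici fun _ h => h)
    (ae_restrict_of_forall_mem measurableSet_Ioi fun _ h => le_of_lt h)
    (memLp_exp_neg_Ici a) (by simpa only [one_mul] using memLp_exp_neg_mul_Ioi one_pos b)

theorem memLp_airyTau_add (τ a u : ℝ) :
    MemLp (fun z => airyTau τ (z + u)) 2 (volume.restrict (Ici a)) := by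
  obtain ⟨C, hC, hb⟩ := exists_norm_airyTau_le τ (a + u)
  refine ((memLp_exp_neg_Ici a).const_mul (C * Real.exp (-u))).of_le
    ((measurable_airyTau τ).comp (measurable_id.add_const u)).aestronglyMeasurable ?_
  refine ae_restrict_of_forall_mem measurableSet_Ici fun z hz => ?_
  refine (hb _ (by simpa using hz)).trans ((le_of_eq ?_).trans (le_abs_self _))
  rw [mul_assoc, ← Real.exp_add]
  ring_nf

end AiryBound

/-! ### Entire functions defined by integrals -/

section Entire

/-- Integrals `∫ E(t) e^{-w γ(t)} dt` with rapidly decreasing `E` are entire functions of `w`. -/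
theorem differentiable_integral_mul_exp {E γ : ℝ → ℂ} (hE : AEStronglyMeasurable E)
    (hγ : Continuous γ) (hb : ∀ k : ℝ, ∃ C, ∀ t, ‖E t‖ * Real.exp (k * ‖γ t‖) ≤
      C * Real.exp (-|t|)) : Differentiable ℂ fun w : ℂ => ∫ t, E t * Complex.exp (-w * γ t) := by
  intro w₀
  have hexp : ∀ (w : ℂ) (t : ℝ), ‖Complex.exp (-w * γ t)‖ ≤ Real.exp (‖w‖ * ‖γ t‖) := fun w t => by
    rw [Complex.norm_exp]
    refine Real.exp_le_exp.mpr ((Complex.re_le_norm _).trans ?_)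
    rw [norm_mul, norm_neg]
  have hm : ∀ w : ℂ, AEStronglyMeasurable fun t => E t * Complex.exp (-w * γ t) := fun w =>
    hE.mul (Continuous.aestronglyMeasurable (by fun_prop))
  obtain ⟨C₀, hC₀⟩ := hb ‖w₀‖
  obtain ⟨C, hC⟩ := hb (‖w₀‖ + 2)
  refine ((hasDerivAt_integral_of_dominated_loc_of_deriv_le
    (F' := fun w t => E t * (Complex.exp (-w * γ t) * -γ t))
    (bound := fun t => C * Real.exp (-|t|)) (Metric.ball_mem_nhds w₀ one_pos)
    (Filter.Eventually.of_forall hm) ?_ ?_ ?_ (integrable_exp_neg_abs.const_mul C) ?_).2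
    ).differentiableAt
  · refine (integrable_exp_neg_abs.const_mul C₀).mono' (hm w₀)
      (Filter.Eventually.of_forall fun t => ?_)
    rw [norm_mul]
    exact (mul_le_mul_of_nonneg_left (hexp w₀ t) (norm_nonneg _)).trans (hC₀ t)
  · exact hE.mul (Continuous.aestronglyMeasurable (by fun_prop))
  · refine Filter.Eventually.of_forall fun t w hw => ?_
    have hw' : ‖w‖ ≤ ‖w₀‖ + 1 := by
      have := norm_le_insert' w w₀
      rw [Metric.mem_ball, dist_eq_norm] at hw
      linarith
    refine le_trans ?_ (hC t)
    rw [norm_mul, norm_mul, norm_neg]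
    gcongr
    calc ‖Complex.exp (-w * γ t)‖ * ‖γ t‖
        ≤ Real.exp ((‖w₀‖ + 1) * ‖γ t‖) * Real.exp ‖γ t‖ := by
          gcongr
          · exact (hexp w t).trans (Real.exp_le_exp.mpr (by gcongr))
          · linarith [Real.add_one_le_exp ‖γ t‖]
      _ = _ := by
          rw [← Real.exp_add]
          congr 1
          ring
  · refine Filter.Eventually.of_forall fun t w _ => HasDerivAt.const_mul _ ?_
    have : HasDerivAt (fun w : ℂ => -w * γ t) (-1 * γ t) w := (hasDerivAt_neg w).mul_const _
    simpa using this.cexp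

end Entire

/-! ### The Airy transform -/

section AiryTransform

open scoped FourierTransform

theorem integrable_exp_mul_of_memLp {s ε : ℝ} (hε : 0 < ε) {f : ℝ → ℂ}
    (hf : MemLp f 2 (volume.restrict (Ici s))) :
    Integrable (fun z => (Real.exp (-ε * z) : ℂ) * f z) (volume.restrict (Ici s)) := by
  have hm : MemLp (fun z : ℝ => (Real.exp (-ε * z) : ℂ)) 2 (volume.restrict (Ici s)) := by
    have hc : Continuous fun z : ℝ => (Real.exp (-ε * z) : ℂ) := by fun_prop
    rw [memLp_two_iff_integrable_sq_norm hc.aestronglyMeasurable]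
    have : (fun z : ℝ => ‖(Real.exp (-ε * z) : ℂ)‖ ^ 2) = fun z => Real.exp (-(2 * ε) * z) := by
      funext z
      rw [Complex.norm_real, Real.norm_of_nonneg (Real.exp_pos _).le, ← Real.exp_nat_mul]
      congr 1
      push_cast
      ring
    rw [this, ← Measure.restrict_congr_set Ioi_ae_eq_Ici]
    exact integrableOn_exp_mul_Ioi (by linarith) s
  exact hm.integrable_mul hf

/-- The vertical line representation with the Fourier kernel. -/
theorem airyAi_eq_integral_fourier {ε : ℝ} (hε : 0 < ε) (hε1 : ε ≤ 1) (x : ℝ) :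
    airyAi x = ∫ w : ℝ, Complex.exp ((ε + (2 * Real.pi * w : ℝ) * Complex.I) ^ 3 / 3) *
      Complex.exp (-x * (ε + (2 * Real.pi * w : ℝ) * Complex.I)) := by
  rw [(airyAi_eq_integral_vertical hε hε1 x).2]
  have h := Measure.integral_comp_mul_left (fun ξ : ℝ =>
    Complex.exp ((ε + ξ * Complex.I) ^ 3 / 3 - x * (ε + ξ * Complex.I))) (2 * Real.pi)
  have hp : (0 : ℝ) < (2 * Real.pi)⁻¹ := by positivity
  rw [abs_of_pos hp, Complex.real_smul] at h
  rw [← h]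
  congr 1
  funext w
  rw [← Complex.exp_add]
  congr 1
  ring

theorem norm_exp_vertical_cube {ε : ℝ} (w : ℝ) :
    ‖Complex.exp ((ε + (2 * Real.pi * w : ℝ) * Complex.I) ^ 3 / 3)‖ =
      Real.exp (ε ^ 3 / 3) * Real.exp (-(4 * Real.pi ^ 2 * ε) * w ^ 2) := by
  rw [Complex.norm_exp, ← Real.exp_add]
  congr 1
  set ξ : ℝ := 2 * Real.pi * w with hξ
  have : ((ε : ℂ) + ξ * Complex.I) ^ 3 / 3 = ((ε ^ 3 / 3 - ε * ξ ^ 2 : ℝ) : ℂ) +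
      ((ε ^ 2 * ξ - ξ ^ 3 / 3 : ℝ) : ℂ) * Complex.I := by
    push_cast
    linear_combination ((ε : ℂ) * ξ ^ 2 + ξ ^ 3 * Complex.I / 3) * Complex.I_sq
  rw [this, Complex.add_re, Complex.ofReal_re, Complex.re_ofReal_mul, Complex.I_re, hξ]
  ring

/-- With an exponential weight, the Airy transform is an inverse Fourier transform: it is a
Fourier multiplier applied to the weighted function. -/
theorem exp_mul_airyTransform_eq {s ε : ℝ} (hε : 0 < ε) (hε1 : ε ≤ 1) {f : ℝ → ℂ}
    (hf : MemLp f 2 (volume.restrict (Ici s))) (u : ℝ) :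
    (Real.exp (ε * u) : ℂ) * ∫ z in Ici s, airyAi (z + u) * f z =
      𝓕 (fun w : ℝ => Complex.exp ((ε + (2 * Real.pi * w : ℝ) * Complex.I) ^ 3 / 3) *
        𝓕 (indicator (Ici s) fun z => (Real.exp (-ε * z) : ℂ) * f z) w) u := by
  have hfi := integrable_exp_mul_of_memLp hε hf
  have hG : Integrable fun w : ℝ =>
      Complex.exp ((ε + (2 * Real.pi * w : ℝ) * Complex.I) ^ 3 / 3) := by
    refine (((integrable_exp_neg_mul_sq (b := 4 * Real.pi ^ 2 * ε) (by positivity)).const_mul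
      (Real.exp (ε ^ 3 / 3))).mono' (Continuous.aestronglyMeasurable (by fun_prop))
      (Filter.Eventually.of_forall fun w => (norm_exp_vertical_cube w).le))
  have hprod : Integrable (fun p : ℝ × ℝ =>
      (Complex.exp ((ε + (2 * Real.pi * p.2 : ℝ) * Complex.I) ^ 3 / 3) *
        Complex.exp (((-2 * Real.pi * p.2 * u : ℝ) : ℂ) * Complex.I)) *
      (Complex.exp (((-2 * Real.pi * p.1 * p.2 : ℝ) : ℂ) * Complex.I) *
        ((Real.exp (-ε * p.1) : ℂ) * f p.1))) ((volume.restrict (Ici s)).prod volume) := by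
    have h1 := hfi.norm.mul_prod hG.norm
    refine h1.mono' ?_ (Filter.Eventually.of_forall fun p => le_of_eq ?_)
    · refine (Continuous.aestronglyMeasurable (by fun_prop)).mul
        ((Continuous.aestronglyMeasurable (by fun_prop)).mul hfi.1.comp_fst)
    · simp only [norm_mul, Complex.norm_exp_ofReal_mul_I, mul_one, one_mul]
      ring
  rw [Real.fourier_real_eq_integral_exp_smul, ← integral_const_mul]
  simp only [Real.fourier_real_eq_integral_exp_smul, smul_eq_mul]
  have e1 : ∀ z : ℝ, (Real.exp (ε * u) : ℂ) * (airyAi (z + u) * f z) = ∫ w : ℝ,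
      (Complex.exp ((ε + (2 * Real.pi * w : ℝ) * Complex.I) ^ 3 / 3) *
        Complex.exp (((-2 * Real.pi * w * u : ℝ) : ℂ) * Complex.I)) *
      (Complex.exp (((-2 * Real.pi * z * w : ℝ) : ℂ) * Complex.I) *
        ((Real.exp (-ε * z) : ℂ) * f z)) := fun z => by
    rw [airyAi_eq_integral_fourier hε hε1, ← integral_mul_const, ← integral_const_mul]
    refine integral_congr_ae (Filter.Eventually.of_forall fun w => ?_)
    simp only [Complex.ofReal_exp]
    have : Complex.exp (-((z + u : ℝ) : ℂ) * (ε + ((2 * Real.pi * w : ℝ) : ℂ) * Complex.I)) =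
        Complex.exp (-((ε * u : ℝ) : ℂ)) *
        Complex.exp (((-2 * Real.pi * w * u : ℝ) : ℂ) * Complex.I) *
        (Complex.exp (((-2 * Real.pi * z * w : ℝ) : ℂ) * Complex.I) *
          Complex.exp ((-ε * z : ℝ) : ℂ)) := by
      rw [← Complex.exp_add, ← Complex.exp_add, ← Complex.exp_add]
      congr 1
      push_cast
      ring
    rw [this, Complex.exp_neg]
    have := Complex.exp_ne_zero ((ε * u : ℝ) : ℂ)
    field_simp
  simp only [e1]
  rw [integral_integral_swap hprod]
  refine integral_congr_ae (Filter.Eventually.of_forall fun w => ?_)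
  simp only
  rw [integral_const_mul]
  have e2 : ∫ v : ℝ, Complex.exp (((-2 * Real.pi * v * w : ℝ) : ℂ) * Complex.I) *
      indicator (Ici s) (fun z => (Real.exp (-ε * z) : ℂ) * f z) v =
      ∫ z in Ici s, Complex.exp (((-2 * Real.pi * z * w : ℝ) : ℂ) * Complex.I) *
        ((Real.exp (-ε * z) : ℂ) * f z) := by
    rw [← integral_indicator measurableSet_Ici]
    congr 1
    funext v
    by_cases hv : v ∈ Ici s
    · simp only [indicator_of_mem hv]
    · simp only [indicator_of_notMem hv, mul_zero]
  rw [e2]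
  ring

/-- After multiplication by `e^{ε u}`, the Airy transform of `f` is the Fourier transform of the
product of `e^{(ε + 2πi w)³/3}` and the Fourier transform of `e^{-ε z} f(z)`. The first factor has
modulus `e^{ε³/3 - 4π² ε w²} ≤ e^{ε³/3}`, and Plancherel's theorem, applied twice, gives a bound
whose constant tends to `1` as `ε → 0`. -/
theorem integral_airyTransform_sq_le_of_pos {s ε L : ℝ} (hε : 0 < ε) (hε1 : ε ≤ 1) {f : ℝ → ℂ}
    (hf : MemLp f 2 (volume.restrict (Ici s))) :
    ∫ u in Ioi (-L), ‖∫ z in Ici s, airyAi (z + u) * f z‖ ^ 2 ≤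
      Real.exp (2 * ε * L + 2 * ε ^ 3 / 3 - 2 * ε * s) * ∫ z in Ici s, ‖f z‖ ^ 2 := by
  set h : ℝ → ℂ := indicator (Ici s) fun z => (Real.exp (-ε * z) : ℂ) * f z with hh
  have hfi := integrable_exp_mul_of_memLp hε hf
  have h1 : Integrable h := (integrable_indicator_iff measurableSet_Ici).mpr hfi
  have hnorm : ∀ z ∈ Ici s, ‖(Real.exp (-ε * z) : ℂ) * f z‖ ≤ Real.exp (-ε * s) * ‖f z‖ :=
    fun z hz => by
      rw [norm_mul, Complex.norm_real, Real.norm_of_nonneg (Real.exp_pos _).le]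
      refine mul_le_mul_of_nonneg_right (Real.exp_le_exp.mpr ?_) (norm_nonneg _)
      have : s ≤ z := hz
      nlinarith
  have h2' : MemLp (fun z => (Real.exp (-ε * z) : ℂ) * f z) 2 (volume.restrict (Ici s)) := by
    refine (hf.norm.const_mul (Real.exp (-ε * s))).of_le hfi.1 ?_
    refine ae_restrict_of_forall_mem measurableSet_Ici fun z hz => ?_
    exact (hnorm z hz).trans (le_abs_self _)
  have h2 : MemLp h 2 := (memLp_indicator_iff_restrict measurableSet_Ici).mpr h2'
  have hh2 : ∫ x, ‖h x‖ ^ 2 ≤ Real.exp (-ε * s) ^ 2 * ∫ z in Ici s, ‖f z‖ ^ 2 := by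
    have : (fun x => ‖h x‖ ^ 2) = indicator (Ici s)
        fun z => ‖(Real.exp (-ε * z) : ℂ) * f z‖ ^ 2 := by
      funext x
      by_cases hx : x ∈ Ici s
      · simp only [hh, indicator_of_mem hx]
      · simp only [hh, indicator_of_notMem hx, norm_zero]
        norm_num
    rw [this, integral_indicator measurableSet_Ici, ← integral_const_mul]
    refine setIntegral_mono_on h2'.norm.integrable_sq (hf.norm.integrable_sq.const_mul _)
      measurableSet_Ici fun z hz => ?_
    rw [← mul_pow]
    exact pow_le_pow_left₀ (norm_nonneg _) (hnorm z hz) 2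
  obtain ⟨p1, p2⟩ := plancherel h1 h2
  set G : ℝ → ℂ := fun w => Complex.exp ((ε + (2 * Real.pi * w : ℝ) * Complex.I) ^ 3 / 3) with hG
  have hGc : Continuous G := by rw [hG]; fun_prop
  have hGle : ∀ w, ‖G w‖ ≤ Real.exp (ε ^ 3 / 3) := fun w => by
    rw [hG, norm_exp_vertical_cube]
    have : Real.exp (-(4 * Real.pi ^ 2 * ε) * w ^ 2) ≤ 1 := Real.exp_le_one_iff.mpr (by
      have : 0 ≤ 4 * Real.pi ^ 2 * ε * w ^ 2 := by positivity
      linarith)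
    exact mul_le_of_le_one_right (Real.exp_pos _).le this
  have g2 : MemLp (fun w => G w * 𝓕 h w) 2 := by
    refine (p1.norm.const_mul (Real.exp (ε ^ 3 / 3))).of_le
      (hGc.aestronglyMeasurable.mul p1.1) (Filter.Eventually.of_forall fun w => ?_)
    rw [norm_mul]
    exact (mul_le_mul_of_nonneg_right (hGle w) (norm_nonneg _)).trans (le_abs_self _)
  have g1 : Integrable fun w => G w * 𝓕 h w := by
    have hGi : Integrable G := by
      refine (((integrable_exp_neg_mul_sq (b := 4 * Real.pi ^ 2 * ε) (by positivity)).const_mul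
        (Real.exp (ε ^ 3 / 3))).mono' hGc.aestronglyMeasurable
        (Filter.Eventually.of_forall fun w => (norm_exp_vertical_cube w).le))
    refine (hGi.norm.mul_const (∫ v, ‖h v‖)).mono'
      (hGc.aestronglyMeasurable.mul p1.1) (Filter.Eventually.of_forall fun w => ?_)
    rw [norm_mul]
    exact mul_le_mul_of_nonneg_left (Real.norm_fourier_le w) (norm_nonneg _)
  obtain ⟨q1, q2⟩ := plancherel g1 g2
  have hF : ∀ u, (Real.exp (ε * u) : ℂ) * ∫ z in Ici s, airyAi (z + u) * f z =
      𝓕 (fun w => G w * 𝓕 h w) u := fun u => exp_mul_airyTransform_eq hε hε1 hf u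
  calc ∫ u in Ioi (-L), ‖∫ z in Ici s, airyAi (z + u) * f z‖ ^ 2
      ≤ ∫ u in Ioi (-L), Real.exp (2 * ε * L) * ‖𝓕 (fun w => G w * 𝓕 h w) u‖ ^ 2 := by
        refine integral_mono_of_nonneg (Filter.Eventually.of_forall fun _ => by positivity)
          ((q1.norm.integrable_sq.const_mul _).integrableOn) ?_
        refine ae_restrict_of_forall_mem measurableSet_Ioi fun u hu => ?_
        simp only
        rw [← hF u, norm_mul, Complex.norm_real, Real.norm_of_nonneg (Real.exp_pos _).le, mul_pow,
          ← mul_assoc, ← Real.exp_nat_mul, ← Real.exp_add]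
        refine le_mul_of_one_le_left (by positivity) (Real.one_le_exp ?_)
        have : -L < u := hu
        push_cast
        nlinarith
    _ ≤ ∫ u, Real.exp (2 * ε * L) * ‖𝓕 (fun w => G w * 𝓕 h w) u‖ ^ 2 :=
        setIntegral_le_integral (q1.norm.integrable_sq.const_mul _)
          (Filter.Eventually.of_forall fun _ => by positivity)
    _ = Real.exp (2 * ε * L) * ∫ w, ‖G w * 𝓕 h w‖ ^ 2 := by
        rw [integral_const_mul, q2]
    _ ≤ Real.exp (2 * ε * L) * ∫ w, Real.exp (ε ^ 3 / 3) ^ 2 * ‖𝓕 h w‖ ^ 2 := by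
        refine mul_le_mul_of_nonneg_left ?_ (Real.exp_pos _).le
        refine integral_mono g2.norm.integrable_sq (p1.norm.integrable_sq.const_mul _) fun w => ?_
        simp only
        rw [norm_mul, mul_pow]
        gcongr
        exact hGle w
    _ = Real.exp (2 * ε * L) * (Real.exp (ε ^ 3 / 3) ^ 2 * ∫ x, ‖h x‖ ^ 2) := by
        rw [integral_const_mul, p2]
    _ ≤ Real.exp (2 * ε * L) * (Real.exp (ε ^ 3 / 3) ^ 2 *
          (Real.exp (-ε * s) ^ 2 * ∫ z in Ici s, ‖f z‖ ^ 2)) := by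
        gcongr
    _ = _ := by
        rw [← mul_assoc, ← mul_assoc, ← Real.exp_nat_mul, ← Real.exp_nat_mul, ← Real.exp_add,
          ← Real.exp_add]
        congr 2
        push_cast
        ring

/-- The Airy transform is a contraction in `L²`. -/
theorem integral_airyTransform_sq_le {s : ℝ} (L : ℝ) {f : ℝ → ℂ}
    (hf : MemLp f 2 (volume.restrict (Ici s))) :
    ∫ u in Ioi (-L), ‖∫ z in Ici s, airyAi (z + u) * f z‖ ^ 2 ≤ ∫ z in Ici s, ‖f z‖ ^ 2 := by
  have ht : Filter.Tendsto (fun ε : ℝ => Real.exp (2 * ε * L + 2 * ε ^ 3 / 3 - 2 * ε * s) *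
      ∫ z in Ici s, ‖f z‖ ^ 2) (nhdsWithin 0 (Ioi 0)) (nhds (∫ z in Ici s, ‖f z‖ ^ 2)) := by
    have hc : Continuous fun ε : ℝ => Real.exp (2 * ε * L + 2 * ε ^ 3 / 3 - 2 * ε * s) *
      ∫ z in Ici s, ‖f z‖ ^ 2 := by fun_prop
    have := hc.tendsto 0
    simp only [mul_zero, zero_mul, ne_eq, OfNat.ofNat_ne_zero, not_false_eq_true, zero_pow,
      zero_div, add_zero, sub_zero, Real.exp_zero, one_mul] at this
    exact this.mono_left nhdsWithin_le_nhds
  refine ge_of_tendsto ht ?_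
  filter_upwards [Ioo_mem_nhdsGT (show (0 : ℝ) < 1 by norm_num)] with ε hε
  exact integral_airyTransform_sq_le_of_pos hε.1 hε.2.le hf

/-- The Airy transform of a square integrable function on a half-line extends to an entire
function. -/
theorem exists_entire_airyTransform {s : ℝ} {f : ℝ → ℂ} (hf : MemLp f 2 (volume.restrict (Ici s))) :
    ∃ F : ℂ → ℂ, Differentiable ℂ F ∧ ∀ u : ℝ, F u = ∫ z in Ici s, airyAi (z + u) * f z := by
  have hfi := (integrable_exp_mul_of_memLp one_pos hf)
  set M : ℝ := ∫ z in Ici s, ‖(Real.exp (-1 * z) : ℂ) * f z‖ with hM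
  have hM0 : 0 ≤ M := integral_nonneg fun _ => norm_nonneg _
  have hwc := continuous_wedgeContour
  obtain ⟨D, hD⟩ := isWedgeContour_wedgeContour.deriv_le
  have hD0 : 0 ≤ D := (norm_nonneg _).trans (hD 0)
  -- `Re λ ≥ 1` on the contour, so `e^{-z λ} f(z)` is controlled by the integrable `e^{-z} f(z)`
  have hlap : ∀ t : ℝ, ∀ z ∈ Ici s, ‖Complex.exp (-z * wedgeContour t) * f z‖ ≤
      Real.exp (2 * |s| * ‖wedgeContour t‖) * ‖(Real.exp (-1 * z) : ℂ) * f z‖ := fun t z hz => by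
    rw [norm_mul, norm_mul, ← mul_assoc, Complex.norm_real,
      Real.norm_of_nonneg (Real.exp_pos _).le, Complex.norm_exp, ← Real.exp_add]
    gcongr
    rw [← Complex.ofReal_neg, Complex.re_ofReal_mul]
    have h1 := one_le_re_wedgeContour t
    have h2 := Complex.re_le_norm (wedgeContour t)
    have h3 : s ≤ z := hz
    have h4 : -s ≤ |s| := neg_le_abs s
    have h5 : s ≤ |s| := le_abs_self s
    have h6 : 0 ≤ (z - s) * ((wedgeContour t).re - 1) := mul_nonneg (by linarith) (by linarith)
    have h7 : |s| * 1 ≤ |s| * ‖wedgeContour t‖ := by gcongr; linarith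
    have h8 : -s * (wedgeContour t).re ≤ |s| * ‖wedgeContour t‖ :=
      mul_le_mul h4 h2 (by linarith) (abs_nonneg s)
    nlinarith
  -- the Laplace transform of `f` along the contour: `F(w) = ∫ e^{λ³/3 - w λ} lap(λ) dλ / (2πi)`
  set lap : ℝ → ℂ := fun t => ∫ z in Ici s, Complex.exp (-z * wedgeContour t) * f z with hlapdef
  set E : ℝ → ℂ := fun t => (Complex.exp (wedgeContour t ^ 3 / 3) * deriv wedgeContour t) * lap t
    with hE
  have hlapm : AEStronglyMeasurable lap := by
    have hc : Continuous fun p : ℝ × ℝ => Complex.exp (-p.2 * wedgeContour p.1) := by fun_prop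
    have : AEStronglyMeasurable (fun p : ℝ × ℝ => Complex.exp (-p.2 * wedgeContour p.1) * f p.2)
      ((volume : Measure ℝ).prod (volume.restrict (Ici s))) :=
      hc.aestronglyMeasurable.mul hf.1.comp_snd
    exact this.integral_prod_right'
  have hEm : AEStronglyMeasurable E := by
    refine AEStronglyMeasurable.mul (AEStronglyMeasurable.mul ?_ ?_) hlapm
    · exact Continuous.aestronglyMeasurable (by fun_prop)
    · exact (measurable_deriv _).aestronglyMeasurable
  have hlaple : ∀ t, ‖lap t‖ ≤ Real.exp (2 * |s| * ‖wedgeContour t‖) * M := fun t => by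
    refine (norm_integral_le_integral_norm _).trans ?_
    rw [hM, ← integral_const_mul]
    refine integral_mono_of_nonneg (Filter.Eventually.of_forall fun _ => norm_nonneg _)
      (hfi.norm.const_mul _) ?_
    exact ae_restrict_of_forall_mem measurableSet_Ici (hlap t)
  have hdec : ∀ k : ℝ, ∃ C, ∀ t, ‖Complex.exp (wedgeContour t ^ 3 / 3)‖ *
      Real.exp (k * ‖wedgeContour t‖) ≤ C * Real.exp (-|t|) := fun k => by
    obtain ⟨C, hC⟩ := isWedgeContour_wedgeContour.exists_decay (1 / 3) (by norm_num) 0 |k| le_rfl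
      (abs_nonneg _)
    refine ⟨Real.exp C, fun t => ?_⟩
    rw [Complex.norm_exp, ← Real.exp_add, ← Real.exp_add]
    refine Real.exp_le_exp.mpr ?_
    have h1 := hC t
    have h2 : k * ‖wedgeContour t‖ ≤ |k| * ‖wedgeContour t‖ := by
      gcongr
      exact le_abs_self k
    have h3 : ((1 / 3 : ℝ) : ℂ) * wedgeContour t ^ 3 = wedgeContour t ^ 3 / 3 := by
      push_cast
      ring
    rw [h3] at h1
    linarith
  have hEb : ∀ k : ℝ, ∃ C, ∀ t, ‖E t‖ * Real.exp (k * ‖wedgeContour t‖) ≤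
      C * Real.exp (-|t|) := fun k => by
    obtain ⟨C, hC⟩ := hdec (2 * |s| + k)
    refine ⟨D * M * C, fun t => ?_⟩
    rw [hE, norm_mul, norm_mul]
    calc _ ≤ ‖Complex.exp (wedgeContour t ^ 3 / 3)‖ * D *
          (Real.exp (2 * |s| * ‖wedgeContour t‖) * M) * Real.exp (k * ‖wedgeContour t‖) := by
          gcongr
          · exact hD t
          · exact hlaple t
      _ = D * M * (‖Complex.exp (wedgeContour t ^ 3 / 3)‖ *
          Real.exp ((2 * |s| + k) * ‖wedgeContour t‖)) := by
          rw [add_mul, Real.exp_add]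
          ring
      _ ≤ D * M * (C * Real.exp (-|t|)) := by
          exact mul_le_mul_of_nonneg_left (hC t) (mul_nonneg hD0 hM0)
      _ = _ := by ring
  refine ⟨fun w => (2 * Real.pi * Complex.I)⁻¹ * ∫ t, E t * Complex.exp (-w * wedgeContour t),
    (differentiable_integral_mul_exp hEm hwc hEb).const_mul _, fun u => ?_⟩
  have hprod : Integrable (fun p : ℝ × ℝ =>
      (Complex.exp (wedgeContour p.2 ^ 3 / 3 - u * wedgeContour p.2) * deriv wedgeContour p.2) *
        (Complex.exp (-p.1 * wedgeContour p.2) * f p.1))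
      ((volume.restrict (Ici s)).prod volume) := by
    obtain ⟨C, hC⟩ := hdec (2 * |s| + |u|)
    refine (hfi.norm.mul_prod (integrable_exp_neg_abs.const_mul (C * D))).mono' ?_ ?_
    · refine AEStronglyMeasurable.mul (AEStronglyMeasurable.mul ?_ ?_)
        (AEStronglyMeasurable.mul ?_ hf.1.comp_fst)
      · exact Continuous.aestronglyMeasurable (by fun_prop)
      · exact ((measurable_deriv wedgeContour).comp measurable_snd).aestronglyMeasurable
      · exact Continuous.aestronglyMeasurable (by fun_prop)
    · filter_upwards [Measure.quasiMeasurePreserving_fst.tendsto_ae.eventually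
        (ae_restrict_mem (μ := volume) (measurableSet_Ici (a := s)))] with p hp
      have h1 : ‖Complex.exp (wedgeContour p.2 ^ 3 / 3 - u * wedgeContour p.2)‖ ≤
          ‖Complex.exp (wedgeContour p.2 ^ 3 / 3)‖ * Real.exp (|u| * ‖wedgeContour p.2‖) := by
        rw [sub_eq_add_neg, Complex.exp_add, norm_mul]
        gcongr
        rw [Complex.norm_exp]
        refine Real.exp_le_exp.mpr ((Complex.re_le_norm _).trans ?_)
        rw [norm_neg, norm_mul, Complex.norm_real, Real.norm_eq_abs]
      rw [norm_mul, norm_mul]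
      calc _ ≤ (‖Complex.exp (wedgeContour p.2 ^ 3 / 3)‖ * Real.exp (|u| * ‖wedgeContour p.2‖)) *
            D * (Real.exp (2 * |s| * ‖wedgeContour p.2‖) *
              ‖(Real.exp (-1 * p.1) : ℂ) * f p.1‖) := by
            gcongr
            · exact hD _
            · exact hlap _ _ hp
        _ = (‖Complex.exp (wedgeContour p.2 ^ 3 / 3)‖ *
              Real.exp ((2 * |s| + |u|) * ‖wedgeContour p.2‖)) *
              (D * ‖(Real.exp (-1 * p.1) : ℂ) * f p.1‖) := by
            rw [add_mul, Real.exp_add]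
            ring
        _ ≤ (C * Real.exp (-|p.2|)) * (D * ‖(Real.exp (-1 * p.1) : ℂ) * f p.1‖) := by
            exact mul_le_mul_of_nonneg_right (hC _) (mul_nonneg hD0 (norm_nonneg _))
        _ = _ := by ring
  -- for real `w` this is the Airy transform, by Fubini's theorem
  have e1 : ∀ z : ℝ, airyAi (z + u) * f z = (2 * Real.pi * Complex.I)⁻¹ * ∫ t : ℝ,
      (Complex.exp (wedgeContour t ^ 3 / 3 - u * wedgeContour t) * deriv wedgeContour t) *
        (Complex.exp (-z * wedgeContour t) * f z) := fun z => by
    have h := isWedgeContour_wedgeContour.integral_eq_airyAi (z + u)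
    have h' : airyAi (z + u) = (2 * Real.pi * Complex.I)⁻¹ * ∫ t : ℝ,
        Complex.exp (wedgeContour t ^ 3 / 3 - ((z + u : ℝ) : ℂ) * wedgeContour t) *
          deriv wedgeContour t := by
      rw [h, inv_mul_cancel_left₀ two_pi_I_ne_zero]
    rw [h', mul_assoc, ← integral_mul_const]
    congr 2
    funext t
    have : Complex.exp (wedgeContour t ^ 3 / 3 - ((z + u : ℝ) : ℂ) * wedgeContour t) =
        Complex.exp (wedgeContour t ^ 3 / 3 - u * wedgeContour t) *
          Complex.exp (-z * wedgeContour t) := by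
      rw [← Complex.exp_add]
      congr 1
      push_cast
      ring
    rw [this]
    ring
  simp only [e1]
  rw [integral_const_mul, integral_integral_swap hprod]
  congr 1
  refine integral_congr_ae (Filter.Eventually.of_forall fun t => ?_)
  simp only [hE, hlapdef]
  rw [integral_const_mul, sub_eq_add_neg, Complex.exp_add, neg_mul]
  ring

end AiryTransform

/-! ### Invertibility of `Id - K_Ai` -/

section Invertibility

variable {s : ℝ}
  {Bo : Lp ℂ 2 (volume.restrict (Ioi (0 : ℝ))) →L[ℂ] Lp ℂ 2 (volume.restrict (Ici s))}
  {Bt : Lp ℂ 2 (volume.restrict (Ici s)) →L[ℂ] Lp ℂ 2 (volume.restrict (Ioi (0 : ℝ)))}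

/-- `1` is not an eigenvalue of the Airy kernel: an eigenfunction would have an Airy transform
which vanishes on the negative half-line, hence everywhere. -/
theorem eq_zero_of_airyKernel_fixed
    (hBo : HasKernel (volume.restrict (Ici s)) (volume.restrict (Ioi 0))
      (fun z u => airyAi (z + u)) Bo)
    (hBt : HasKernel (volume.restrict (Ioi 0)) (volume.restrict (Ici s))
      (fun u z => airyAi (z + u)) Bt)
    (f : Lp ℂ 2 (volume.restrict (Ici s))) (hf : Bo (Bt f) = f) : f = 0 := by
  have hb := isProductBounded_airyAi s 0
  obtain ⟨F, hF, hFe⟩ := exists_entire_airyTransform (Lp.memLp f)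
  have hBtF : ∀ᵐ u ∂(volume.restrict (Ioi (0 : ℝ))), Bt f u = F u := by
    filter_upwards [hBt f] with u hu
    rw [hu.2, hFe]
  -- the Airy transform is square integrable on half-lines
  have hF2 : ∀ L : ℝ, MemLp (fun u : ℝ => F u) 2 (volume.restrict (Ioi (-L))) := fun L => by
    have := (isProductBounded_airyAi s (-L)).swap.memLp_integral (Lp.memLp f)
    simpa only [hFe] using this
  have hconj : MemLp (fun z => starRingEnd ℂ (f z)) 2 (volume.restrict (Ici s)) :=
    (Lp.memLp f).star
  have hG2 : MemLp (fun u : ℝ => ∫ z in Ici s, airyAi (z + u) * starRingEnd ℂ (f z)) 2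
      (volume.restrict (Ioi (0 : ℝ))) := hb.swap.memLp_integral hconj
  have hGle := integral_airyTransform_sq_le 0 hconj
  simp only [neg_zero, RCLike.norm_conj] at hGle
  have hFle := fun L => integral_airyTransform_sq_le L (Lp.memLp f)
  simp only [← hFe] at hFle
  -- `f = Bo (Bt f)` and both factors are contractions, so `Bt f` has norm at least `‖f‖`
  have hn : ‖f‖ ^ 2 ≤ ‖f‖ * √(∫ u in Ioi (0 : ℝ), ‖F u‖ ^ 2) := by
    have e : ⟪f, f⟫_ℂ = ∫ u in Ioi (0 : ℝ),
        (∫ z in Ici s, airyAi (z + u) * starRingEnd ℂ (f z)) * F u := by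
      conv_lhs => rw [← hf]
      nth_rewrite 1 [hf]
      rw [hBo.inner_eq_swap hb]
      refine integral_congr_ae ?_
      filter_upwards [hBtF] with u hu
      have hm : MemLp (fun z => airyAi (z + u)) 2 (volume.restrict (Ici s)) :=
        memLp_airyTau_add 0 s u
      rw [hu, inner_toL2_right hm]
      simp only [mul_comm]
    calc ‖f‖ ^ 2 = ‖⟪f, f⟫_ℂ‖ := by
          rw [inner_self_eq_norm_sq_to_K, norm_pow]
          simp
      _ ≤ √(∫ u in Ioi (0 : ℝ), ‖∫ z in Ici s, airyAi (z + u) * starRingEnd ℂ (f z)‖ ^ 2) *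
          √(∫ u in Ioi (0 : ℝ), ‖F u‖ ^ 2) := by
          rw [e]
          have := hF2 0
          rw [neg_zero] at this
          exact norm_integral_mul_le_sqrt hG2 this
      _ ≤ _ := by
          gcongr
          refine Real.sqrt_le_iff.mpr ⟨norm_nonneg _, ?_⟩
          rw [norm_sq_eq_integral]
          exact hGle
  by_contra hne
  have hpos : 0 < ‖f‖ := norm_pos_iff.mpr hne
  have h1 : ‖f‖ ^ 2 ≤ ∫ u in Ioi (0 : ℝ), ‖F u‖ ^ 2 := by
    have : ‖f‖ ≤ √(∫ u in Ioi (0 : ℝ), ‖F u‖ ^ 2) := by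
      refine le_of_mul_le_mul_left ?_ hpos
      rwa [← sq]
    exact (Real.le_sqrt' hpos).mp this
  -- but on `(-1, ∞)` the Airy transform has norm at most `‖f‖` too: nothing is left for `(-1, 0]`
  have h2 : ∫ u in Ioc (-1 : ℝ) 0, ‖F u‖ ^ 2 ≤ 0 := by
    have h3 := hFle 1
    rw [← norm_sq_eq_integral] at h3
    have hi := (hF2 1).norm.integrable_sq
    rw [← Ioc_union_Ioi_eq_Ioi (show (-1 : ℝ) ≤ 0 by norm_num),
      setIntegral_union (Ioc_disjoint_Ioi le_rfl) measurableSet_Ioi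
        (hi.mono_measure (Measure.restrict_mono_set _ Ioc_subset_Ioi_self))
        (hi.mono_measure (Measure.restrict_mono_set _ (Ioi_subset_Ioi (by norm_num))))] at h3
    linarith
  have h3 : (fun u : ℝ => ‖F u‖ ^ 2) =ᵐ[volume.restrict (Ioc (-1 : ℝ) 0)] 0 := by
    refine (integral_eq_zero_iff_of_nonneg (fun _ => by positivity)
      ((hF2 1).norm.integrable_sq.mono_measure
        (Measure.restrict_mono_set _ Ioc_subset_Ioi_self))).mp (le_antisymm h2 ?_)
    exact integral_nonneg fun _ => by positivity
  have hFc : Continuous fun u : ℝ => F u := hF.continuous.comp Complex.continuous_ofReal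
  have h4 : EqOn (fun u : ℝ => F u) 0 (Ioo (-1 : ℝ) 0) := by
    refine Measure.eqOn_open_of_ae_eq (μ := volume) ?_ isOpen_Ioo hFc.continuousOn
      continuousOn_const
    refine Filter.Eventually.filter_mono (ae_mono (Measure.restrict_mono_set _
      Ioo_subset_Ioc_self)) (h3.mono fun u hu => ?_)
    simpa using hu
  -- identity theorem
  have h5 : F = 0 := by
    refine AnalyticOnNhd.eq_of_frequently_eq (z₀ := ((-(1 / 2) : ℝ) : ℂ))
      (hF.differentiableOn.analyticOnNhd isOpen_univ)
      (fun _ _ => analyticAt_const) ?_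
    have ht : Filter.Tendsto (fun u : ℝ => (u : ℂ)) (nhdsWithin (-(1 / 2) : ℝ) {-(1 / 2)}ᶜ)
        (nhdsWithin ((-(1 / 2) : ℝ) : ℂ) {((-(1 / 2) : ℝ) : ℂ)}ᶜ) := by
      refine Complex.continuous_ofReal.continuousWithinAt.tendsto_nhdsWithin fun u hu => ?_
      simpa [Complex.ofReal_inj] using fun h => hu (Complex.ofReal_injective (by simpa using h))
    refine ht.frequently (Filter.Eventually.frequently ?_)
    refine Filter.Eventually.filter_mono nhdsWithin_le_nhds ?_
    filter_upwards [Ioo_mem_nhds (show (-1 : ℝ) < -(1 / 2) by norm_num)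
      (show (-(1 / 2) : ℝ) < 0 by norm_num)] with u hu
    exact h4 hu
  have h6 : Bt f = 0 := by
    refine Lp.ext ?_
    filter_upwards [hBtF, Lp.coeFn_zero ℂ 2 (volume.restrict (Ioi (0 : ℝ)))] with u hu hz
    rw [hu, hz, h5]
    rfl
  rw [h6, map_zero] at hf
  exact hne hf.symm

/-- The Airy operator is a product of two integral operators, and `Id - K_Ai` is invertible. -/
theorem airyOperator_spec
    (hBo : HasKernel (volume.restrict (Ici s)) (volume.restrict (Ioi 0))
      (fun z u => airyAi (z + u)) Bo)
    (hBt : HasKernel (volume.restrict (Ioi 0)) (volume.restrict (Ici s))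
      (fun u z => airyAi (z + u)) Bt) :
    IsIntegralOperator (volume.restrict (Ici s)) airyKernel (Bo ∘L Bt) ∧
      airyOperator s = Bo ∘L Bt ∧ IsUnit (1 - airyOperator s) := by
  have hb := isProductBounded_airyAi s 0
  have hK : HasKernel (volume.restrict (Ici s)) (volume.restrict (Ici s)) airyKernel
      (Bo ∘L Bt) := hBo.comp hBt hb hb.swap
  have hop : airyOperator s = Bo ∘L Bt := hK.integralOperator_eq
  refine ⟨hK, hop, ?_⟩
  rw [hop]
  have hc : IsCompactOperator (Bo ∘L Bt) := (hBo.isCompactOperator hb).comp_clm Bt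
  rcases hc.hasEigenvalue_or_mem_resolventSet one_ne_zero with h | h
  · obtain ⟨f, hf⟩ := h.exists_hasEigenvector
    refine absurd (eq_zero_of_airyKernel_fixed hBo hBt f ?_) hf.2
    simpa using hf.apply_eq_smul
  · simpa using spectrum.mem_resolventSet_iff.mp h

end Invertibility

/-! ### Exponential functions on the four contours -/

section Legs

instance sigmaFinite_legMeasure : SigmaFinite legMeasure := by
  unfold legMeasure
  infer_instance

theorem integrable_legMeasure {f : Fin 4 × ℝ → ℂ} (hm : AEStronglyMeasurable f legMeasure)
    (h : ∀ l, Integrable fun t => f (l, t)) : Integrable f legMeasure := by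
  refine (integrable_prod_iff hm).mpr ⟨Filter.Eventually.of_forall h, ?_⟩
  exact Integrable.of_finite

theorem integral_legMeasure {f : Fin 4 × ℝ → ℂ} (hm : AEStronglyMeasurable f legMeasure)
    (h : ∀ l, Integrable fun t => f (l, t)) :
    ∫ p, f p ∂legMeasure = ∑ l, ∫ t, f (l, t) := by
  rw [legMeasure, integral_prod f (integrable_legMeasure hm h),
    integral_fintype Integrable.of_finite]
  simp

theorem memLp_exp_neg_abs_legMeasure :
    MemLp (fun p : Fin 4 × ℝ => Real.exp (-|p.2|)) 2 legMeasure := by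
  have hc : Measurable fun p : Fin 4 × ℝ => Real.exp (-|p.2|) :=
    (Continuous.measurable (by fun_prop : Continuous fun t : ℝ => Real.exp (-|t|))).comp
      measurable_snd
  rw [memLp_two_iff_integrable_sq hc.aestronglyMeasurable]
  have hi : Integrable fun t : ℝ => Real.exp (-|t|) ^ 2 := by
    refine integrable_exp_neg_abs.mono' (Continuous.aestronglyMeasurable (by fun_prop))
      (Filter.Eventually.of_forall fun t => ?_)
    rw [Real.norm_of_nonneg (by positivity)]
    have h1 : Real.exp (-|t|) ≤ 1 := Real.exp_le_one_iff.mpr (by simp)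
    nlinarith [Real.exp_pos (-|t|)]
  refine (integrable_prod_iff (hc.pow_const 2).aestronglyMeasurable).mpr
    ⟨Filter.Eventually.of_forall fun _ => hi, Integrable.of_finite⟩

/-- The function `d e^{κ λ³ + θ λ² - (e y + y₀) λ}` of `λ = γ(t)` and the real variable `y`, with
different coefficients on the four copies of the contour. -/
def legExp (γ : ℝ → ℂ) (d : Fin 4 → ℂ) (κ θ e y₀ : Fin 4 → ℝ) (p : Fin 4 × ℝ) (y : ℝ) : ℂ :=
  d p.1 * Complex.exp (κ p.1 * γ p.2 ^ 3 + θ p.1 * γ p.2 ^ 2 -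
    ((e p.1 * y + y₀ p.1 : ℝ) : ℂ) * γ p.2)

variable {γ : ℝ → ℂ} {d d' : Fin 4 → ℂ} {κ θ e y₀ κ' θ' e' y₀' : Fin 4 → ℝ}

theorem measurable_legExp (hγ : Continuous γ) :
    Measurable (Function.uncurry (legExp γ d κ θ e y₀)) := by
  have m1 : ∀ f : Fin 4 → ℝ, Measurable fun p : (Fin 4 × ℝ) × ℝ => (f p.1.1 : ℂ) := fun f =>
    (measurable_of_finite fun l => (f l : ℂ)).comp (measurable_fst.comp measurable_fst)
  have m2 : Measurable fun p : (Fin 4 × ℝ) × ℝ => d p.1.1 :=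
    (measurable_of_finite d).comp (measurable_fst.comp measurable_fst)
  have m3 : Measurable fun p : (Fin 4 × ℝ) × ℝ => γ p.1.2 :=
    hγ.measurable.comp (measurable_snd.comp measurable_fst)
  have m4 : Measurable fun p : (Fin 4 × ℝ) × ℝ => ((e p.1.1 * p.2 + y₀ p.1.1 : ℝ) : ℂ) := by
    push_cast
    exact ((m1 e).mul (Complex.measurable_ofReal.comp measurable_snd)).add (m1 y₀)
  exact m2.mul ((((m1 κ).mul (m3.pow_const 3)).add ((m1 θ).mul (m3.pow_const 2))).sub
    (m4.mul m3)).cexp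

theorem measurable_legExp_mul_deriv (hγ : Continuous γ) :
    Measurable (Function.uncurry fun y p => legExp γ d κ θ e y₀ p y * deriv γ p.2) :=
  ((measurable_legExp hγ).comp measurable_swap).mul
    ((measurable_deriv γ).comp (measurable_snd.comp measurable_snd))

/-- If `|e^{-e y λ}| ≤ ψ(y) e^{M |λ|}` on the contours that carry a nonzero coefficient, then
`legExp` is bounded up to a constant by the product `e^{-|t|} ψ(y)`; the factor `e^{M |λ|}` is
absorbed by the cubic. -/
theorem exists_norm_legExp_le (hγ : IsWedgeContour γ) (hκ : ∀ l, 0 < κ l) {T : Set ℝ} {ψ : ℝ → ℝ}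
    (hψ0 : ∀ y, 0 ≤ ψ y) {M : ℝ} (hM : 0 ≤ M)
    (hb : ∀ l, d l ≠ 0 → ∀ y ∈ T, ∀ t, -(e l * y) * (γ t).re ≤ Real.log (ψ y) + M * ‖γ t‖)
    (hψ : ∀ y ∈ T, 0 < ψ y) :
    ∃ C, 0 ≤ C ∧ ∀ p, ∀ y ∈ T, ‖legExp γ d κ θ e y₀ p y‖ ≤ C * Real.exp (-|p.2|) * ψ y := by
  have h : ∀ l, ∃ C, ∀ t, (κ l * γ t ^ 3).re + |θ l| * ‖γ t‖ ^ 2 + (M + |y₀ l|) * ‖γ t‖ ≤ C - |t| :=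
    fun l => hγ.exists_decay (κ l) (hκ l) _ _ (abs_nonneg _) (add_nonneg hM (abs_nonneg _))
  choose C hC using h
  refine ⟨∑ l, ‖d l‖ * Real.exp (C l), Finset.sum_nonneg fun _ _ => by positivity,
    fun p y hy => ?_⟩
  obtain ⟨l, t⟩ := p
  simp only [legExp]
  by_cases hd : d l = 0
  · rw [hd, zero_mul, norm_zero]
    exact mul_nonneg (mul_nonneg (Finset.sum_nonneg fun _ _ => by positivity)
      (Real.exp_pos _).le) (hψ0 y)
  have h1 : ‖Complex.exp (κ l * γ t ^ 3 + θ l * γ t ^ 2 -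
      ((e l * y + y₀ l : ℝ) : ℂ) * γ t)‖ ≤ Real.exp (C l) * Real.exp (-|t|) * ψ y := by
    rw [← Real.exp_log (hψ y hy), ← Real.exp_add, ← Real.exp_add, Complex.norm_exp]
    refine Real.exp_le_exp.mpr ?_
    rw [Complex.sub_re, Complex.add_re, Complex.re_ofReal_mul ((e l * y + y₀ l : ℝ))]
    have h2 : ((θ l : ℂ) * γ t ^ 2).re ≤ |θ l| * ‖γ t‖ ^ 2 := by
      refine (Complex.re_le_norm _).trans_eq ?_
      rw [norm_mul, norm_pow, Complex.norm_real, Real.norm_eq_abs]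
    have h3 : -(y₀ l) * (γ t).re ≤ |y₀ l| * ‖γ t‖ := by
      calc _ ≤ |-(y₀ l) * (γ t).re| := le_abs_self _
        _ = |y₀ l| * |(γ t).re| := by rw [abs_mul, abs_neg]
        _ ≤ _ := by gcongr; exact Complex.abs_re_le_norm _
    have h4 := hb l hd y hy t
    have h5 := hC l t
    nlinarith
  rw [norm_mul]
  calc ‖d l‖ * _ ≤ ‖d l‖ * (Real.exp (C l) * Real.exp (-|t|) * ψ y) := by gcongr
    _ = (‖d l‖ * Real.exp (C l)) * Real.exp (-|t|) * ψ y := by ring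
    _ ≤ _ := by
      gcongr
      · exact hψ0 y
      · exact Finset.single_le_sum (f := fun l => ‖d l‖ * Real.exp (C l))
          (fun _ _ => by positivity) (Finset.mem_univ l)

/-- Product bounds in both orders of the variables; the second kernel carries the factor `dλ / dt`
of the contour integral. -/
theorem isProductBounded_legExp (hγ : IsWedgeContour γ) (hκ : ∀ l, 0 < κ l) {ν : Measure ℝ}
    {T : Set ℝ} {ψ : ℝ → ℝ} (hT : ∀ᵐ y ∂ν, y ∈ T) (hψm : MemLp ψ 2 ν) {M : ℝ} (hM : 0 ≤ M)
    (hb : ∀ l, d l ≠ 0 → ∀ y ∈ T, ∀ t, -(e l * y) * (γ t).re ≤ Real.log (ψ y) + M * ‖γ t‖)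
    (hψ : ∀ y, 0 < ψ y) :
    IsProductBounded legMeasure ν (legExp γ d κ θ e y₀) ∧
      IsProductBounded ν legMeasure (fun y p => legExp γ d κ θ e y₀ p y * deriv γ p.2) := by
  obtain ⟨C, hC0, hC⟩ := exists_norm_legExp_le (θ := θ) (y₀ := y₀) hγ hκ (fun y => (hψ y).le) hM hb
    fun y _ => hψ y
  obtain ⟨D, hD⟩ := hγ.deriv_le
  have hD0 : 0 ≤ D := (norm_nonneg _).trans (hD 0)
  refine ⟨⟨measurable_legExp hγ.continuous, univ, T, fun p => C * Real.exp (-|p.2|), ψ,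
      Filter.Eventually.of_forall fun _ => mem_univ _, hT, fun p => by positivity,
      fun y => (hψ y).le, memLp_exp_neg_abs_legMeasure.const_mul C, hψm,
      fun p _ y hy => hC p y hy⟩,
    ⟨measurable_legExp_mul_deriv hγ.continuous, T, univ, ψ, fun p => D * C * Real.exp (-|p.2|),
      hT, Filter.Eventually.of_forall fun _ => mem_univ _, fun y => (hψ y).le,
      fun p => by positivity, hψm, memLp_exp_neg_abs_legMeasure.const_mul (D * C),
      fun y hy p _ => ?_⟩⟩
  rw [norm_mul]
  calc _ ≤ (C * Real.exp (-|p.2|) * ψ y) * D := by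
        have := (hψ y).le
        gcongr
        · exact hC p y hy
        · exact hD _
    _ = _ := by ring

/-- The integral over the contours of a product of two exponentials is an Airy function. -/
theorem integral_legExp_mul (hγ : IsWedgeContour γ) (hκ : ∀ l, 0 < κ l) (hκ' : ∀ l, 0 < κ' l)
    {r : ℝ} (hr : 0 < r) (hr3 : ∀ l, d l * d' l ≠ 0 → 3 * (κ l + κ' l) * r ^ 3 = 1) (y z : ℝ) :
    ∫ p, (legExp γ d κ θ e y₀ p y * deriv γ p.2) * legExp γ d' κ' θ' e' y₀' p z ∂legMeasure =
      ∑ l, d l * d' l * (2 * Real.pi * Complex.I * (r * airyTau (r ^ 2 * (θ l + θ' l))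
        (r * (e l * y + y₀ l + (e' l * z + y₀' l))))) := by
  have hm : Measurable fun p => (legExp γ d κ θ e y₀ p y * deriv γ p.2) *
      legExp γ d' κ' θ' e' y₀' p z :=
    (((measurable_legExp hγ.continuous).comp (measurable_id.prodMk measurable_const)).mul
      ((measurable_deriv γ).comp measurable_snd)).mul
      ((measurable_legExp hγ.continuous).comp (measurable_id.prodMk measurable_const))
  have heq : ∀ l t, (legExp γ d κ θ e y₀ (l, t) y * deriv γ t) * legExp γ d' κ' θ' e' y₀' (l, t) z =
      d l * d' l * (Complex.exp (((κ l + κ' l : ℝ) : ℂ) * γ t ^ 3 +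
        ((θ l + θ' l : ℝ) : ℂ) * γ t ^ 2 -
        ((e l * y + y₀ l + (e' l * z + y₀' l) : ℝ) : ℂ) * γ t) * deriv γ t) := fun l t => by
    simp only [legExp]
    have : Complex.exp (((κ l + κ' l : ℝ) : ℂ) * γ t ^ 3 + ((θ l + θ' l : ℝ) : ℂ) * γ t ^ 2 -
        ((e l * y + y₀ l + (e' l * z + y₀' l) : ℝ) : ℂ) * γ t) =
        Complex.exp (κ l * γ t ^ 3 + θ l * γ t ^ 2 - ((e l * y + y₀ l : ℝ) : ℂ) * γ t) *
        Complex.exp (κ' l * γ t ^ 3 + θ' l * γ t ^ 2 - ((e' l * z + y₀' l : ℝ) : ℂ) * γ t) := by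
      rw [← Complex.exp_add]
      congr 1
      push_cast
      ring
    rw [this]
    ring
  rw [integral_legMeasure hm.aestronglyMeasurable]
  · refine Finset.sum_congr rfl fun l _ => ?_
    simp only [heq]
    rw [integral_const_mul]
    by_cases h0 : d l * d' l = 0
    · rw [h0, zero_mul, zero_mul]
    · rw [hγ.integral_eq_airyTau hr (hr3 l h0)]
  · intro l
    simp only [heq]
    exact (hγ.integrable (add_pos (hκ l) (hκ' l)) _ _).const_mul _

end Legs

/-! ### Factorization of the contour operator -/

section Factorization

theorem cbrtTwo_pos : 0 < cbrtTwo := Real.rpow_pos_of_pos two_pos _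

theorem cbrtTwo_cube : cbrtTwo ^ 3 = 2 := by
  rw [cbrtTwo, ← Real.rpow_natCast, ← Real.rpow_mul (by norm_num)]
  norm_num

theorem cbrtTwo_sq : cbrtTwo ^ 2 = (2 : ℝ) ^ ((2 : ℝ) / 3) := by
  rw [cbrtTwo, ← Real.rpow_natCast, ← Real.rpow_mul (by norm_num)]
  norm_num

theorem cbrtTwo_sq_mul (τ : ℝ) : cbrtTwo ^ 2 * (τ / (2 : ℝ) ^ ((2 : ℝ) / 3)) = τ := by
  rw [← cbrtTwo_sq]
  have := cbrtTwo_pos.ne'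
  field_simp

/-- The factor `x ↦ h_x(ξ)⁻¹` on `L₁` and `x ↦ -g_x(ξ)⁻¹` on `R₂`, where the endpoint `ã_j` in
`h_j` and `g_j` is replaced by `x`. -/
def factorA₀ (τ s : ℝ) (γ : ℝ → ℂ) : Fin 4 × ℝ → ℝ → ℂ :=
  legExp γ ![cbrtTwo, 0, 0, -cbrtTwo] (fun _ => 1 / 12)
    (fun _ => -(τ / (2 : ℝ) ^ ((2 : ℝ) / 3))) ![1, 1, 1, -1] ![s, 0, 0, 0]

/-- The factor `x ↦ h_x(ζ) / (2πi)` on `R₁` and `x ↦ g_x(ζ) / (2πi)` on `L₂`; the sign on `L₂`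
comes from the orientation `dζ = -γ'(t) dt`. -/
def factorB₀ (τ s : ℝ) (γ : ℝ → ℂ) (x : ℝ) (p : Fin 4 × ℝ) : ℂ :=
  legExp γ
    ![0, (cbrtTwo * (2 * Real.pi * Complex.I))⁻¹, -(cbrtTwo * (2 * Real.pi * Complex.I))⁻¹, 0]
    (fun _ => 1 / 12) (fun _ => τ / (2 : ℝ) ^ ((2 : ℝ) / 3)) ![1, 1, -1, 1] ![0, s, 0, 0] p x *
    deriv γ p.2

/-- The factor `u ↦ e^{-ξ³/12 + u ξ}` on `L₂`. -/
def factorA₁ (γ : ℝ → ℂ) : Fin 4 × ℝ → ℝ → ℂ :=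
  legExp γ ![0, 0, 1, 0] (fun _ => 1 / 12) (fun _ => 0) (fun _ => 1) (fun _ => 0)

/-- The factor `u ↦ e^{ζ³/12 - u ζ} / (2πi)` on `R₂`. -/
def factorB₁ (γ : ℝ → ℂ) (u : ℝ) (p : Fin 4 × ℝ) : ℂ :=
  legExp γ ![0, 0, 0, (2 * Real.pi * Complex.I)⁻¹] (fun _ => 1 / 12) (fun _ => 0) (fun _ => 1)
    (fun _ => 0) p u * deriv γ p.2

/-- The factor `z ↦ -e^{ξ³/12 - (z - s) ξ}` on `R₁` and `z ↦ -e^{ξ³/4 - z ξ}` on `R₂`. -/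
def factorA₂ (s : ℝ) (γ : ℝ → ℂ) : Fin 4 × ℝ → ℝ → ℂ :=
  legExp γ ![0, -1, 0, -1] ![1 / 12, 1 / 12, 1 / 4, 1 / 4] (fun _ => 0) (fun _ => 1) ![-s, -s, 0, 0]

/-- The factor `z ↦ e^{-ζ³/12 + (z - s) ζ} / (2πi)` on `L₁` and `z ↦ e^{-ζ³/4 + z ζ} / (2πi)` on
`L₂`; the signs come from the orientation `dζ = -γ'(t) dt`. -/
def factorB₂ (s : ℝ) (γ : ℝ → ℂ) (z : ℝ) (p : Fin 4 × ℝ) : ℂ :=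
  legExp γ ![-(2 * Real.pi * Complex.I)⁻¹, 0, -(2 * Real.pi * Complex.I)⁻¹, 0]
    ![1 / 12, 1 / 12, 1 / 4, 1 / 4] (fun _ => 0) (fun _ => 1) ![-s, -s, 0, 0] p z * deriv γ p.2

/-- `(x, u) ↦ Ai^{(τ)}(2^{1/3} (u - x))`. -/
def airyRow₁ (τ x u : ℝ) : ℂ := airyTau τ (-(cbrtTwo * x) + cbrtTwo * u)

/-- `(x, z) ↦ Ai^{(τ)}(2^{1/3} (x + z))`. -/
def airyRow₂ (τ x z : ℝ) : ℂ := airyTau τ (cbrtTwo * x + cbrtTwo * z)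

variable {γ : ℝ → ℂ} {τ s R : ℝ} {J : Set ℝ}

/-- On `[a, ∞)` the exponential `e^{-y λ}` decays in `y` at the rate `r ≤ Re λ`. -/
theorem legs_re_le_of_ge {a r : ℝ} (hr0 : 0 < r) (hr : ∀ t, r ≤ (γ t).re) {e : Fin 4 → ℝ}
    (he : ∀ l, e l = 1) (d : Fin 4 → ℂ) :
    ∀ l, d l ≠ 0 → ∀ y ∈ Ici a, ∀ t, -(e l * y) * (γ t).re ≤
      Real.log (Real.exp (-(r * y))) + |a| * ‖γ t‖ := fun l _ y hy t => by
  rw [Real.log_exp, he]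
  have h1 := hr t
  have h2 : a ≤ y := hy
  have h3 : (γ t).re ≤ ‖γ t‖ := Complex.re_le_norm _
  have h4 : 0 ≤ (y - a) * ((γ t).re - r) := mul_nonneg (by linarith) (by linarith)
  have h5 : -a * ((γ t).re - r) ≤ |a| * ‖γ t‖ :=
    mul_le_mul (neg_le_abs a) (by linarith) (by linarith) (abs_nonneg a)
  nlinarith

/-- On a bounded set no decay in `y` is needed, and the sign of the coefficient of `y λ`
is irrelevant. -/
theorem legs_re_le_of_bounded {e : Fin 4 → ℝ} (he : ∀ l, |e l| = 1) (d : Fin 4 → ℂ) :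
    ∀ l, d l ≠ 0 → ∀ y ∈ Icc (-R) R, ∀ t, -(e l * y) * (γ t).re ≤
      Real.log 1 + R * ‖γ t‖ := fun l _ y hy t => by
  rw [Real.log_one, zero_add]
  refine (le_abs_self _).trans ?_
  rw [abs_mul, abs_neg, abs_mul, he, one_mul]
  have h1 : |y| ≤ R := abs_le.mpr hy
  have : 0 ≤ R := (abs_nonneg y).trans h1
  gcongr
  exact Complex.abs_re_le_norm _

theorem memLp_of_bounded_on (hJ : MeasurableSet J) (hJR : J ⊆ Icc (-R) R) {f : ℝ → ℝ} (C : ℝ)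
    (hf : Measurable f) (hC : ∀ x ∈ Icc (-R) R, |f x| ≤ C) : MemLp f 2 (volume.restrict J) := by
  have : IsFiniteMeasure ((volume : Measure ℝ).restrict J) :=
    ⟨by rw [Measure.restrict_apply_univ]; exact (measure_mono hJR).trans_lt (by simp)⟩
  exact MemLp.of_bound hf.aestronglyMeasurable C
    (ae_restrict_of_forall_mem hJ fun x hx => hC x (hJR hx))

theorem isProductBounded_factor₀ (hγ : IsAiryContour γ) (hJ : MeasurableSet J)
    (hJR : J ⊆ Icc (-R) R) (hR : 0 ≤ R) :
    IsProductBounded legMeasure (volume.restrict J) (factorA₀ τ s γ) ∧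
      IsProductBounded (volume.restrict J) legMeasure (factorB₀ τ s γ) := by
  have hT : ∀ᵐ y ∂(volume.restrict J), y ∈ Icc (-R) R := ae_restrict_of_forall_mem hJ hJR
  have hψ : MemLp (fun _ : ℝ => (1 : ℝ)) 2 (volume.restrict J) :=
    memLp_of_bounded_on hJ hJR 1 measurable_const fun _ _ => by simp
  constructor
  · exact (isProductBounded_legExp hγ.isWedgeContour (fun _ => by norm_num) hT hψ hR
      (legs_re_le_of_bounded (fun l => by fin_cases l <;> simp) _) fun _ => one_pos).1
  · exact (isProductBounded_legExp hγ.isWedgeContour (fun _ => by norm_num) hT hψ hR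
      (legs_re_le_of_bounded (fun l => by fin_cases l <;> simp) _) fun _ => one_pos).2

theorem isProductBounded_factor₁ (hγ : IsAiryContour γ) :
    IsProductBounded legMeasure (volume.restrict (Ioi 0)) (factorA₁ γ) ∧
      IsProductBounded (volume.restrict (Ioi 0)) legMeasure (factorB₁ γ) := by
  obtain ⟨r, hr0, hr⟩ := hγ.exists_le_re
  have hT : ∀ᵐ y ∂(volume.restrict (Ioi (0 : ℝ))), y ∈ Ici (0 : ℝ) :=
    ae_restrict_of_forall_mem measurableSet_Ioi fun _ h => le_of_lt (mem_Ioi.mp h)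
  constructor
  · exact (isProductBounded_legExp hγ.isWedgeContour (fun _ => by norm_num) hT
      (memLp_exp_neg_mul_Ioi hr0 0) (abs_nonneg 0) (legs_re_le_of_ge hr0 hr (fun _ => rfl) _)
      fun _ => Real.exp_pos _).1
  · exact (isProductBounded_legExp hγ.isWedgeContour (fun _ => by norm_num) hT
      (memLp_exp_neg_mul_Ioi hr0 0) (abs_nonneg 0) (legs_re_le_of_ge hr0 hr (fun _ => rfl) _)
      fun _ => Real.exp_pos _).2

theorem isProductBounded_factor₂ (hγ : IsAiryContour γ) :
    IsProductBounded legMeasure (volume.restrict (Ici s)) (factorA₂ s γ) ∧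
      IsProductBounded (volume.restrict (Ici s)) legMeasure (factorB₂ s γ) := by
  obtain ⟨r, hr0, hr⟩ := hγ.exists_le_re
  have hT : ∀ᵐ y ∂(volume.restrict (Ici s)), y ∈ Ici s :=
    ae_restrict_of_forall_mem measurableSet_Ici fun _ h => h
  have hκ : ∀ l, 0 < (![1 / 12, 1 / 12, 1 / 4, 1 / 4] : Fin 4 → ℝ) l := fun l => by
    fin_cases l <;> simp
  constructor
  · exact (isProductBounded_legExp hγ.isWedgeContour hκ hT
      (memLp_exp_neg_mul_Ici hr0 s) (abs_nonneg s) (legs_re_le_of_ge hr0 hr (fun _ => rfl) _)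
      fun _ => Real.exp_pos _).1
  · exact (isProductBounded_legExp hγ.isWedgeContour hκ hT
      (memLp_exp_neg_mul_Ici hr0 s) (abs_nonneg s) (legs_re_le_of_ge hr0 hr (fun _ => rfl) _)
      fun _ => Real.exp_pos _).2

theorem isProductBounded_airyRow₁ (τ : ℝ) (hJ : MeasurableSet J) (hJR : J ⊆ Icc (-R) R) :
    IsProductBounded (volume.restrict J) (volume.restrict (Ioi 0)) (airyRow₁ τ) := by
  have hc := cbrtTwo_pos
  refine isProductBounded_airyTau τ (p := fun x => -(cbrtTwo * x)) (q := fun u => cbrtTwo * u)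
    (p₀ := -(cbrtTwo * R)) (q₀ := 0) (by fun_prop) (by fun_prop)
    (ae_restrict_of_forall_mem hJ fun x hx => ?_)
    (ae_restrict_of_forall_mem measurableSet_Ioi fun u hu => mul_nonneg hc.le (le_of_lt hu))
    (memLp_of_bounded_on hJ hJR (Real.exp (cbrtTwo * R)) (by fun_prop) fun x hx => ?_)
    (memLp_exp_neg_mul_Ioi hc 0)
  · have := (hJR hx).2
    nlinarith
  · rw [abs_of_pos (Real.exp_pos _), neg_neg]
    exact Real.exp_le_exp.mpr (by nlinarith [hx.2])

theorem isProductBounded_airyRow₂ (τ : ℝ) (hJ : MeasurableSet J) (hJR : J ⊆ Icc (-R) R) :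
    IsProductBounded (volume.restrict J) (volume.restrict (Ici s)) (airyRow₂ τ) := by
  have hc := cbrtTwo_pos
  refine isProductBounded_airyTau τ (p := fun x => cbrtTwo * x) (q := fun u => cbrtTwo * u)
    (p₀ := -(cbrtTwo * R)) (q₀ := cbrtTwo * s) (by fun_prop) (by fun_prop)
    (ae_restrict_of_forall_mem hJ fun x hx => ?_)
    (ae_restrict_of_forall_mem measurableSet_Ici fun u hu => mul_le_mul_of_nonneg_left hu hc.le)
    (memLp_of_bounded_on hJ hJR (Real.exp (cbrtTwo * R)) (by fun_prop) fun x hx => ?_)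
    (memLp_exp_neg_mul_Ici hc s)
  · have := (hJR hx).1
    nlinarith
  · rw [abs_of_pos (Real.exp_pos _)]
    exact Real.exp_le_exp.mpr (by nlinarith [hx.1])

theorem memLp_airyTau_mul_Ici (τ x a : ℝ) :
    MemLp (fun z => airyTau τ (x + cbrtTwo * z)) 2 (volume.restrict (Ici a)) := by
  have hc := cbrtTwo_pos
  obtain ⟨C, hC, hb⟩ := exists_norm_airyTau_le τ (x + cbrtTwo * a)
  refine ((memLp_exp_neg_mul_Ici hc a).const_mul (C * Real.exp (-x))).of_le
    ((measurable_airyTau τ).comp (by fun_prop)).aestronglyMeasurable ?_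
  refine ae_restrict_of_forall_mem measurableSet_Ici fun z hz => ?_
  have hz' : a ≤ z := hz
  refine (hb _ (by gcongr)).trans ((le_of_eq ?_).trans (le_abs_self _))
  rw [mul_assoc, ← Real.exp_add]
  ring_nf

theorem memLp_airyRow₁ (τ x : ℝ) : MemLp (airyRow₁ τ x) 2 (volume.restrict (Ioi 0)) :=
  (memLp_airyTau_mul_Ici τ (-(cbrtTwo * x)) 0).mono_measure
    (Measure.restrict_mono_set _ Ioi_subset_Ici_self)

theorem memLp_airyRow₂ (τ x : ℝ) : MemLp (airyRow₂ τ x) 2 (volume.restrict (Ici s)) :=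
  memLp_airyTau_mul_Ici τ (cbrtTwo * x) s

/-! ### Composition of the factors in the other order -/

/-- The exponents add up to `λ³/6`; the substitution `λ ↦ 2^{1/3} λ` turns this into `λ³/3`, which
is where the scale `2^{1/3}` of the Airy functions comes from. The same happens in the other three
blocks with a row or a column in `L²(J)`. -/
theorem block₀₁_eq (hγ : IsWedgeContour γ) (x u : ℝ) :
    ∫ p, factorB₀ τ s γ x p * factorA₁ γ p u ∂legMeasure = -airyRow₁ τ x u := by
  have hc : (cbrtTwo : ℂ) ≠ 0 := by exact_mod_cast cbrtTwo_pos.ne'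
  have h2 := two_pi_I_ne_zero
  simp only [factorB₀, factorA₁]
  rw [integral_legExp_mul hγ (fun _ => by norm_num) (fun _ => by norm_num) cbrtTwo_pos
    (fun l _ => by rw [cbrtTwo_cube]; norm_num)]
  simp only [Fin.sum_univ_four, Matrix.cons_val_zero, Matrix.cons_val_one, Matrix.cons_val,
    zero_mul, mul_zero, zero_add, add_zero, mul_one, one_mul, cbrtTwo_sq_mul]
  rw [airyRow₁, show cbrtTwo * (-1 * x + u) = -(cbrtTwo * x) + cbrtTwo * u by ring]
  field_simp

theorem block₀₂_eq (hγ : IsWedgeContour γ) (x z : ℝ) :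
    ∫ p, factorB₀ τ s γ x p * factorA₂ s γ p z ∂legMeasure = -airyRow₂ τ x z := by
  have hc : (cbrtTwo : ℂ) ≠ 0 := by exact_mod_cast cbrtTwo_pos.ne'
  have h2 := two_pi_I_ne_zero
  have hκ : ∀ l, 0 < (![1 / 12, 1 / 12, 1 / 4, 1 / 4] : Fin 4 → ℝ) l := fun l => by
    fin_cases l <;> simp
  simp only [factorB₀, factorA₂]
  rw [integral_legExp_mul hγ (fun _ => by norm_num) hκ cbrtTwo_pos
    (fun l hl => by rw [cbrtTwo_cube]; fin_cases l <;> simp at hl ⊢; norm_num)]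
  simp only [Fin.sum_univ_four, Matrix.cons_val_zero, Matrix.cons_val_one, Matrix.cons_val,
    zero_mul, mul_zero, zero_add, add_zero, one_mul, cbrtTwo_sq_mul]
  rw [airyRow₂, show cbrtTwo * (x + s + (z + -s)) = cbrtTwo * x + cbrtTwo * z by ring]
  field_simp

theorem block₁₀_eq (hγ : IsWedgeContour γ) (u x : ℝ) :
    ∫ p, factorB₁ γ u p * factorA₀ τ s γ p x ∂legMeasure =
      -((cbrtTwo : ℂ) ^ 2 * airyRow₁ (-τ) x u) := by
  have h2 := two_pi_I_ne_zero
  simp only [factorB₁, factorA₀]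
  rw [integral_legExp_mul hγ (fun _ => by norm_num) (fun _ => by norm_num) cbrtTwo_pos
    (fun l _ => by rw [cbrtTwo_cube]; norm_num)]
  simp only [Fin.sum_univ_four, Matrix.cons_val_zero, Matrix.cons_val_one, Matrix.cons_val,
    zero_mul, mul_zero, zero_add, add_zero, one_mul, mul_neg, cbrtTwo_sq_mul]
  rw [airyRow₁, show cbrtTwo * (u + -1 * x) = -(cbrtTwo * x) + cbrtTwo * u by ring]
  field_simp

theorem block₂₀_eq (hγ : IsWedgeContour γ) (z x : ℝ) :
    ∫ p, factorB₂ s γ z p * factorA₀ τ s γ p x ∂legMeasure =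
      -((cbrtTwo : ℂ) ^ 2 * airyRow₂ (-τ) x z) := by
  have h2 := two_pi_I_ne_zero
  have hκ : ∀ l, 0 < (![1 / 12, 1 / 12, 1 / 4, 1 / 4] : Fin 4 → ℝ) l := fun l => by
    fin_cases l <;> simp
  simp only [factorB₂, factorA₀]
  rw [integral_legExp_mul hγ hκ (fun _ => by norm_num) cbrtTwo_pos
    (fun l hl => by rw [cbrtTwo_cube]; fin_cases l <;> simp at hl ⊢; norm_num)]
  simp only [Fin.sum_univ_four, Matrix.cons_val_zero, Matrix.cons_val_one, Matrix.cons_val,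
    zero_mul, mul_zero, zero_add, add_zero, one_mul, mul_neg, neg_zero, cbrtTwo_sq_mul]
  rw [airyRow₂, show cbrtTwo * (z + -s + (x + s)) = cbrtTwo * x + cbrtTwo * z by ring]
  field_simp

theorem block₁₂_eq (hγ : IsWedgeContour γ) (u z : ℝ) :
    ∫ p, factorB₁ γ u p * factorA₂ s γ p z ∂legMeasure = -airyAi (z + u) := by
  have h2 := two_pi_I_ne_zero
  have hκ : ∀ l, 0 < (![1 / 12, 1 / 12, 1 / 4, 1 / 4] : Fin 4 → ℝ) l := fun l => by
    fin_cases l <;> simp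
  simp only [factorB₁, factorA₂]
  rw [integral_legExp_mul hγ (fun _ => by norm_num) hκ one_pos
    (fun l hl => by fin_cases l <;> simp at hl ⊢; norm_num)]
  simp only [Fin.sum_univ_four, Matrix.cons_val_zero, Matrix.cons_val_one, Matrix.cons_val,
    zero_mul, mul_zero, zero_add, add_zero, one_mul, Complex.ofReal_one]
  rw [airyAi, add_comm u z]
  field_simp

theorem block₂₁_eq (hγ : IsWedgeContour γ) (z u : ℝ) :
    ∫ p, factorB₂ s γ z p * factorA₁ γ p u ∂legMeasure = -airyAi (z + u) := by
  have h2 := two_pi_I_ne_zero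
  have hκ : ∀ l, 0 < (![1 / 12, 1 / 12, 1 / 4, 1 / 4] : Fin 4 → ℝ) l := fun l => by
    fin_cases l <;> simp
  simp only [factorB₂, factorA₁]
  rw [integral_legExp_mul hγ hκ (fun _ => by norm_num) one_pos
    (fun l hl => by fin_cases l <;> simp at hl ⊢; norm_num)]
  simp only [Fin.sum_univ_four, Matrix.cons_val_zero, Matrix.cons_val_one, Matrix.cons_val,
    zero_mul, mul_zero, zero_add, add_zero, mul_one, one_mul, Complex.ofReal_one]
  rw [airyAi]
  field_simp

theorem factorB₀_mul_factorA₀ (x y : ℝ) (p : Fin 4 × ℝ) :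
    factorB₀ τ s γ x p * factorA₀ τ s γ p y = 0 := by
  obtain ⟨l, t⟩ := p
  fin_cases l <;> simp [factorB₀, factorA₀, legExp]

theorem factorB₁_mul_factorA₁ (x y : ℝ) (p : Fin 4 × ℝ) :
    factorB₁ γ x p * factorA₁ γ p y = 0 := by
  obtain ⟨l, t⟩ := p
  fin_cases l <;> simp [factorB₁, factorA₁, legExp]

theorem factorB₂_mul_factorA₂ (x y : ℝ) (p : Fin 4 × ℝ) :
    factorB₂ s γ x p * factorA₂ s γ p y = 0 := by
  obtain ⟨l, t⟩ := p
  fin_cases l <;> simp [factorB₂, factorA₂, legExp]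

end Factorization

/-! ### Weak forms of compositions and transposes -/

section General

variable {X Y Z : Type} [MeasurableSpace X] [MeasurableSpace Y] [MeasurableSpace Z]
  {μ : Measure X} {ν : Measure Y} {ρ : Measure Z}

theorem IsProductBounded.const_mul {F : X → Y → ℂ} (hF : IsProductBounded μ ν F) (c : ℂ) :
    IsProductBounded μ ν fun x y => c * F x y := by
  obtain ⟨S, T, φ, ψ, hS, hT, h1, h2, h3, h4, h5⟩ := hF.exists_bound
  refine ⟨hF.measurable.const_mul c, S, T, fun x => ‖c‖ * φ x, ψ, hS, hT,
    fun x => mul_nonneg (norm_nonneg _) (h1 x), h2, h3.const_mul _, h4, fun x hx y hy => ?_⟩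
  rw [norm_mul, mul_assoc]
  exact mul_le_mul_of_nonneg_left (h5 x hx y hy) (norm_nonneg _)

variable [SFinite μ] [SFinite ν] [SFinite ρ]

/-- The weak form of a composition with a known kernel. -/
theorem integral_inner_mul_inner_eq_neg {A : X → Z → ℂ} {B : Y → X → ℂ} {G : Y → Z → ℂ}
    (hB : IsProductBounded ν μ B) (hA : IsProductBounded μ ρ A)
    (hG : ∀ y z, ∫ p, B y p * A p z ∂μ = -G y z) (h : Lp ℂ 2 ν) (g : Lp ℂ 2 ρ) :
    ∫ p, ⟪h, toL2 ν fun y => B y p⟫_ℂ * ⟪toL2 ρ fun z => starRingEnd ℂ (A p z), g⟫_ℂ ∂μ =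
      -∫ y, starRingEnd ℂ (h y) * ∫ z, G y z * g z ∂ρ ∂ν := by
  rw [integral_inner_mul_inner hB hA]
  simp only [hG, neg_mul, integral_neg, mul_neg]

/-- The transpose of an integral operator. -/
theorem HasKernel.integral_mul_eq {F : X → Y → ℂ} {T : Lp ℂ 2 ν →L[ℂ] Lp ℂ 2 μ}
    {T' : Lp ℂ 2 μ →L[ℂ] Lp ℂ 2 ν} (hT : HasKernel μ ν F T)
    (hT' : HasKernel ν μ (fun y x => F x y) T') (hF : IsProductBounded μ ν F) (p : Lp ℂ 2 ν)
    (q : Lp ℂ 2 μ) : ∫ x, T p x * q x ∂μ = ∫ y, p y * T' q y ∂ν := by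
  have hi := hF.integrable_mul (Lp.memLp q) (Lp.memLp p)
  calc ∫ x, T p x * q x ∂μ = ∫ x, ∫ y, q x * (F x y * p y) ∂ν ∂μ := by
        refine integral_congr_ae ?_
        filter_upwards [hT p] with x hx
        rw [hx.2, integral_const_mul, mul_comm]
    _ = ∫ y, ∫ x, q x * (F x y * p y) ∂μ ∂ν := integral_integral_swap hi
    _ = _ := by
        refine integral_congr_ae ?_
        filter_upwards [hT' q] with y hy
        rw [hy.2, ← integral_const_mul]
        refine integral_congr_ae (Filter.Eventually.of_forall fun x => ?_)
        simp only
        ring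

end General

/-! ### The block operator -/

section Blocks

variable {γ : ℝ → ℂ} {τ s R : ℝ} {J : Set ℝ}
  {Bo : Lp ℂ 2 (volume.restrict (Ioi (0 : ℝ))) →L[ℂ] Lp ℂ 2 (volume.restrict (Ici s))}
  {Bt : Lp ℂ 2 (volume.restrict (Ici s)) →L[ℂ] Lp ℂ 2 (volume.restrict (Ioi (0 : ℝ)))}

/-- The composition of the factors in the other order has the blocks required for the
elimination. -/
theorem blockFactorization_factors (hγ : IsAiryContour γ) (hJ : MeasurableSet J)
    (hJR : J ⊆ Icc (-R) R) (hR : 0 ≤ R)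
    (hBo : HasKernel (volume.restrict (Ici s)) (volume.restrict (Ioi 0))
      (fun z u => airyAi (z + u)) Bo)
    (hBt : HasKernel (volume.restrict (Ioi 0)) (volume.restrict (Ici s))
      (fun u z => airyAi (z + u)) Bt) :
    BlockFactorization legMeasure (volume.restrict J)
      (fun p => toL2 (volume.restrict J) fun x => starRingEnd ℂ (factorA₀ τ s γ p x))
      (fun p => toL2 (volume.restrict J) fun x => factorB₀ τ s γ x p)
      (fun p => toL2 (volume.restrict (Ioi 0)) fun u => starRingEnd ℂ (factorA₁ γ p u))
      (fun p => toL2 (volume.restrict (Ioi 0)) fun u => factorB₁ γ u p)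
      (fun p => toL2 (volume.restrict (Ici s)) fun z => starRingEnd ℂ (factorA₂ s γ p z))
      (fun p => toL2 (volume.restrict (Ici s)) fun z => factorB₂ s γ z p)
      Bo Bt
      (fun x => toL2 (volume.restrict (Ioi 0)) fun u => starRingEnd ℂ (airyRow₁ τ x u))
      (fun x => toL2 (volume.restrict (Ioi 0)) fun u => (cbrtTwo : ℂ) ^ 2 * airyRow₁ (-τ) x u)
      (fun x => toL2 (volume.restrict (Ici s)) fun z => starRingEnd ℂ (airyRow₂ τ x z))
      (fun x => toL2 (volume.restrict (Ici s)) fun z =>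
        (cbrtTwo : ℂ) ^ 2 * airyRow₂ (-τ) x z) := by
  obtain ⟨hA₀, hB₀⟩ := isProductBounded_factor₀ (τ := τ) (s := s) hγ hJ hJR hR
  obtain ⟨hA₁, hB₁⟩ := isProductBounded_factor₁ hγ
  obtain ⟨hA₂, hB₂⟩ := isProductBounded_factor₂ (s := s) hγ
  have hw := hγ.isWedgeContour
  have r₁ := isProductBounded_airyRow₁ τ hJ hJR
  have r₂ := isProductBounded_airyRow₂ (s := s) τ hJ hJR
  have q₁ := (isProductBounded_airyRow₁ (-τ) hJ hJR).const_mul ((cbrtTwo : ℂ) ^ 2)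
  have q₂ := (isProductBounded_airyRow₂ (s := s) (-τ) hJ hJR).const_mul ((cbrtTwo : ℂ) ^ 2)
  refine
    { field_V₀ := hA₀.conj.field
      field_W₀ := hB₀.swap.field
      field_V₁ := hA₁.conj.field
      field_W₁ := hB₁.swap.field
      field_V₂ := hA₂.conj.field
      field_W₂ := hB₂.swap.field
      field_a₁ := r₁.conj.field
      field_b₁ := q₁.field
      field_a₂ := r₂.conj.field
      field_b₂ := q₂.field
      block₀₀ := fun h h' => ?_
      block₁₁ := fun h h' => ?_
      block₂₂ := fun h h' => ?_
      block₁₂ := fun h h' => ?_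
      block₂₁ := fun h h' => ?_
      block₀₁ := fun h h' => ?_
      block₀₂ := fun h h' => ?_
      block₁₀ := fun h h' => ?_
      block₂₀ := fun h h' => ?_ }
  · rw [integral_inner_mul_inner hB₀ hA₀]
    simp only [factorB₀_mul_factorA₀, integral_zero, zero_mul, mul_zero]
  · rw [integral_inner_mul_inner hB₁ hA₁]
    simp only [factorB₁_mul_factorA₁, integral_zero, zero_mul, mul_zero]
  · rw [integral_inner_mul_inner hB₂ hA₂]
    simp only [factorB₂_mul_factorA₂, integral_zero, zero_mul, mul_zero]
  · rw [integral_inner_mul_inner_eq_neg hB₁ hA₂ (block₁₂_eq hw), hBt.inner_eq]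
  · rw [integral_inner_mul_inner_eq_neg hB₂ hA₁ (block₂₁_eq hw), hBo.inner_eq]
  · rw [integral_inner_mul_inner_eq_neg hB₀ hA₁ (block₀₁_eq hw)]
    congr 2
    funext x
    have hm : MemLp (fun u => starRingEnd ℂ (airyRow₁ τ x u)) 2 (volume.restrict (Ioi 0)) :=
      (memLp_airyRow₁ τ x).star
    rw [inner_toL2_left hm]
    simp only [Complex.conj_conj]
  · rw [integral_inner_mul_inner_eq_neg hB₀ hA₂ (block₀₂_eq hw)]
    congr 2
    funext x
    have hm : MemLp (fun u => starRingEnd ℂ (airyRow₂ τ x u)) 2 (volume.restrict (Ici s)) :=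
      (memLp_airyRow₂ τ x).star
    rw [inner_toL2_left hm]
    simp only [Complex.conj_conj]
  · rw [integral_inner_mul_inner_eq_neg hB₁ hA₀ (block₁₀_eq hw)]
    obtain ⟨T, hT⟩ := q₁.swap.exists_hasKernel
    rw [← hT.inner_eq, hT.inner_eq_swap q₁.swap]
  · rw [integral_inner_mul_inner_eq_neg hB₂ hA₀ (block₂₀_eq hw)]
    obtain ⟨T, hT⟩ := q₂.swap.exists_hasKernel
    rw [← hT.inner_eq, hT.inner_eq_swap q₂.swap]

/-! ### The tacnode kernel as a Schur complement -/

theorem memLp_airyAi_mul (τ x : ℝ) :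
    MemLp (fun z => ∫ w in Ioi (0 : ℝ), airyTau τ (-x + cbrtTwo * w) * airyAi (w + z)) 2
      (volume.restrict (Ici s)) := by
  have h := (isProductBounded_airyAi s 0).memLp_integral
    ((memLp_airyTau_mul_Ici τ (-x) 0).mono_measure
      (Measure.restrict_mono_set _ Ioi_subset_Ici_self))
  refine h.ae_eq (Filter.Eventually.of_forall fun z => ?_)
  simp only [mul_comm, add_comm]

theorem memLp_calA (τ x : ℝ) : MemLp (calA τ x) 2 (volume.restrict (Ici s)) :=
  (memLp_airyTau_mul_Ici τ x s).sub (memLp_airyAi_mul τ x)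

/-- `b₂ - Bo b₁` is the function `𝒜^{-τ}`, up to the factor `2^{2/3}`. -/
theorem toL2_sub_airy_eq
    (hBo : HasKernel (volume.restrict (Ici s)) (volume.restrict (Ioi 0))
      (fun z u => airyAi (z + u)) Bo) (y : ℝ) :
    (toL2 (volume.restrict (Ici s)) fun z => (cbrtTwo : ℂ) ^ 2 * airyRow₂ (-τ) y z) -
      Bo (toL2 (volume.restrict (Ioi 0)) fun u => (cbrtTwo : ℂ) ^ 2 * airyRow₁ (-τ) y u) =
      (cbrtTwo : ℂ) ^ 2 • toL2 (volume.restrict (Ici s)) (calA (-τ) (cbrtTwo * y)) := by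
  have m₁ := (memLp_airyRow₁ (-τ) y).const_mul ((cbrtTwo : ℂ) ^ 2)
  have m₂ := (memLp_airyRow₂ (s := s) (-τ) y).const_mul ((cbrtTwo : ℂ) ^ 2)
  have m₃ := memLp_calA (s := s) (-τ) (cbrtTwo * y)
  refine Lp.ext ?_
  filter_upwards [Lp.coeFn_sub (toL2 (volume.restrict (Ici s)) fun z =>
      (cbrtTwo : ℂ) ^ 2 * airyRow₂ (-τ) y z)
      (Bo (toL2 (volume.restrict (Ioi 0)) fun u => (cbrtTwo : ℂ) ^ 2 * airyRow₁ (-τ) y u)),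
    coeFn_toL2 m₂, coeFn_toL2 m₃,
    hBo (toL2 (volume.restrict (Ioi 0)) fun u => (cbrtTwo : ℂ) ^ 2 * airyRow₁ (-τ) y u),
    Lp.coeFn_smul ((cbrtTwo : ℂ) ^ 2) (toL2 (volume.restrict (Ici s)) (calA (-τ) (cbrtTwo * y)))]
    with z e1 e2 e3 e4 e5
  rw [e1, e5, Pi.sub_apply, Pi.smul_apply, e2, e3, e4.2, smul_eq_mul, calA, mul_sub,
    ← integral_const_mul]
  congr 1
  refine integral_congr_ae ?_
  filter_upwards [coeFn_toL2 m₁] with u hu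
  rw [hu, airyRow₁, add_comm u z]
  ring

/-- The row `a₂ - a₁ Bt` is the function `𝒜^τ`. -/
theorem inner_airyRow_eq
    (hBt : HasKernel (volume.restrict (Ioi 0)) (volume.restrict (Ici s))
      (fun u z => airyAi (z + u)) Bt) (x : ℝ) (v : Lp ℂ 2 (volume.restrict (Ici s))) :
    ⟪toL2 (volume.restrict (Ici s)) fun z => starRingEnd ℂ (airyRow₂ τ x z), v⟫_ℂ -
      ⟪toL2 (volume.restrict (Ioi 0)) fun u => starRingEnd ℂ (airyRow₁ τ x u), Bt v⟫_ℂ =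
      ∫ z in Ici s, calA τ (cbrtTwo * x) z * v z := by
  have m₁ : MemLp (fun u => starRingEnd ℂ (airyRow₁ τ x u)) 2 (volume.restrict (Ioi 0)) :=
    (memLp_airyRow₁ τ x).star
  have m₂ : MemLp (fun u => starRingEnd ℂ (airyRow₂ τ x u)) 2 (volume.restrict (Ici s)) :=
    (memLp_airyRow₂ τ x).star
  have hi := (isProductBounded_airyAi s 0).swap.integrable_mul (memLp_airyRow₁ τ x) (Lp.memLp v)
  have e1 : ⟪toL2 (volume.restrict (Ioi 0)) fun u => starRingEnd ℂ (airyRow₁ τ x u), Bt v⟫_ℂ =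
      ∫ z in Ici s, (∫ w in Ioi (0 : ℝ), airyTau τ (-(cbrtTwo * x) + cbrtTwo * w) *
        airyAi (w + z)) * v z := by
    calc _ = ∫ u in Ioi (0 : ℝ), ∫ z in Ici s, airyRow₁ τ x u * (airyAi (z + u) * v z) := by
          rw [inner_toL2_left m₁]
          refine integral_congr_ae ?_
          filter_upwards [hBt v] with u hu
          rw [hu.2, integral_const_mul, Complex.conj_conj]
      _ = _ := integral_integral_swap hi
      _ = _ := by
          refine integral_congr_ae (Filter.Eventually.of_forall fun z => ?_)
          simp only
          rw [← integral_mul_const]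
          refine integral_congr_ae (Filter.Eventually.of_forall fun u => ?_)
          simp only [airyRow₁, add_comm u z]
          ring
  rw [e1, inner_toL2_left m₂, ← integral_sub]
  · refine integral_congr_ae (Filter.Eventually.of_forall fun z => ?_)
    simp only [Complex.conj_conj, airyRow₂, calA]
    ring
  · simp only [Complex.conj_conj]
    exact (memLp_airyRow₂ τ x).integrable_mul (Lp.memLp v)
  · exact (memLp_airyAi_mul τ (cbrtTwo * x)).integrable_mul (Lp.memLp v)

/-- The product `a₁ b₁` is the Airy-type kernel `K_Ai^{(τ, -τ)}`, the part of the tacnode kernel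
without a resolvent. -/
theorem inner_airyRow₁_eq (x y : ℝ) :
    ⟪toL2 (volume.restrict (Ioi 0)) fun u => starRingEnd ℂ (airyRow₁ τ x u),
      toL2 (volume.restrict (Ioi 0)) fun u => (cbrtTwo : ℂ) ^ 2 * airyRow₁ (-τ) y u⟫_ℂ =
      cbrtTwo * airyKernelTau τ (-(cbrtTwo * x)) (-(cbrtTwo * y)) := by
  have hc := cbrtTwo_pos
  have hc' : (cbrtTwo : ℂ) ≠ 0 := by exact_mod_cast hc.ne'
  have m₁ : MemLp (fun u => starRingEnd ℂ (airyRow₁ τ x u)) 2 (volume.restrict (Ioi 0)) :=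
    (memLp_airyRow₁ τ x).star
  have m₂ := (memLp_airyRow₁ (-τ) y).const_mul ((cbrtTwo : ℂ) ^ 2)
  have h := integral_comp_mul_left_Ioi (fun u => airyTau τ (-(cbrtTwo * x) + u) *
    airyTau (-τ) (-(cbrtTwo * y) + u)) 0 hc
  rw [mul_zero, Complex.real_smul] at h
  rw [inner_toL2_left m₁, airyKernelTau]
  have e : ∫ u in Ioi (0 : ℝ), starRingEnd ℂ (starRingEnd ℂ (airyRow₁ τ x u)) *
      (toL2 (volume.restrict (Ioi 0)) fun u => (cbrtTwo : ℂ) ^ 2 * airyRow₁ (-τ) y u) u =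
      (cbrtTwo : ℂ) ^ 2 * ∫ u in Ioi (0 : ℝ), airyTau τ (-(cbrtTwo * x) + cbrtTwo * u) *
        airyTau (-τ) (-(cbrtTwo * y) + cbrtTwo * u) := by
    rw [← integral_const_mul]
    refine integral_congr_ae ?_
    filter_upwards [coeFn_toL2 m₂] with u hu
    rw [hu, Complex.conj_conj, airyRow₁, airyRow₁]
    ring
  rw [e, h]
  push_cast
  field_simp

/-- The operator `Bo Bt` is symmetric for the bilinear form `∫ f g`, hence so is its resolvent. -/
theorem integral_resolvent_mul_comm
    (hBo : HasKernel (volume.restrict (Ici s)) (volume.restrict (Ioi 0))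
      (fun z u => airyAi (z + u)) Bo)
    (hBt : HasKernel (volume.restrict (Ioi 0)) (volume.restrict (Ici s))
      (fun u z => airyAi (z + u)) Bt)
    {R : Lp ℂ 2 (volume.restrict (Ici s)) →L[ℂ] Lp ℂ 2 (volume.restrict (Ici s))}
    (hR : ∀ v, R v - Bo (Bt (R v)) = v) (f g : Lp ℂ 2 (volume.restrict (Ici s))) :
    ∫ z in Ici s, R f z * g z = ∫ z in Ici s, f z * R g z := by
  have hb := isProductBounded_airyAi s 0
  have hi : ∀ p q : Lp ℂ 2 (volume.restrict (Ici s)),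
      Integrable (fun z => p z * q z) (volume.restrict (Ici s)) := fun p q =>
    (Lp.memLp p).integrable_mul (Lp.memLp q)
  have hsym : ∫ z in Ici s, Bo (Bt (R f)) z * R g z = ∫ z in Ici s, R f z * Bo (Bt (R g)) z := by
    rw [hBo.integral_mul_eq hBt hb, hBt.integral_mul_eq hBo hb.swap]
  have e1 : ∫ z in Ici s, R f z * g z =
      (∫ z in Ici s, R f z * R g z) - ∫ z in Ici s, R f z * Bo (Bt (R g)) z := by
    rw [← integral_sub (hi _ _) (hi _ _)]
    refine integral_congr_ae ?_
    have := Lp.coeFn_sub (R g) (Bo (Bt (R g)))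
    rw [hR g] at this
    filter_upwards [this] with z hz
    rw [hz, Pi.sub_apply, mul_sub]
  have e2 : ∫ z in Ici s, f z * R g z =
      (∫ z in Ici s, R f z * R g z) - ∫ z in Ici s, Bo (Bt (R f)) z * R g z := by
    rw [← integral_sub (hi _ _) (hi _ _)]
    refine integral_congr_ae ?_
    have := Lp.coeFn_sub (R f) (Bo (Bt (R f)))
    rw [hR f] at this
    filter_upwards [this] with z hz
    rw [hz, Pi.sub_apply, sub_mul]
  rw [e1, e2, hsym]

/-- The rescaled tacnode kernel in terms of the rows and columns of the block operator. -/
theorem tacnodeKernelRescaled_eq {σ : ℝ} (hs : s = sigmaTilde σ)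
    (hBo : HasKernel (volume.restrict (Ici s)) (volume.restrict (Ioi 0))
      (fun z u => airyAi (z + u)) Bo)
    (hBt : HasKernel (volume.restrict (Ioi 0)) (volume.restrict (Ici s))
      (fun u z => airyAi (z + u)) Bt)
    (hR : ∀ v, Ring.inverse (1 - airyOperator s) v -
      Bo (Bt (Ring.inverse (1 - airyOperator s) v)) = v) (x y : ℝ) :
    ⟪toL2 (volume.restrict (Ici s)) fun z => starRingEnd ℂ (airyRow₂ τ x z),
      Ring.inverse (1 - airyOperator s)
        ((toL2 (volume.restrict (Ici s)) fun z => (cbrtTwo : ℂ) ^ 2 * airyRow₂ (-τ) y z) -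
        Bo (toL2 (volume.restrict (Ioi 0)) fun u => (cbrtTwo : ℂ) ^ 2 * airyRow₁ (-τ) y u))⟫_ℂ +
    ⟪toL2 (volume.restrict (Ioi 0)) fun u => starRingEnd ℂ (airyRow₁ τ x u),
      (toL2 (volume.restrict (Ioi 0)) fun u => (cbrtTwo : ℂ) ^ 2 * airyRow₁ (-τ) y u) -
      Bt (Ring.inverse (1 - airyOperator s)
        ((toL2 (volume.restrict (Ici s)) fun z => (cbrtTwo : ℂ) ^ 2 * airyRow₂ (-τ) y z) -
        Bo (toL2 (volume.restrict (Ioi 0)) fun u => (cbrtTwo : ℂ) ^ 2 * airyRow₁ (-τ) y u)))⟫_ℂ =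
      tacnodeKernelRescaled τ σ x y := by
  subst hs
  set v := Ring.inverse (1 - airyOperator (sigmaTilde σ))
    ((toL2 (volume.restrict (Ici (sigmaTilde σ))) fun z => (cbrtTwo : ℂ) ^ 2 * airyRow₂ (-τ) y z) -
    Bo (toL2 (volume.restrict (Ioi 0)) fun u => (cbrtTwo : ℂ) ^ 2 * airyRow₁ (-τ) y u)) with hv
  rw [inner_sub_right, inner_airyRow₁_eq]
  have e1 := inner_airyRow_eq (τ := τ) hBt x v
  have e2 : v = (cbrtTwo : ℂ) ^ 2 • Ring.inverse (1 - airyOperator (sigmaTilde σ))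
      (toL2 (volume.restrict (Ici (sigmaTilde σ))) (calA (-τ) (cbrtTwo * y))) := by
    rw [hv, toL2_sub_airy_eq hBo, map_smul]
  have e3 : ∫ z in Ici (sigmaTilde σ), calA τ (cbrtTwo * x) z * v z = (cbrtTwo : ℂ) ^ 2 *
      ∫ z in Ici (sigmaTilde σ), Ring.inverse (1 - airyOperator (sigmaTilde σ))
        (toL2 (volume.restrict (Ici (sigmaTilde σ))) (calA τ (cbrtTwo * x))) z *
          calA (-τ) (cbrtTwo * y) z := by
    have m₁ := coeFn_toL2 (memLp_calA (s := sigmaTilde σ) τ (cbrtTwo * x))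
    have m₂ := coeFn_toL2 (memLp_calA (s := sigmaTilde σ) (-τ) (cbrtTwo * y))
    calc _ = (cbrtTwo : ℂ) ^ 2 * ∫ z in Ici (sigmaTilde σ),
          toL2 (volume.restrict (Ici (sigmaTilde σ))) (calA τ (cbrtTwo * x)) z *
          Ring.inverse (1 - airyOperator (sigmaTilde σ))
            (toL2 (volume.restrict (Ici (sigmaTilde σ))) (calA (-τ) (cbrtTwo * y))) z := by
          rw [← integral_const_mul]
          refine integral_congr_ae ?_
          have h := Lp.coeFn_smul ((cbrtTwo : ℂ) ^ 2)
            (Ring.inverse (1 - airyOperator (sigmaTilde σ))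
              (toL2 (volume.restrict (Ici (sigmaTilde σ))) (calA (-τ) (cbrtTwo * y))))
          rw [← e2] at h
          filter_upwards [m₁, h] with z h1 h2
          rw [h1, h2, Pi.smul_apply, smul_eq_mul]
          ring
      _ = _ := by
          rw [← integral_resolvent_mul_comm hBo hBt hR]
          congr 1
          refine integral_congr_ae ?_
          filter_upwards [m₂] with z h2
          rw [h2]
  rw [tacnodeKernelRescaled, tacnodeKernel]
  simp only [add_sub_cancel_left, sub_add_cancel_left]
  rw [e3] at e1
  linear_combination e1

/-! ### The Tracy--Widom distribution as a determinant of a matrix -/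

theorem inner_airyAi_eq (z w : ℝ) :
    ⟪toL2 (volume.restrict (Ioi 0)) fun u => starRingEnd ℂ (airyAi (z + u)),
      toL2 (volume.restrict (Ioi 0)) fun u => airyAi (w + u)⟫_ℂ = airyKernel z w := by
  have m : ∀ z, MemLp (fun u => airyAi (z + u)) 2 (volume.restrict (Ioi 0)) := fun z => by
    have := (memLp_airyTau_add 0 0 z).mono_measure
      (Measure.restrict_mono_set volume (Ioi_subset_Ici_self (a := (0 : ℝ))))
    simpa only [airyAi, add_comm] using this
  have m' : MemLp (fun u => starRingEnd ℂ (airyAi (z + u))) 2 (volume.restrict (Ioi 0)) :=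
    (m z).star
  rw [inner_toL2_left m', airyKernel]
  refine integral_congr_ae ?_
  filter_upwards [coeFn_toL2 (m w)] with u hu
  rw [hu, Complex.conj_conj]

/-- The Fredholm series of the Airy kernel converges, and its sum is the determinant of the matrix
of `Bt Bo`. -/
theorem tracyWidomF2_eq
    (hBo : HasKernel (volume.restrict (Ici s)) (volume.restrict (Ioi 0))
      (fun z u => airyAi (z + u)) Bo)
    (hBt : HasKernel (volume.restrict (Ioi 0)) (volume.restrict (Ici s))
      (fun u z => airyAi (z + u)) Bt) {κ : Type} [Countable κ] [MeasurableSpace κ]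
    [DiscreteMeasurableSpace κ] (e : HilbertBasis κ ℂ (Lp ℂ 2 (volume.restrict (Ioi (0 : ℝ))))) :
    FredholmConverges (volume.restrict (Ici s)) airyKernel ∧
    tracyWidomF2 s = fredholmDet Measure.count fun k l => ⟪e k, Bt (Bo (e l))⟫_ℂ := by
  have hb := isProductBounded_airyAi s 0
  have hker : airyKernel = fun z w => ∑' k,
      ⟪toL2 (volume.restrict (Ioi 0)) fun u => starRingEnd ℂ (airyAi (z + u)), e k⟫_ℂ *
      ⟪e k, toL2 (volume.restrict (Ioi 0)) fun u => airyAi (w + u)⟫_ℂ := by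
    funext z w
    rw [e.tsum_inner_mul_inner, inner_airyAi_eq]
  have fA := hb.conj.field.ellTwo_left e
  have fB := hb.field.ellTwo_right e
  refine ⟨by rw [hker]; exact fredholmConverges_tsum fA fB, ?_⟩
  rw [tracyWidomF2, hker, fredholmDet_tsum fA fB]
  congr 1
  funext k l
  rw [integral_inner_mul_inner hb.swap hb]
  exact ((hBt.comp hBo hb.swap hb).inner_eq (e k) (e l)).symm

end Blocks

/-! ### Changes of variables in Fredholm determinants -/

section ChangeOfVariables

theorem Measure.pi_nnreal_smul {X : Type} [MeasurableSpace X] (μ : Measure X) [SigmaFinite μ]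
    (c : NNReal) (n : ℕ) :
    Measure.pi (fun _ : Fin n => c • μ) = c ^ n • Measure.pi fun _ : Fin n => μ := by
  refine Measure.pi_eq fun s _ => ?_
  simp only [Measure.smul_apply, Measure.pi_pi, ENNReal.smul_def, smul_eq_mul]
  rw [Finset.prod_mul_distrib, Finset.prod_const, Finset.card_univ, Fintype.card_fin,
    ENNReal.coe_pow]

theorem det_kernel_const_mul {X : Type} (c : ℂ) (K : X → X → ℂ) {n : ℕ} (x : Fin n → X) :
    Matrix.det (Matrix.of fun i j => c * K (x i) (x j)) =
      c ^ n * Matrix.det (Matrix.of fun i j => K (x i) (x j)) := by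
  have h : (Matrix.of fun i j => c * K (x i) (x j)) = c • Matrix.of fun i j => K (x i) (x j) := by
    ext i j
    simp
  rw [h, Matrix.det_smul, Fintype.card_fin]

variable {X Y : Type} [MeasurableSpace X] [MeasurableSpace Y] {μ : Measure X} [SigmaFinite μ]
  {ν : Measure Y} [SigmaFinite ν] {c : NNReal} {φ : X ≃ᵐ Y}

theorem measurePreserving_pi_map (hφ : MeasurePreserving φ (c • μ) ν) (n : ℕ) :
    MeasurePreserving (fun (x : Fin n → X) i => φ (x i)) (c ^ n • Measure.pi fun _ => μ)
      (Measure.pi fun _ => ν) := by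
  rw [← Measure.pi_nnreal_smul]
  exact measurePreserving_pi _ _ fun _ => hφ

theorem measurableEmbedding_pi_map (φ : X ≃ᵐ Y) (n : ℕ) :
    MeasurableEmbedding fun (x : Fin n → X) i => φ (x i) :=
  (MeasurableEquiv.piCongrRight fun _ : Fin n => φ).measurableEmbedding

/-- Change of variables in the terms of the Fredholm series: the Jacobian factor `c` of the map
becomes a factor of the kernel. -/
theorem fredholmTerm_comp (hφ : MeasurePreserving φ (c • μ) ν) (K : Y → Y → ℂ) (n : ℕ) :
    fredholmTerm μ (fun x y => ((c : ℝ) : ℂ) * K (φ x) (φ y)) n = fredholmTerm ν K n := by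
  rw [fredholmTerm, fredholmTerm,
    ← (measurePreserving_pi_map hφ n).integral_comp (measurableEmbedding_pi_map φ n),
    integral_smul_nnreal_measure]
  congr 1
  simp only [det_kernel_const_mul ((c : ℝ) : ℂ) fun x y => K (φ x) (φ y)]
  rw [integral_const_mul, NNReal.smul_def, NNReal.coe_pow, Complex.real_smul, Complex.ofReal_pow]

theorem fredholmConverges_of_comp (hφ : MeasurePreserving φ (c • μ) ν) (hc : c ≠ 0)
    {K : Y → Y → ℂ} (h : FredholmConverges μ fun x y => ((c : ℝ) : ℂ) * K (φ x) (φ y)) :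
    FredholmConverges ν K := by
  refine ⟨fun n => ?_, (funext (fredholmTerm_comp hφ K) : _ = fredholmTerm ν K) ▸ h.2⟩
  rw [← (measurePreserving_pi_map hφ n).integrable_comp_emb (measurableEmbedding_pi_map φ n)]
  have hc' : ((c : ℝ) : ℂ) ≠ 0 := by exact_mod_cast hc
  have h1 := ((h.1 n).const_mul (((c : ℝ) : ℂ) ^ n)⁻¹).smul_measure_nnreal (c := c ^ n)
  refine h1.congr (Filter.Eventually.of_forall fun x => ?_)
  simp only [det_kernel_const_mul ((c : ℝ) : ℂ) fun x y => K (φ x) (φ y), Function.comp_def]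
  rw [inv_mul_cancel_left₀ (pow_ne_zero n hc')]

end ChangeOfVariables

/-! ### Unions of intervals -/

section Intervals

variable {K : ℕ} {a : ℕ → ℝ}

theorem measurableSet_intervalUnion : MeasurableSet (intervalUnion K a) :=
  Finset.measurableSet_biUnion _ fun _ _ => measurableSet_Icc

theorem exists_intervalUnion_subset (K : ℕ) (a : ℕ → ℝ) :
    ∃ R, 0 ≤ R ∧ intervalUnion K a ⊆ Icc (-R) R := by
  have h : Bornology.IsBounded (intervalUnion K a) :=
    (Bornology.isBounded_biUnion_finset _).mpr fun _ _ => Metric.isBounded_Icc _ _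
  obtain ⟨R, hR⟩ := h.exists_norm_le
  refine ⟨|R|, abs_nonneg R, fun x hx => abs_le.mp ((hR x hx).trans (le_abs_self R))⟩

theorem intervalUnion_succ (K : ℕ) (a : ℕ → ℝ) :
    intervalUnion (K + 1) a = intervalUnion K a ∪ Icc (a (2 * K + 1)) (a (2 * K + 2)) := by
  rw [intervalUnion, ← Finset.insert_Icc_right_eq_Icc_add_one (by omega), Finset.set_biUnion_insert,
    union_comm]
  rfl

/-- This is where the alternating sums over the endpoints in the kernels of `𝕄` come from. -/
theorem integral_exp_intervalUnion (ha : StrictMonoOn a (Icc 1 (2 * K))) {w : ℂ} (hw : w ≠ 0) :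
    ∫ x in intervalUnion K a, Complex.exp (w * x) =
      (∑ j ∈ Finset.Icc 1 (2 * K), (-1) ^ j * Complex.exp (w * a j)) / w := by
  induction K with
  | zero => simp [intervalUnion]
  | succ K ih =>
    have hlt : ∀ i j, 1 ≤ i → i < j → j ≤ 2 * (K + 1) → a i < a j := fun i j h1 h2 h3 =>
      ha ⟨h1, h2.le.trans h3⟩ ⟨h1.trans h2.le, h3⟩ h2
    have hd : Disjoint (intervalUnion K a) (Icc (a (2 * K + 1)) (a (2 * K + 2))) := by
      refine disjoint_left.mpr fun x hx hx' => ?_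
      simp only [intervalUnion, mem_iUnion, Finset.mem_Icc] at hx
      obtain ⟨k, ⟨h1, h2⟩, _, h3⟩ := hx
      have := hlt (2 * k) (2 * K + 1) (by omega) (by omega) (by omega)
      linarith [hx'.1]
    have hcont : Continuous fun x : ℝ => Complex.exp (w * x) := by fun_prop
    obtain ⟨R, _, hR⟩ := exists_intervalUnion_subset K a
    have hi : ∀ u v : ℝ, IntegrableOn (fun x : ℝ => Complex.exp (w * x)) (Icc u v) := fun u v =>
      hcont.integrableOn_Icc
    have hle := hlt (2 * K + 1) (2 * K + 2) (by omega) (by omega) (by omega)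
    rw [intervalUnion_succ, setIntegral_union hd measurableSet_Icc ((hi _ _).mono_set hR) (hi _ _),
      ih (ha.mono (Icc_subset_Icc_right (by omega))), integral_Icc_eq_integral_Ioc,
      ← intervalIntegral.integral_of_le hle.le, integral_exp_mul_complex hw,
      show 2 * (K + 1) = 2 * K + 1 + 1 by ring, Finset.sum_Icc_succ_top (by omega),
      Finset.sum_Icc_succ_top (by omega)]
    have e1 : (-1 : ℂ) ^ (2 * K + 1) = -1 := by rw [pow_succ, pow_mul]; simp
    have e2 : (-1 : ℂ) ^ (2 * K + 1 + 1) = 1 := by rw [pow_succ, e1]; simp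
    rw [e1, e2]
    field_simp
    ring

/-- The affine map `x ↦ σ + 2^{1/3} x`. -/
def rescaling (σ : ℝ) : ℝ ≃ᵐ ℝ :=
  (MeasurableEquiv.mulLeft₀ cbrtTwo cbrtTwo_pos.ne').trans (MeasurableEquiv.addLeft σ)

theorem rescaling_apply (σ x : ℝ) : rescaling σ x = σ + cbrtTwo * x := rfl

theorem preimage_rescaling_intervalUnion (σ : ℝ) (K : ℕ) (a : ℕ → ℝ) :
    rescaling σ ⁻¹' intervalUnion K a = intervalUnion K (rescaledEndpoint σ a) := by
  ext x
  simp only [intervalUnion, mem_preimage, mem_iUnion, mem_Icc, rescaling_apply, rescaledEndpoint,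
    div_le_iff₀ cbrtTwo_pos, le_div_iff₀ cbrtTwo_pos, sub_le_iff_le_add', le_sub_iff_add_le',
    mul_comm x]

/-- The map `x ↦ σ + 2^{1/3} x` carries `2^{1/3} dx` on `Ĩ` to `dx` on `I`. -/
theorem measurePreserving_rescaling (σ : ℝ) (K : ℕ) (a : ℕ → ℝ) :
    MeasurePreserving (rescaling σ)
      (cbrtTwo.toNNReal • volume.restrict (intervalUnion K (rescaledEndpoint σ a)))
      (volume.restrict (intervalUnion K a)) := by
  have h : MeasurePreserving (rescaling σ) (cbrtTwo.toNNReal • volume) volume := by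
    refine ⟨(rescaling σ).measurable, ?_⟩
    have hc := cbrtTwo_pos
    have e : (rescaling σ : ℝ → ℝ) = (fun x => σ + x) ∘ fun x => cbrtTwo * x := rfl
    rw [e, ← Measure.map_map (by fun_prop) (by fun_prop), Measure.map_smul]
    have h1 := Real.smul_map_volume_mul_left hc.ne'
    rw [abs_of_pos hc] at h1
    have h2 : cbrtTwo.toNNReal • Measure.map (fun x => cbrtTwo * x) volume = volume := h1
    rw [h2]
    exact (measurePreserving_add_left volume σ).map_eq
  have h' := h.restrict_preimage (measurableSet_intervalUnion (K := K) (a := a))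
  rwa [preimage_rescaling_intervalUnion, Measure.restrict_smul] at h'

end Intervals

/-! ### The kernel of the contour operator -/

section ContourKernel

variable {γ : ℝ → ℂ} {τ s : ℝ} {K : ℕ} {b : ℕ → ℝ}

theorem integral_legExp_mul_legExp (γ : ℝ → ℂ) (d d' : Fin 4 → ℂ)
    {κ θ e y₀ κ' θ' e' y₀' : Fin 4 → ℝ} (J : Set ℝ) (p q : Fin 4 × ℝ) (D : ℂ) :
    ∫ y in J, legExp γ d κ θ e y₀ p y * (legExp γ d' κ' θ' e' y₀' q y * D) =
      legExp γ d κ θ e y₀ p 0 * (legExp γ d' κ' θ' e' y₀' q 0 * D) *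
        ∫ y in J, Complex.exp (-(e p.1 * γ p.2 + e' q.1 * γ q.2) * (y : ℝ)) := by
  have h : ∀ (d : Fin 4 → ℂ) (κ θ e y₀ : Fin 4 → ℝ) p y, legExp γ d κ θ e y₀ p y =
      legExp γ d κ θ e y₀ p 0 * Complex.exp (-(e p.1 * γ p.2) * (y : ℝ)) := fun d κ θ e y₀ p y => by
    rw [legExp, legExp, mul_assoc, ← Complex.exp_add]
    congr 2
    push_cast
    ring
  rw [← integral_const_mul]
  refine integral_congr_ae (Filter.Eventually.of_forall fun y => ?_)
  simp only
  rw [h d κ θ e y₀ p y, h d' κ' θ' e' y₀' q y, neg_add, add_mul, Complex.exp_add]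
  ring

theorem integral_exp_neg_mul_Ioi {w : ℂ} (hw : 0 < w.re) (c : ℝ) :
    ∫ y in Ioi c, Complex.exp (-w * (y : ℝ)) = Complex.exp (-(w * c)) / w := by
  rw [integral_exp_mul_complex_Ioi (by simpa using hw), neg_div_neg_eq, neg_mul]

theorem integral_exp_neg_mul_Ici {w : ℂ} (hw : 0 < w.re) (c : ℝ) :
    ∫ y in Ici c, Complex.exp (-w * (y : ℝ)) = Complex.exp (-(w * c)) / w := by
  rw [integral_Ici_eq_integral_Ioi, integral_exp_neg_mul_Ioi hw]

/-- The alternating sums of products `h_j⁻¹ h_j`, `h_j⁻¹ g_j`, … are exponentials times the boundary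
terms of `∫ e^{(l - m) x} dx` over the union of intervals. -/
theorem sum_neg_one_pow_mul_inv_mul (S : Finset ℕ) (b : ℕ → ℝ) (P Q l m : ℂ) :
    ∑ j ∈ S, (-1) ^ j * (Complex.exp (P - b j * l) / (cbrtTwo : ℂ))⁻¹ *
        (Complex.exp (Q - b j * m) / (cbrtTwo : ℂ)) =
      Complex.exp (Q - P) * ∑ j ∈ S, (-1) ^ j * Complex.exp ((l - m) * b j) := by
  have hc : (cbrtTwo : ℂ) ≠ 0 := by exact_mod_cast cbrtTwo_pos.ne'
  rw [Finset.mul_sum]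
  refine Finset.sum_congr rfl fun j _ => ?_
  rw [inv_div, div_eq_mul_inv, ← Complex.exp_neg]
  have : Complex.exp (Q - P) * Complex.exp ((l - m) * b j) =
      Complex.exp (-(P - b j * l)) * Complex.exp (Q - b j * m) := by
    rw [← Complex.exp_add, ← Complex.exp_add]
    congr 1
    ring
  rw [mul_left_comm (Complex.exp _), this]
  field_simp

theorem hFun_eq (j : ℕ) (ζ : ℂ) : hFun τ s b j ζ =
    Complex.exp ((ζ ^ 3 / 12 + (τ / (2 : ℝ) ^ ((2 : ℝ) / 3) : ℝ) * ζ ^ 2 - s * ζ) - b j * ζ) /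
      (cbrtTwo : ℂ) := by
  rw [hFun]
  congr 2
  push_cast
  ring

theorem gFun_eq (j : ℕ) (ζ : ℂ) : gFun τ b j ζ =
    Complex.exp ((-ζ ^ 3 / 12 + (τ / (2 : ℝ) ^ ((2 : ℝ) / 3) : ℝ) * ζ ^ 2) - b j * ζ) /
      (cbrtTwo : ℂ) := rfl

theorem kernelHH_eq (m l : ℂ) : kernelHH τ s K b m l =
    -(Complex.exp ((l ^ 3 / 12 + (τ / (2 : ℝ) ^ ((2 : ℝ) / 3) : ℝ) * l ^ 2 - s * l) -
      (m ^ 3 / 12 + (τ / (2 : ℝ) ^ ((2 : ℝ) / 3) : ℝ) * m ^ 2 - s * m)) *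
      ∑ j ∈ Finset.Icc 1 (2 * K), (-1) ^ j * Complex.exp ((m - l) * b j)) /
      (2 * Real.pi * Complex.I * (m - l)) := by
  rw [kernelHH, ← sum_neg_one_pow_mul_inv_mul, ← Finset.sum_neg_distrib]
  simp only [hFun_eq, pow_succ, mul_neg, mul_one, neg_mul]

theorem kernelHA_eq (m₁ m₂ : ℂ) : kernelHA τ s K b m₁ m₂ =
    -(Complex.exp ((-m₂ ^ 3 / 12 + (τ / (2 : ℝ) ^ ((2 : ℝ) / 3) : ℝ) * m₂ ^ 2) -
      (m₁ ^ 3 / 12 + (τ / (2 : ℝ) ^ ((2 : ℝ) / 3) : ℝ) * m₁ ^ 2 - s * m₁)) *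
      ∑ j ∈ Finset.Icc 1 (2 * K), (-1) ^ j * Complex.exp ((m₁ - m₂) * b j)) /
      (2 * Real.pi * Complex.I * (m₁ - m₂)) := by
  rw [kernelHA, ← sum_neg_one_pow_mul_inv_mul, ← Finset.sum_neg_distrib]
  simp only [hFun_eq, gFun_eq, pow_succ, mul_neg, mul_one, neg_mul]

theorem kernelBH_eq (l₂ l₁ : ℂ) : kernelBH τ s K b l₂ l₁ =
    (Complex.exp ((l₁ ^ 3 / 12 + (τ / (2 : ℝ) ^ ((2 : ℝ) / 3) : ℝ) * l₁ ^ 2 - s * l₁) -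
      (-l₂ ^ 3 / 12 + (τ / (2 : ℝ) ^ ((2 : ℝ) / 3) : ℝ) * l₂ ^ 2)) *
      ∑ j ∈ Finset.Icc 1 (2 * K), (-1) ^ j * Complex.exp ((l₂ - l₁) * b j)) /
      (2 * Real.pi * Complex.I * (l₂ - l₁)) := by
  rw [kernelBH, ← sum_neg_one_pow_mul_inv_mul]
  simp only [hFun_eq, gFun_eq]

theorem kernelBABA_eq (l m : ℂ) : kernelBABA τ s K b l m =
    Complex.exp ((l ^ 3 - m ^ 3) / 4 + (m - l) * s) / (2 * Real.pi * Complex.I * (l - m)) +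
    (Complex.exp ((-m ^ 3 / 12 + (τ / (2 : ℝ) ^ ((2 : ℝ) / 3) : ℝ) * m ^ 2) -
      (-l ^ 3 / 12 + (τ / (2 : ℝ) ^ ((2 : ℝ) / 3) : ℝ) * l ^ 2)) *
      ∑ j ∈ Finset.Icc 1 (2 * K), (-1) ^ j * Complex.exp ((l - m) * b j)) /
      (2 * Real.pi * Complex.I * (l - m)) := by
  rw [kernelBABA, ← sum_neg_one_pow_mul_inv_mul]
  simp only [gFun_eq]

/-- The kernel of `𝕄` as a sum of compositions. Points on different contours with the same parameter
are excluded: there the denominator `ξ - ζ` may vanish, and the quotient has the junk value `0`,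
while the integral over the union of intervals is the limit at the removable singularity. -/
theorem kernelM_eq (hγ : IsAiryContour γ) (hb : StrictMonoOn b (Icc 1 (2 * K)))
    {p q : Fin 4 × ℝ} (hpq : p.1 = q.1 ∨ p.2 ≠ q.2) :
    kernelM τ s K b γ p q =
      (∫ x in intervalUnion K b, factorA₀ τ s γ p x * factorB₀ τ s γ x q) +
      ((∫ z in Ici s, factorA₂ s γ p z * factorB₂ s γ z q) +
        ∫ u in Ioi (0 : ℝ), factorA₁ γ p u * factorB₁ γ u q) := by
  have hc : (cbrtTwo : ℂ) ≠ 0 := by exact_mod_cast cbrtTwo_pos.ne'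
  have h2 := two_pi_I_ne_zero
  obtain ⟨i, t⟩ := p
  obtain ⟨j, t'⟩ := q
  simp only [factorA₀, factorB₀, factorA₁, factorB₁, factorA₂, factorB₂,
    integral_legExp_mul_legExp]
  have ha := hγ.re_pos t
  have ha' := hγ.re_pos t'
  have hadd : 0 < (γ t + γ t').re := by rw [Complex.add_re]; linarith
  have hadd0 : γ t + γ t' ≠ 0 := fun h => by rw [h] at hadd; simp at hadd
  have hw₀ : γ t ≠ γ t' → ∀ w, (w = γ t - γ t' ∨ w = γ t' - γ t) → w ≠ 0 := fun h w hw => by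
    rcases hw with rfl | rfl
    · exact sub_ne_zero.mpr h
    · exact sub_ne_zero.mpr h.symm
  have hne : -γ t - γ t' ≠ 0 := fun h => hadd0 (by linear_combination -h)
  have hne' : γ t - -γ t' ≠ 0 := fun h => hadd0 (by linear_combination h)
  have hD : deriv (-γ) t' = -deriv γ t' := deriv.neg
  generalize hP : (2 * Real.pi * Complex.I : ℂ) = P at *
  have hz : ∀ A B C : ℂ, A = B + C → Complex.exp A = Complex.exp B * Complex.exp C :=
    fun A B C h => by rw [h, Complex.exp_add]
  fin_cases i <;> fin_cases j <;> simp [kernelM, blockM, leg, legExp, hD, -mul_inv_rev]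
  · rw [kernelHH_eq, show -γ t' + -γ t = -γ t - γ t' by ring,
      integral_exp_intervalUnion hb hne, hP, Complex.ofReal_div]
    generalize ∑ j ∈ Finset.Icc 1 (2 * K), (-1) ^ j * Complex.exp ((-γ t - γ t') * b j) = S
    rw [hz _ (12⁻¹ * γ t ^ 3 + -(τ / ((2 : ℝ) ^ ((2 : ℝ) / 3) : ℝ) * γ t ^ 2) - s * γ t)
      (12⁻¹ * γ t' ^ 3 + τ / ((2 : ℝ) ^ ((2 : ℝ) / 3) : ℝ) * γ t' ^ 2 - s * γ t') (by ring)]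
    field_simp
  · have hne : -γ t - -γ t' ≠ 0 := hw₀ (fun h => hpq.elim (by simp) fun h' => h' (hγ.injective h)) _
      (Or.inr (by ring))
    rw [kernelHA_eq, show γ t' + -γ t = -γ t - -γ t' by ring,
      integral_exp_intervalUnion hb hne, hP, Complex.ofReal_div]
    generalize ∑ j ∈ Finset.Icc 1 (2 * K), (-1) ^ j * Complex.exp ((-γ t - -γ t') * b j) = S
    rw [hz _ (12⁻¹ * γ t ^ 3 + -(τ / ((2 : ℝ) ^ ((2 : ℝ) / 3) : ℝ) * γ t ^ 2) - s * γ t)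
      (12⁻¹ * γ t' ^ 3 + τ / ((2 : ℝ) ^ ((2 : ℝ) / 3) : ℝ) * γ t' ^ 2) (by ring)]
    field_simp
  · rw [kernelQRQL, show -γ t' + -γ t = -(γ t + γ t') by ring, integral_exp_neg_mul_Ici hadd, hP,
      hz _ (12⁻¹ * γ t ^ 3 + s * γ t + (12⁻¹ * γ t' ^ 3 + s * γ t'))
        (-((γ t + γ t') * s)) (by ring),
      hz _ (12⁻¹ * γ t ^ 3 + s * γ t) (12⁻¹ * γ t' ^ 3 + s * γ t') rfl]
    field_simp
    ring
  · rw [kernelQRA, show -γ t' + -γ t = -(γ t + γ t') by ring, integral_exp_neg_mul_Ici hadd, hP,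
      hz _ (12⁻¹ * γ t ^ 3 + s * γ t + (4⁻¹ * γ t' ^ 3)) (-((γ t + γ t') * s)) (by ring),
      hz _ (12⁻¹ * γ t ^ 3 + s * γ t) (4⁻¹ * γ t' ^ 3) rfl]
    field_simp
    ring
  · rw [kernelC, show -γ t' + -γ t = -(γ t + γ t') by ring, integral_exp_neg_mul_Ioi hadd, hP,
      hz _ (12⁻¹ * γ t ^ 3 + (12⁻¹ * γ t' ^ 3)) (-((γ t + γ t') * (0 : ℝ))) (by push_cast; ring),
      hz _ (12⁻¹ * γ t ^ 3) (12⁻¹ * γ t' ^ 3) rfl]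
    field_simp
    ring
  · rw [kernelBQL, show -γ t' + -γ t = -(γ t + γ t') by ring, integral_exp_neg_mul_Ici hadd, hP,
      hz _ (4⁻¹ * γ t ^ 3 + (12⁻¹ * γ t' ^ 3 + s * γ t')) (-((γ t + γ t') * s)) (by ring),
      hz _ (4⁻¹ * γ t ^ 3) (12⁻¹ * γ t' ^ 3 + s * γ t') rfl]
    field_simp
    ring
  · have hne : γ t - γ t' ≠ 0 := hw₀ (fun h => hpq.elim (by simp) fun h' => h' (hγ.injective h)) _
      (Or.inl rfl)
    rw [kernelBH_eq, show -γ t' + γ t = γ t - γ t' by ring,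
      integral_exp_intervalUnion hb hne, hP, Complex.ofReal_div]
    generalize ∑ j ∈ Finset.Icc 1 (2 * K), (-1) ^ j * Complex.exp ((γ t - γ t') * b j) = S
    rw [hz _ (12⁻¹ * γ t ^ 3 + -(τ / ((2 : ℝ) ^ ((2 : ℝ) / 3) : ℝ) * γ t ^ 2))
      (12⁻¹ * γ t' ^ 3 + τ / ((2 : ℝ) ^ ((2 : ℝ) / 3) : ℝ) * γ t' ^ 2 - s * γ t') (by ring)]
    field_simp
  · rw [kernelBABA_eq, show γ t' + γ t = γ t - -γ t' by ring,
      integral_exp_intervalUnion hb hne', show -γ t' + -γ t = -(γ t + γ t') by ring,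
      integral_exp_neg_mul_Ici hadd, hP, Complex.ofReal_div]
    generalize ∑ j ∈ Finset.Icc 1 (2 * K), (-1) ^ j * Complex.exp ((γ t - -γ t') * b j) = S
    rw [hz _ (4⁻¹ * γ t ^ 3 + 4⁻¹ * γ t' ^ 3) (-((γ t + γ t') * s)) (by ring),
      hz _ (4⁻¹ * γ t ^ 3) (4⁻¹ * γ t' ^ 3) rfl,
      hz (-(-γ t') ^ 3 / 12 + τ / ((2 : ℝ) ^ ((2 : ℝ) / 3) : ℝ) * (-γ t') ^ 2 -
        (-γ t ^ 3 / 12 + τ / ((2 : ℝ) ^ ((2 : ℝ) / 3) : ℝ) * γ t ^ 2))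
        (12⁻¹ * γ t ^ 3 + -(τ / ((2 : ℝ) ^ ((2 : ℝ) / 3) : ℝ) * γ t ^ 2))
      (12⁻¹ * γ t' ^ 3 + τ / ((2 : ℝ) ^ ((2 : ℝ) / 3) : ℝ) * γ t' ^ 2) (by ring)]
    field_simp
    ring

end ContourKernel

/-! ### Integrable form -/

section Integrable

theorem sum_Icc_one_eq_sum_fin (n : ℕ) (f : ℕ → ℂ) :
    ∑ j ∈ Finset.Icc 1 n, f j = ∑ j : Fin n, f (j.val + 1) := by
  induction n with
  | zero => simp
  | succ n ih => rw [Finset.sum_Icc_succ_top (by omega), ih, Fin.sum_univ_castSucc]; rfl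

theorem iiks_dotProduct (τ s : ℝ) (K : ℕ) (b : ℕ → ℝ) (i j : Fin 4) (ξ ζ : ℂ) :
    dotProduct (iiksF τ s K b i ξ) (iiksG τ s K b j ζ) =
      -Complex.exp (-ξ ^ 3 / 12) * chi 2 i * (Complex.exp (ζ ^ 3 / 12) * chi 3 j) +
      ((-Complex.exp (ξ ^ 3 / 4 - ξ * s) * chi 3 i - Complex.exp (ξ ^ 3 / 12) * chi 1 i) *
        (Complex.exp (-ζ ^ 3 / 12) * chi 0 j + Complex.exp (-ζ ^ 3 / 4 + ζ * s) * chi 2 j) +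
      ∑ k ∈ Finset.Icc 1 (2 * K),
        (-(-1) ^ k * (gFun τ b k ξ)⁻¹ * chi 3 i + (-1) ^ k * (hFun τ s b k ξ)⁻¹ * chi 0 i) *
        (gFun τ b k ζ * chi 2 j + hFun τ s b k ζ * chi 1 j)) := by
  rw [iiksF, iiksG, Matrix.cons_dotProduct_cons, Matrix.cons_dotProduct_cons, dotProduct,
    sum_Icc_one_eq_sum_fin]

/-- On the diagonal every term of the sum is, up to its sign, independent of `j`, and the number of
terms is even. -/
theorem sum_neg_one_pow_mul_inv_mul_self (K : ℕ) (b : ℕ → ℝ) (P Q ξ : ℂ) :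
    ∑ j ∈ Finset.Icc 1 (2 * K), (-1) ^ j * (Complex.exp (P - b j * ξ) / (cbrtTwo : ℂ))⁻¹ *
        (Complex.exp (Q - b j * ξ) / (cbrtTwo : ℂ)) = 0 := by
  have h : ∑ j ∈ Finset.Icc 1 (2 * K), (-1 : ℂ) ^ j = 0 := by
    induction K with
    | zero => simp
    | succ K ih =>
      rw [show 2 * (K + 1) = 2 * K + 1 + 1 by ring, Finset.sum_Icc_succ_top (by omega),
        Finset.sum_Icc_succ_top (by omega), ih]
      ring
  rw [sum_neg_one_pow_mul_inv_mul]
  simp [h]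

theorem blockM_eq_iiks (τ s : ℝ) (K : ℕ) (b : ℕ → ℝ) (i j : Fin 4) (ξ ζ : ℂ) :
    blockM τ s K b i j ξ ζ =
      dotProduct (iiksF τ s K b i ξ) (iiksG τ s K b j ζ) / (2 * Real.pi * Complex.I * (ξ - ζ)) := by
  have hz : ∀ A B C : ℂ, A = B + C → Complex.exp A = Complex.exp B * Complex.exp C :=
    fun A B C h => by rw [h, Complex.exp_add]
  have hs : ∀ F G : ℕ → ℂ, (∀ k, F k = -G k) → -∑ k ∈ Finset.Icc 1 (2 * K), F k =
    ∑ k ∈ Finset.Icc 1 (2 * K), G k := fun F G h => by simp [h]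
  rw [iiks_dotProduct]
  fin_cases i <;> fin_cases j <;> simp [blockM, chi, -mul_inv_rev]
  · rw [kernelHH, ← neg_div, hs]
    exact fun k => by ring
  · rw [kernelHA, ← neg_div, hs]
    exact fun k => by ring
  · rw [kernelQRQL, ← neg_div, hz _ (ξ ^ 3 / 12) (-ζ ^ 3 / 12) (by ring)]
  · rw [kernelQRA, ← neg_div, hz _ (ξ ^ 3 / 12) (-ζ ^ 3 / 4 + ζ * s) (by ring)]
  · rw [kernelC, ← neg_div, hz _ (-ξ ^ 3 / 12) (ζ ^ 3 / 12) (by ring)]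
  · rw [kernelBQL, ← neg_div, hz _ (ξ ^ 3 / 4 - ξ * s) (-ζ ^ 3 / 12) (by ring)]
  · rw [kernelBH, ← neg_div]
  · rw [kernelBABA, hz _ (ξ ^ 3 / 4 - ξ * s) (-ζ ^ 3 / 4 + ζ * s) (by ring), ← add_div, ← neg_div,
      neg_add]

theorem iiks_dotProduct_self (τ s : ℝ) (K : ℕ) (b : ℕ → ℝ) {i j : Fin 4}
    (hij : i.val % 2 = j.val % 2) (ξ : ℂ) :
    dotProduct (iiksF τ s K b i ξ) (iiksG τ s K b j ξ) = 0 := by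
  rw [iiks_dotProduct]
  fin_cases i <;> fin_cases j <;> simp [chi, hFun_eq, gFun_eq, -inv_div] at hij ⊢
  · exact sum_neg_one_pow_mul_inv_mul_self K b _ _ ξ
  · exact sum_neg_one_pow_mul_inv_mul_self K b _ _ ξ

end Integrable

/-! ### The determinant identity -/

section Assembly

variable {X : Type} [MeasurableSpace X] {μ : Measure X}

theorem inner_toL2_conj {f g : X → ℂ} (hf : MemLp (fun x => starRingEnd ℂ (f x)) 2 μ)
    (hg : MemLp g 2 μ) :
    ⟪toL2 μ fun x => starRingEnd ℂ (f x), toL2 μ g⟫_ℂ = ∫ x, f x * g x ∂μ := by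
  rw [inner_toL2_left hf]
  refine integral_congr_ae ?_
  filter_upwards [coeFn_toL2 hg] with x hx
  rw [hx, Complex.conj_conj]

theorem tsum_sumElim_inner_mul_inner {H H' : Type} [NormedAddCommGroup H] [InnerProductSpace ℂ H]
    [NormedAddCommGroup H'] [InnerProductSpace ℂ H'] {κ κ' : Type} (e : HilbertBasis κ ℂ H)
    (e' : HilbertBasis κ' ℂ H') (v w : H) (v' w' : H') :
    ∑' k, Sum.elim (fun k => ⟪v, e k⟫_ℂ) (fun k => ⟪v', e' k⟫_ℂ) k *
        Sum.elim (fun k => ⟪e k, w⟫_ℂ) (fun k => ⟪e' k, w'⟫_ℂ) k =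
      ⟪v, w⟫_ℂ + ⟪v', w'⟫_ℂ :=
  HasSum.tsum_eq (HasSum.sum (e.hasSum_inner_mul_inner _ _) (e'.hasSum_inner_mul_inner _ _))

theorem ae_legMeasure_ne (t : ℝ) : ∀ᵐ q ∂legMeasure, t ≠ q.2 := by
  have h : {q : Fin 4 × ℝ | ¬t ≠ q.2} = univ ×ˢ {t} := by
    ext q
    simp [eq_comm]
  rw [ae_iff, h, legMeasure, Measure.prod_prod]
  simp

theorem ae_prod_legMeasure_ne : ∀ᵐ p ∂legMeasure.prod legMeasure, p.1.2 ≠ p.2.2 := by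
  have hm : MeasurableSet {p : (Fin 4 × ℝ) × (Fin 4 × ℝ) | p.1.2 ≠ p.2.2} :=
    (measurableSet_eq_fun (measurable_snd.comp measurable_fst)
      (measurable_snd.comp measurable_snd)).compl
  exact (Measure.ae_prod_iff_ae_ae hm).mpr
    (Filter.Eventually.of_forall fun p => ae_legMeasure_ne p.2)

variable {γ : ℝ → ℂ} {τ s : ℝ} {K : ℕ} {b : ℕ → ℝ}

/-- `𝕄` is a bounded operator with a convergent Fredholm series, and its kernel can be replaced by
the sum of compositions, from which it differs on a null set. -/
theorem kernelM_spec (hγ : IsAiryContour γ) (hb : StrictMonoOn b (Icc 1 (2 * K))) :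
    (∃ T, IsIntegralOperator legMeasure (kernelM τ s K b γ) T) ∧
    FredholmConverges legMeasure (kernelM τ s K b γ) ∧
    fredholmDet legMeasure (kernelM τ s K b γ) = fredholmDet legMeasure fun p q =>
      ⟪toL2 (volume.restrict (intervalUnion K b)) fun x => starRingEnd ℂ (factorA₀ τ s γ p x),
        toL2 (volume.restrict (intervalUnion K b)) fun x => factorB₀ τ s γ x q⟫_ℂ +
      (⟪toL2 (volume.restrict (Ici s)) fun z => starRingEnd ℂ (factorA₂ s γ p z),
        toL2 (volume.restrict (Ici s)) fun z => factorB₂ s γ z q⟫_ℂ +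
      ⟪toL2 (volume.restrict (Ioi 0)) fun u => starRingEnd ℂ (factorA₁ γ p u),
        toL2 (volume.restrict (Ioi 0)) fun u => factorB₁ γ u q⟫_ℂ) := by
  obtain ⟨R, hR, hJR⟩ := exists_intervalUnion_subset K b
  obtain ⟨hA₀, hB₀⟩ :=
    isProductBounded_factor₀ (τ := τ) (s := s) hγ measurableSet_intervalUnion hJR hR
  obtain ⟨hA₁, hB₁⟩ := isProductBounded_factor₁ hγ
  obtain ⟨hA₂, hB₂⟩ := isProductBounded_factor₂ (s := s) hγ
  have hK := (hA₀.comp hB₀).add ((hA₂.comp hB₂).add (hA₁.comp hB₁))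
  have hdiag : ∀ᵐ p ∂legMeasure, _ :=
    Filter.Eventually.of_forall fun p => kernelM_eq (τ := τ) (s := s) hγ hb (p := p) (Or.inl rfl)
  have hoff := ae_prod_legMeasure_ne.mono fun p hp =>
    kernelM_eq (τ := τ) (s := s) hγ hb (p := p.1) (q := p.2) (Or.inr hp)
  refine ⟨?_, hK.fredholmConverges.congr hdiag hoff, ?_⟩
  · obtain ⟨T, hT⟩ := hK.exists_hasKernel
    exact ⟨T, hT.congr (Filter.Eventually.of_forall fun p => (ae_legMeasure_ne p.2).mono
      fun q hq => kernelM_eq hγ hb (Or.inr hq))⟩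
  · refine (fredholmDet_congr (K' := fun p q =>
      (∫ x in intervalUnion K b, factorA₀ τ s γ p x * factorB₀ τ s γ x q) +
      ((∫ z in Ici s, factorA₂ s γ p z * factorB₂ s γ z q) +
        ∫ u in Ioi (0 : ℝ), factorA₁ γ p u * factorB₁ γ u q)) hdiag hoff).trans ?_
    have hS := hA₀.conj.section_memLp.and (hA₁.conj.section_memLp.and (hA₂.conj.section_memLp.and
      (hB₀.swap.section_memLp.and (hB₁.swap.section_memLp.and hB₂.swap.section_memLp))))
    obtain ⟨e1, e2⟩ := ae_prod_of_conull hS fun p hp q hq =>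
      congrArg₂ (· + ·) (inner_toL2_conj hp.1 hq.2.2.2.1).symm (congrArg₂ (· + ·)
        (inner_toL2_conj hp.2.2.1 hq.2.2.2.2.2).symm (inner_toL2_conj hp.2.1 hq.2.2.2.2.1).symm)
    exact fredholmDet_congr e1 e2

/-- The determinant identity in the rescaled variables, with the invertibility and convergence
statements it presupposes. -/
theorem tacnodeKernelRescaled_spec (τ σ : ℝ) (hγ : IsAiryContour γ)
    (hb : StrictMonoOn b (Icc 1 (2 * K))) :
    (∃ T, IsIntegralOperator (volume.restrict (Ici (sigmaTilde σ))) airyKernel T) ∧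
    IsUnit (1 - airyOperator (sigmaTilde σ)) ∧
    FredholmConverges (volume.restrict (Ici (sigmaTilde σ))) airyKernel ∧
    tracyWidomF2 (sigmaTilde σ) ≠ 0 ∧
    FredholmConverges (volume.restrict (intervalUnion K b)) (tacnodeKernelRescaled τ σ) ∧
    fredholmDet legMeasure (kernelM τ (sigmaTilde σ) K b γ) = tracyWidomF2 (sigmaTilde σ) *
      fredholmDet (volume.restrict (intervalUnion K b)) (tacnodeKernelRescaled τ σ) := by
  obtain ⟨s, hs⟩ : ∃ s, s = sigmaTilde σ := ⟨_, rfl⟩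
  rw [← hs]
  obtain ⟨Bo, hBo⟩ := (isProductBounded_airyAi s 0).exists_hasKernel
  obtain ⟨Bt, hBt⟩ := (isProductBounded_airyAi s 0).swap.exists_hasKernel
  obtain ⟨hop, heq, hu⟩ := airyOperator_spec hBo hBt
  have hR : ∀ v, Ring.inverse (1 - airyOperator s) v -
      Bo (Bt (Ring.inverse (1 - airyOperator s) v)) = v := fun v => by
    have h := DFunLike.congr_fun (Ring.mul_inverse_cancel _ hu) v
    have h2 : ∀ w, airyOperator s w = Bo (Bt w) := fun w => by rw [heq]; rfl
    rw [mul_apply_eq_comp, sub_apply, h2] at h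
    exact h
  have hsol : ∀ v w, Ring.inverse (1 - airyOperator s) (w - Bo v) +
      Bo (v - Bt (Ring.inverse (1 - airyOperator s) (w - Bo v))) = w := fun v w => by
    have h := hR (w - Bo v)
    generalize Ring.inverse (1 - airyOperator s) (w - Bo v) = c at *
    rw [map_sub]
    rw [sub_eq_iff_eq_add] at h
    nth_rewrite 1 [h]
    abel
  obtain ⟨R, hR0, hJR⟩ := exists_intervalUnion_subset K b
  have D := blockFactorization_factors (τ := τ) hγ measurableSet_intervalUnion hJR hR0 hBo hBt
  obtain ⟨κ₀, _, ⟨e₀⟩⟩ := exists_countable_hilbertBasis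
    (Lp ℂ 2 ((volume : Measure ℝ).restrict (intervalUnion K b)))
  obtain ⟨κ₁, _, ⟨e₁⟩⟩ := exists_countable_hilbertBasis
    (Lp ℂ 2 ((volume : Measure ℝ).restrict (Ioi (0 : ℝ))))
  obtain ⟨κ₂, _, ⟨e₂⟩⟩ := exists_countable_hilbertBasis
    (Lp ℂ 2 ((volume : Measure ℝ).restrict (Ici s)))
  let _ : MeasurableSpace κ₀ := ⊤
  let _ : MeasurableSpace κ₁ := ⊤
  let _ : MeasurableSpace κ₂ := ⊤
  obtain ⟨hF, hFe⟩ := tracyWidomF2_eq hBo hBt e₁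
  -- the solution of `c₁ + Bt c₂ = b₁`, `c₂ + Bo c₁ = b₂`: `c₂ = (1 - Bo Bt)⁻¹ (b₂ - Bo b₁)` and
  -- `c₁ = b₁ - Bt c₂`
  have hc₂ := (D.field_b₂.sub (D.field_b₁.clm_apply Bo)).clm_apply
    (Ring.inverse (1 - airyOperator s))
  have hc₁ := D.field_b₁.sub (hc₂.clm_apply Bt)
  have hker := fun x y => tacnodeKernelRescaled_eq (τ := τ) hs hBo hBt hR x y
  refine ⟨⟨_, hop⟩, hu, hF, ?_, ?_, ?_⟩
  · rw [hFe]
    exact D.fredholmDet_ne_zero e₁ hR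
  · have hconv := fredholmConverges_tsum
      ((D.field_a₂.ellTwo_left e₂).sumElim (D.field_a₁.ellTwo_left e₁))
      ((hc₂.ellTwo_right e₂).sumElim (hc₁.ellTwo_right e₁))
    simp only [tsum_sumElim_inner_mul_inner, hker] at hconv
    exact hconv
  · have h1 := D.fredholmDet_eq e₀ e₁ e₂ hc₁ hc₂ (fun x => sub_add_cancel _ _) fun x => hsol _ _
    simp only [hker] at h1
    rw [← hFe] at h1
    exact (kernelM_spec hγ hb).2.2.trans h1

end Assembly

end

theorem mainTheorem4 (τ σ : ℝ) (K : ℕ) (a : ℕ → ℝ)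
    (ha : StrictMonoOn a (Set.Icc 1 (2 * K)))
    (γ : ℝ → ℂ) (hγ : IsAiryContour γ) :
    -- the tacnode kernel is well defined
    (∃ T, IsIntegralOperator (volume.restrict (Ici (sigmaTilde σ))) airyKernel T) ∧
    IsUnit (1 - airyOperator (sigmaTilde σ)) ∧
    (∀ t x : ℝ, MemLp (calA t x) 2 (volume.restrict (Ici (sigmaTilde σ)))) ∧
    -- `𝕄` is a bounded operator, and all the determinants exist
    (∃ T, IsIntegralOperator legMeasure
      (kernelM τ (sigmaTilde σ) K (rescaledEndpoint σ a) γ) T) ∧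
    FredholmConverges (volume.restrict (Ici (sigmaTilde σ))) airyKernel ∧
    FredholmConverges (volume.restrict (intervalUnion K a)) (tacnodeKernel τ σ) ∧
    FredholmConverges (volume.restrict (intervalUnion K (rescaledEndpoint σ a)))
      (tacnodeKernelRescaled τ σ) ∧
    FredholmConverges legMeasure (kernelM τ (sigmaTilde σ) K (rescaledEndpoint σ a) γ) ∧
    tracyWidomF2 (sigmaTilde σ) ≠ 0 ∧
    -- the gap probability, in the original and in the rescaled variables
    tacnodeGapProbability τ σ (intervalUnion K a) =
      (tracyWidomF2 (sigmaTilde σ))⁻¹ *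
        fredholmDet legMeasure (kernelM τ (sigmaTilde σ) K (rescaledEndpoint σ a) γ) ∧
    fredholmDet (volume.restrict (intervalUnion K (rescaledEndpoint σ a)))
        (tacnodeKernelRescaled τ σ) =
      (tracyWidomF2 (sigmaTilde σ))⁻¹ *
        fredholmDet legMeasure (kernelM τ (sigmaTilde σ) K (rescaledEndpoint σ a) γ) ∧
    -- the kernels of `𝕄` are integrable in the sense of Its, Izergin, Korepin and Slavnov
    (∀ (i j : Fin 4) (ξ ζ : ℂ),
      blockM τ (sigmaTilde σ) K (rescaledEndpoint σ a) i j ξ ζ =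
        dotProduct (iiksF τ (sigmaTilde σ) K (rescaledEndpoint σ a) i ξ)
            (iiksG τ (sigmaTilde σ) K (rescaledEndpoint σ a) j ζ)
          / (2 * Real.pi * Complex.I * (ξ - ζ))) ∧
    (∀ i j : Fin 4, i.val % 2 = j.val % 2 → ∀ ξ : ℂ,
      dotProduct (iiksF τ (sigmaTilde σ) K (rescaledEndpoint σ a) i ξ)
        (iiksG τ (sigmaTilde σ) K (rescaledEndpoint σ a) j ξ) = 0) := by
  have hc : cbrtTwo.toNNReal ≠ 0 := (Real.toNNReal_pos.mpr cbrtTwo_pos).ne'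
  have hb : StrictMonoOn (rescaledEndpoint σ a) (Icc 1 (2 * K)) := fun i hi j hj hij =>
    div_lt_div_of_pos_right (sub_lt_sub_right (ha hi hj hij) σ) cbrtTwo_pos
  obtain ⟨h1, h2, h3, h4, h5, h6⟩ := tacnodeKernelRescaled_spec τ σ hγ hb
  obtain ⟨k1, k2, -⟩ := kernelM_spec (τ := τ) (s := sigmaTilde σ) hγ hb
  have hφ := measurePreserving_rescaling σ K a
  have hres : tacnodeKernelRescaled τ σ = fun x y => ((cbrtTwo.toNNReal : ℝ) : ℂ) *
      tacnodeKernel τ σ (rescaling σ x) (rescaling σ y) := by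
    rw [Real.coe_toNNReal _ cbrtTwo_pos.le]
    rfl
  have hdet : fredholmDet (volume.restrict (intervalUnion K (rescaledEndpoint σ a)))
      (tacnodeKernelRescaled τ σ) = (tracyWidomF2 (sigmaTilde σ))⁻¹ *
        fredholmDet legMeasure (kernelM τ (sigmaTilde σ) K (rescaledEndpoint σ a) γ) := by
    rw [h6, inv_mul_cancel_left₀ h4]
  refine ⟨h1, h2, memLp_calA, k1, h3, fredholmConverges_of_comp hφ hc (hres ▸ h5), h5, k2, h4,
    ?_, hdet, blockM_eq_iiks τ _ K _, fun i j => iiks_dotProduct_self τ _ K _⟩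
  rw [← hdet, tacnodeGapProbability, hres]
  exact (tsum_congr (fredholmTerm_comp hφ _)).symm
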